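/- Conventions. All vector spaces are over $\mathbb C$. For a locally convex space $X$, let $X^\star$ be the space of continuous linear functionals on $X$ with the topology of uniform convergence on totally bounded subsets of $X$. $X$ is *stereotype* if the natural map $X\to (X^\star)^\star$ is an isomorphism of locally convex spaces. A *Brauner space* is a locally convex space isomorphic to $X^\star$ for some Fréchet space $X$. A continuous linear map $\varphi:X\to Y$ is *nuclear* if $\varphi(x)=\sum_{n}\lambda_n f_n(x)b_n$ for all $x\in X$, with $\lambda_n\ge 0$, $\sum\lambda_n<\infty$, $(f_n)$ an equicontinuous sequence of functionals on $X$, and $(b_n)$ a sequence in a Banach disk of $Y$ (a bounded closed absolutely convex set $B$ such that $\bigcup_{r>0}rB$ is complete in the norm with unit ball $B$). A stereotype space is *nuclear* if every continuous linear map from it into a Banach space is nuclear. Let $G$ be a compactly generated Stein group, i.e. a (Hausdorff, finite-dimensional) complex Lie group whose underlying manifold is a Stein manifold and for which there is a compact set $K\subseteq G$ with $G=\bigcup_{n\in\mathbb N}K^n$. Let $\mathcal O(G)$ be the space of holomorphic functions on $G$ with the topology of uniform convergence on compact sets. A *semicharacter* is a locally bounded function $f:G\to[1,\infty)$ with $f(xy)\le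 f(x)f(y)$; put $f^{\blacksquare}=\{u\in\mathcal O(G): |u(x)|\le f(x)\ \forall x\in G\}$. Let $\mathcal O_{\exp}(G)=\bigcup_f f^{\blacksquare}$ be the space of holomorphic functions of exponential type, i.e. those bounded by some semicharacter. For $D=f^{\blacksquare}$ give $\mathbb C D=\bigcup_{r>0} rD$ the topology in which a set is closed iff its intersection with each $rD$, $r>0$, is closed in $rD$ (with the topology of $\mathcal O(G)$), and give $\mathcal O_{\exp}(G)$ the topology of the locally convex inductive limit of these spaces $\mathbb C D$, i.e. the finest locally convex topology making all inclusions $\mathbb C D\to\mathcal O_{\exp}(G)$ continuous. Write $\mathcal O^\star_{\exp}(G)=(\mathcal O_{\exp}(G))^\star$. Theorem. For every compactly generated Stein group $G$, the space $\mathcal O_{\exp}(G)$ is a nuclear Brauner space, and its dual space $\mathcal O^\star_{\exp}(G)$ is a nuclear Fréchet space. Moreover, let $K$ be a compact neighbourhood of the identity with $G=\bigcup_{n}K^n$, and for an integer $N\ge1$ put $E_N=\{u\in\mathcal O(G): |u(x)|\le N^n \text{ for all } n\ge 1,\ x\in K^n\}$. Then for every $N\ge 1$ there is an integer $M>N$ such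 that the inclusion $\mathbb C E_N\to\mathbb C E_M$ of the spaces normed by the unit balls $E_N$ and $E_M$ is absolutely summing: there is $L>0$ such that for all finite families $u_1,\dots,u_l\in\mathbb C E_N$, $$\sum_{i=1}^l\|u_i\|_{E_M}\le L\cdot\sup_{\alpha\in (E_N)^\circ}\sum_{i=1}^l|\alpha(u_i)|,$$ where $(E_N)^\circ$ is the set of continuous linear functionals $\alpha$ on $\mathcal O(G)$ with $|\alpha|\le1$ on $E_N$. -/

import Mathlib

open scoped Manifold ContDiff Topology Pointwise

universe u v w

/-! ## Locally convex spaces: stereotype duality, Fréchet, Brauner and nuclear spaces -/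

section StereotypeSpaces

/-- The stereotype dual `X^⋆`: the continuous linear functionals on `X` with the topology of
uniform convergence on the totally bounded subsets of `X`. -/
abbrev StereotypeDual (X : Type u) [AddCommGroup X] [Module ℂ X] [TopologicalSpace X]
    [IsTopologicalAddGroup X] : Type u :=
  UniformConvergenceCLM (E := X) (RingHom.id ℂ) ℂ
    {S : Set X | @TotallyBounded X (IsTopologicalAddGroup.rightUniformSpace X) S}

theorem StereotypeDual.continuous_eval (X : Type u) [AddCommGroup X] [Module ℂ X]
    [TopologicalSpace X] [IsTopologicalAddGroup X] (x : X) :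
    Continuous fun f : StereotypeDual X => f x := by
  have h : ⋃₀ {S : Set X | @TotallyBounded X (IsTopologicalAddGroup.rightUniformSpace X) S}
      = Set.univ := by
    refine Set.eq_univ_of_forall fun y => Set.mem_sUnion.2 ⟨{y}, ?_, rfl⟩
    exact @totallyBounded_singleton X (IsTopologicalAddGroup.rightUniformSpace X) y
  exact (UniformConvergenceCLM.continuousEvalConst (RingHom.id ℂ) ℂ _ h).continuous_eval_const x

/-- The natural map `X → (X^⋆)^⋆`, `x ↦ (f ↦ f x)`. -/
noncomputable def stereotypeEval (X : Type u) [AddCommGroup X] [Module ℂ X] [TopologicalSpace X]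
    [IsTopologicalAddGroup X] (x : X) : StereotypeDual (StereotypeDual X) :=
  UniformConvergenceCLM.ofFun (RingHom.id ℂ) ℂ _
    { toFun := fun f : StereotypeDual X => f x
      map_add' := fun _ _ => rfl
      map_smul' := fun _ _ => rfl
      cont := StereotypeDual.continuous_eval X x }

/-- A locally convex space is stereotype if the natural map to its second stereotype dual
(which is always linear) is an isomorphism of locally convex spaces. -/
structure IsStereotype (X : Type u) [AddCommGroup X] [Module ℂ X] [TopologicalSpace X]
    [IsTopologicalAddGroup X] : Prop where
  continuousSMul : ContinuousSMul ℂ X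
  locallyConvex : LocallyConvexSpace ℝ X
  isHomeomorph : IsHomeomorph (stereotypeEval X)

/-- Fréchet spaces: complete metrizable locally convex spaces. -/
structure IsFrechetSpace (X : Type u) [AddCommGroup X] [Module ℂ X] [TopologicalSpace X]
    [IsTopologicalAddGroup X] : Prop where
  continuousSMul : ContinuousSMul ℂ X
  locallyConvex : LocallyConvexSpace ℝ X
  metrizable : TopologicalSpace.MetrizableSpace X
  complete : @CompleteSpace X (IsTopologicalAddGroup.rightUniformSpace X)

/-- Brauner spaces: the stereotype duals of Fréchet spaces. -/
def IsBraunerSpace (Y : Type u) [AddCommGroup Y] [Module ℂ Y] [TopologicalSpace Y] : Prop :=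
  ∃ (X : Type u) (_ : AddCommGroup X) (_ : Module ℂ X) (_ : TopologicalSpace X)
    (_ : IsTopologicalAddGroup X),
    IsFrechetSpace X ∧ Nonempty (Y ≃L[ℂ] StereotypeDual X)

/-- A Banach disk: a bounded closed absolutely convex set `B` such that the space
`⋃ r > 0, r • B` is complete for the norm with unit ball `B`. -/
structure IsBanachDisk {Y : Type u} [AddCommGroup Y] [Module ℂ Y] [TopologicalSpace Y]
    (B : Set Y) : Prop where
  nonempty : B.Nonempty
  balanced : Balanced ℂ B
  convex : Convex ℝ B
  isClosed : IsClosed B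
  bounded : Bornology.IsVonNBounded ℂ B
  complete : ∀ x : ℕ → Y, (∀ n, ∃ r : ℝ, 0 < r ∧ x n ∈ (r : ℂ) • B) →
    (∀ ε : ℝ, 0 < ε → ∃ n₀, ∀ m ≥ n₀, ∀ n ≥ n₀, x m - x n ∈ (ε : ℂ) • B) →
    ∃ a : Y, (∃ r : ℝ, 0 < r ∧ a ∈ (r : ℂ) • B) ∧
      ∀ ε : ℝ, 0 < ε → ∃ n₀, ∀ n ≥ n₀, x n - a ∈ (ε : ℂ) • B

/-- A nuclear map: `φ x = ∑ cₙ fₙ(x) bₙ` with an equicontinuous sequence of functionals `fₙ`,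
a sequence `bₙ` in a Banach disk, and a summable sequence `cₙ ≥ 0`. -/
def IsNuclearMap {X : Type u} {Y : Type w} [AddCommGroup X] [Module ℂ X] [TopologicalSpace X]
    [AddCommGroup Y] [Module ℂ Y] [TopologicalSpace Y] (φ : X →L[ℂ] Y) : Prop :=
  ∃ (f : ℕ → X →L[ℂ] ℂ) (b : ℕ → Y) (c : ℕ → ℝ) (B : Set Y),
    Equicontinuous (fun n (x : X) => f n x) ∧ IsBanachDisk B ∧ (∀ n, b n ∈ B) ∧
    (∀ n, 0 ≤ c n) ∧ Summable c ∧
    ∀ x, HasSum (fun n => (c n : ℂ) • f n x • b n) (φ x)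

/-- A stereotype space is nuclear if each of its continuous linear maps into a Banach space is
nuclear. -/
structure IsNuclearSpace (X : Type u) [AddCommGroup X] [Module ℂ X] [TopologicalSpace X]
    [IsTopologicalAddGroup X] : Prop where
  stereotype : IsStereotype X
  nuclear_maps : ∀ (Y : Type w) [NormedAddCommGroup Y] [NormedSpace ℂ Y] [CompleteSpace Y]
    (φ : X →L[ℂ] Y), IsNuclearMap φ

end StereotypeSpaces

/-! ## The spaces generated by absolutely convex sets -/

section GeneratedSpaces

variable {X : Type u} [AddCommGroup X] [Module ℂ X]

/-- `ℂD = ⋃ r > 0, r • D`, for an absolutely convex set `D`. -/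
def diskSpan (D : Set X) : Set X := {x | ∃ r : ℝ, 0 < r ∧ x ∈ (r : ℂ) • D}

theorem smul_subset_diskSpan (D : Set X) (r : {r : ℝ // 0 < r}) :
    ((r : ℝ) : ℂ) • D ⊆ diskSpan D := fun _ hx => ⟨r, r.2, hx⟩

/-- The Kelley topology on `ℂD` generated by the sets `r • D`. -/
@[reducible]
def kelleyTopology [TopologicalSpace X] (D : Set X) : TopologicalSpace (diskSpan D) :=
  ⨆ r : {r : ℝ // 0 < r},
    TopologicalSpace.coinduced (Set.inclusion (smul_subset_diskSpan D r)) inferInstance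

/-- A set is closed in the Kelley topology iff its trace on each `r • D` is closed in `r • D`. -/
theorem isClosed_kelleyTopology_iff [TopologicalSpace X] (D : Set X) (M : Set (diskSpan D)) :
    @IsClosed _ (kelleyTopology D) M ↔
      ∀ r : {r : ℝ // 0 < r}, IsClosed (Set.inclusion (smul_subset_diskSpan D r) ⁻¹' M) := by
  unfold kelleyTopology
  rw [isClosed_iSup_iff]
  exact forall_congr' fun r => isClosed_coinduced

/-- For absolutely convex sets `A`, `B`: the space `ℂA` with the norm whose unit ball is `A`
is contained in `ℂB` with the norm whose unit ball is `B`, and the inclusion is absolutely summing: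
`∑ ‖uᵢ‖_B ≤ L * sup_{α ∈ A°} ∑ |α(uᵢ)|` for all finite families in `ℂA`, where `A°` is the polar
of `A` in the dual of `X`. -/
def IsAbsolutelySummingInclusion [TopologicalSpace X] (A B : Set X) : Prop :=
  diskSpan A ⊆ diskSpan B ∧
  ∃ L : ℝ, 0 < L ∧ ∀ (l : ℕ) (x : Fin l → X), (∀ i, x i ∈ diskSpan A) →
    ∀ S : ℝ, (∀ α : X →L[ℂ] ℂ, (∀ a ∈ A, ‖α a‖ ≤ 1) → ∑ i, ‖α (x i)‖ ≤ S) →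
      ∑ i, gauge B (x i) ≤ L * S

end GeneratedSpaces

/-! ## Holomorphic functions and Stein manifolds -/

section Stein

variable (E : Type v) [NormedAddCommGroup E] [NormedSpace ℂ E]
variable (M : Type u) [TopologicalSpace M] [ChartedSpace E M]

/-- The space `𝒪(M)` of holomorphic functions on a complex manifold `M` modelled on `E`. Its
topology is that of uniform convergence on compact sets, inherited from `C(M, ℂ)`. -/
def holomorphicFunctions : Submodule ℂ C(M, ℂ) where
  carrier := {u | MDifferentiable 𝓘(ℂ, E) 𝓘(ℂ, ℂ) (u : M → ℂ)}
  add_mem' := fun {_ _} hu hv => hu.add hv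
  zero_mem' := mdifferentiable_const
  smul_mem' := fun c _ hu => hu.const_smul c

/-- The holomorphically convex hull of a set `K`, which is meant to be compact: the points `x` with
`|u x| ≤ max_K |u|` for every holomorphic function `u`. -/
def holomorphicHull (K : Set M) : Set M :=
  {x | ∀ u ∈ holomorphicFunctions E M, ∃ y ∈ K, ‖u x‖ ≤ ‖u y‖}

/-- Stein manifolds. -/
structure IsSteinManifold : Prop where
  separability : ∀ x y : M, x ≠ y → ∃ u ∈ holomorphicFunctions E M, u x ≠ u y
  /-- Every point has a holomorphic chart whose coordinates, in some basis of `E`, are restrictions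
  of holomorphic functions on the whole of `M`. -/
  uniformization : ∀ x : M, ∃ u : Fin (Module.finrank ℂ E) → C(M, ℂ),
    (∀ i, u i ∈ holomorphicFunctions E M) ∧
    ∃ e ∈ IsManifold.maximalAtlas 𝓘(ℂ, E) ω M, x ∈ e.source ∧
      ∃ b : Module.Basis (Fin (Module.finrank ℂ E)) ℂ E,
        ∀ y ∈ e.source, ∀ i, b.repr (e y) i = u i y
  convexity : ∀ K : Set M, IsCompact K → IsCompact (holomorphicHull E M K)

end Stein

/-! ## Functions of exponential type -/

section ExponentialType

/-- The group `G` is generated by a compact set `K`, in the sense that `G = ⋃ n, K ^ n`. -/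
def IsCompactlyGeneratedGroup (G : Type u) [TopologicalSpace G] [Group G] : Prop :=
  ∃ K : Set G, IsCompact K ∧ ⋃ n : ℕ, K ^ n = Set.univ

/-- Semicharacters: locally bounded submultiplicative functions `G → [1, ∞)`. -/
structure IsSemicharacter {G : Type u} [TopologicalSpace G] [Group G] (f : G → ℝ) : Prop where
  one_le : ∀ x, 1 ≤ f x
  locallyBounded : ∀ x, ∃ U ∈ 𝓝 x, ∃ C : ℝ, ∀ y ∈ U, f y ≤ C
  submul : ∀ x y, f (x * y) ≤ f x * f y

theorem IsSemicharacter.const {G : Type u} [TopologicalSpace G] [Group G] {C : ℝ} (hC : 1 ≤ C) :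
    IsSemicharacter fun _ : G => C where
  one_le _ := hC
  locallyBounded _ := ⟨Set.univ, Filter.univ_mem, C, fun _ _ => le_rfl⟩
  submul _ _ := by nlinarith

theorem IsSemicharacter.mul {G : Type u} [TopologicalSpace G] [Group G] {f g : G → ℝ}
    (hf : IsSemicharacter f) (hg : IsSemicharacter g) : IsSemicharacter fun x => f x * g x where
  one_le x := one_le_mul_of_one_le_of_one_le (hf.one_le x) (hg.one_le x)
  locallyBounded x := by
    obtain ⟨U, hU, C, hC⟩ := hf.locallyBounded x
    obtain ⟨V, hV, D, hD⟩ := hg.locallyBounded x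
    refine ⟨U ∩ V, Filter.inter_mem hU hV, C * D, fun y hy => ?_⟩
    have h1 := hf.one_le y
    have h2 := hg.one_le y
    exact mul_le_mul (hC y hy.1) (hD y hy.2) (by linarith) (by linarith [hC y hy.1])
  submul x y := by
    have h1 := hf.one_le x
    have h2 := hf.one_le y
    have h3 := hg.one_le (x * y)
    calc f (x * y) * g (x * y) ≤ (f x * f y) * (g x * g y) :=
          mul_le_mul (hf.submul x y) (hg.submul x y) (by linarith) (by positivity)
      _ = f x * g x * (f y * g y) := by ring

variable (E : Type v) [NormedAddCommGroup E] [NormedSpace ℂ E]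
variable (G : Type u) [TopologicalSpace G] [ChartedSpace E G] [Group G]

variable {G} in
/-- The rectangle of `f`: all holomorphic functions bounded by `f`. -/
def rectangle (f : G → ℝ) : Set (holomorphicFunctions E G) := {u | ∀ x, ‖u.1 x‖ ≤ f x}

/-- The holomorphic functions of exponential type, i.e. those bounded by some semicharacter. -/
def expTypeFunctions : Submodule ℂ C(G, ℂ) where
  carrier := {u | u ∈ holomorphicFunctions E G ∧
    ∃ f : G → ℝ, IsSemicharacter f ∧ ∀ x, ‖u x‖ ≤ f x}
  add_mem' := by
    rintro u v ⟨hu', f, hf, hu⟩ ⟨hv', g, hg, hv⟩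
    refine ⟨(holomorphicFunctions E G).add_mem hu' hv', _,
      (IsSemicharacter.const (G := G) (C := 2) one_le_two).mul (hf.mul hg), fun x => ?_⟩
    have h1 := hf.one_le x
    have h2 := hg.one_le x
    calc ‖u x + v x‖ ≤ ‖u x‖ + ‖v x‖ := norm_add_le _ _
      _ ≤ f x + g x := add_le_add (hu x) (hv x)
      _ ≤ 2 * (f x * g x) := by nlinarith
  zero_mem' := ⟨(holomorphicFunctions E G).zero_mem, _, IsSemicharacter.const le_rfl,
    fun x => by simp⟩
  smul_mem' := by
    rintro c u ⟨hu', f, hf, hu⟩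
    refine ⟨(holomorphicFunctions E G).smul_mem c hu', _,
      (IsSemicharacter.const (G := G) (le_max_left 1 ‖c‖)).mul hf, fun x => ?_⟩
    calc ‖c * u x‖ = ‖c‖ * ‖u x‖ := norm_mul _ _
      _ ≤ max 1 ‖c‖ * f x := mul_le_mul (le_max_right _ _) (hu x) (norm_nonneg _) (by positivity)

/-- The space `𝒪_exp(G)` of holomorphic functions of exponential type, as a vector space without
the topology induced from `C(G, ℂ)`. -/
def OExp : Type u := expTypeFunctions E G

noncomputable instance : AddCommGroup (OExp E G) :=
  inferInstanceAs (AddCommGroup (expTypeFunctions E G))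

noncomputable instance : Module ℂ (OExp E G) := inferInstanceAs (Module ℂ (expTypeFunctions E G))

variable {G} in
/-- The inclusion of `ℂD` into `𝒪_exp(G)`, where `D` is the rectangle of a semicharacter. -/
def rectangleInclusion {f : G → ℝ} (hf : IsSemicharacter f)
    (u : diskSpan (rectangle E f)) : OExp E G :=
  ⟨u.1.1, by
    obtain ⟨r, -, v, hv, huv⟩ := u.2
    have h : (r : ℂ) • v.1 ∈ expTypeFunctions E G :=
      (expTypeFunctions E G).smul_mem _ ⟨v.2, f, hf, hv⟩
    rw [← huv]
    exact h⟩

/-- The locally convex topologies on `𝒪_exp(G)` for which the inclusion of `ℂD`, with its Kelley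
topology, is continuous for the rectangle `D` of any semicharacter. -/
def oExpAdmissibleTopologies : Set (TopologicalSpace (OExp E G)) :=
  {t | @IsTopologicalAddGroup _ t _ ∧ @ContinuousSMul ℂ _ _ _ t ∧ @LocallyConvexSpace ℝ _ _ _ _ _ t ∧
    ∀ (f : G → ℝ) (hf : IsSemicharacter f),
      @Continuous _ _ (kelleyTopology (rectangle E f)) t (rectangleInclusion E hf)}

/-- The topology of `𝒪_exp(G)`: the locally convex inductive limit of the spaces `ℂD`, i.e. the
finest locally convex topology for which the inclusions of the spaces `ℂD` are continuous. -/
instance : TopologicalSpace (OExp E G) := sInf (oExpAdmissibleTopologies E G)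

instance : IsTopologicalAddGroup (OExp E G) :=
  topologicalAddGroup_sInf fun _ ht => ht.1

instance : ContinuousSMul ℂ (OExp E G) :=
  continuousSMul_sInf fun _ ht => ht.2.1

instance : LocallyConvexSpace ℝ (OExp E G) :=
  LocallyConvexSpace.sInf fun _ ht => ht.2.2.1

/-- The topology of `𝒪_exp(G)` is itself admissible, hence the finest admissible topology. -/
theorem oExp_topology_mem :
    (inferInstance : TopologicalSpace (OExp E G)) ∈ oExpAdmissibleTopologies E G :=
  ⟨inferInstance, inferInstance, inferInstance, fun f hf =>
    continuous_sInf_rng.2 fun _ ht => ht.2.2.2 f hf⟩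

variable {G} in
/-- The rectangle `E_N = {u : |u| ≤ N ^ n on K ^ n for all n ≥ 1}`. -/
def powerRectangle (K : Set G) (N : ℕ) : Set (holomorphicFunctions E G) :=
  {u | ∀ n : ℕ, 1 ≤ n → ∀ x ∈ K ^ n, ‖u.1 x‖ ≤ (N : ℝ) ^ n}

end ExponentialType

section LocalEstimate

open Metric

/-- Finite `R / 2 ^ k`-nets of `closedBall 0 R` whose cardinality grows at most exponentially. -/
theorem exists_finset_net_closedBall (E : Type v) [NormedAddCommGroup E] [NormedSpace ℂ E]
    [FiniteDimensional ℂ E] : ∃ m : ℕ, 1 ≤ m ∧ ∀ R : ℝ, 0 < R → ∀ k : ℕ, ∃ F : Finset E,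
      F.card ≤ m ^ k ∧ ∀ y ∈ closedBall (0 : E) R, ∃ x ∈ F, dist y x ≤ R / 2 ^ k := by
  classical
  have : ProperSpace E := FiniteDimensional.proper ℂ E
  obtain ⟨t, -, ht, hcov⟩ := (isCompact_closedBall (0 : E) 1).finite_cover_balls
    (e := 1 / 2) (by norm_num)
  lift t to Finset E using ht
  have htne : t.Nonempty := by
    obtain ⟨x, hx, -⟩ := Set.mem_iUnion₂.1 (hcov (mem_closedBall_self zero_le_one))
    exact ⟨x, hx⟩
  refine ⟨t.card, htne.card_pos, fun R hR k => ?_⟩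
  induction k with
  | zero => exact ⟨{0}, by simp, fun y hy => ⟨0, by simp, by simpa using hy⟩⟩
  | succ k ih =>
    obtain ⟨F, hF, hcovF⟩ := ih
    refine ⟨Finset.image₂ (fun x z => x + ((R / 2 ^ k : ℝ) : ℂ) • z) F t, ?_, fun y hy => ?_⟩
    · rw [pow_succ]
      exact (Finset.card_image₂_le _ _ _).trans (Nat.mul_le_mul_right _ hF)
    · obtain ⟨x, hx, hxy⟩ := hcovF y hy
      have hs : 0 < R / 2 ^ k := by positivity
      have hs' : ((R / 2 ^ k : ℝ) : ℂ) ≠ 0 := by exact_mod_cast hs.ne'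
      have hn : ‖((R / 2 ^ k : ℝ) : ℂ)‖ = R / 2 ^ k := by
        rw [Complex.norm_real, Real.norm_of_nonneg hs.le]
      have hmem : ((R / 2 ^ k : ℝ) : ℂ)⁻¹ • (y - x) ∈ closedBall (0 : E) 1 := by
        rw [mem_closedBall_zero_iff, norm_smul, norm_inv, hn, inv_mul_le_iff₀ hs, mul_one,
          ← dist_eq_norm]
        exact hxy
      obtain ⟨z, hz, hyz⟩ := Set.mem_iUnion₂.1 (hcov hmem)
      refine ⟨_, Finset.mem_image₂_of_mem hx hz, ?_⟩
      have : y - (x + ((R / 2 ^ k : ℝ) : ℂ) • z)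
          = ((R / 2 ^ k : ℝ) : ℂ) • (((R / 2 ^ k : ℝ) : ℂ)⁻¹ • (y - x) - z) := by
        rw [smul_sub, smul_inv_smul₀ hs']; abel
      rw [dist_eq_norm, this, norm_smul, hn, ← dist_eq_norm, pow_succ]
      have := (mem_ball.1 hyz).le
      calc R / 2 ^ k * dist _ z ≤ R / 2 ^ k * (1 / 2) := by gcongr
        _ = _ := by field_simp

/-- The nets of a subset of a ball can be chosen inside of the subset. -/
theorem exists_finset_net_subset (E : Type v) [NormedAddCommGroup E] [NormedSpace ℂ E]
    [FiniteDimensional ℂ E] : ∃ m : ℕ, 1 ≤ m ∧ ∀ R : ℝ, 0 < R → ∀ k : ℕ,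
      ∀ S : Set E, S.Nonempty → S ⊆ closedBall 0 R → ∃ F : Finset E, F.Nonempty ∧
      F.card ≤ m ^ k ∧ (∀ x ∈ F, x ∈ S) ∧ ∀ y ∈ S, ∃ x ∈ F, dist y x ≤ 2 * (R / 2 ^ k) := by
  classical
  obtain ⟨m, hm, h⟩ := exists_finset_net_closedBall E
  refine ⟨m, hm, fun R hR k S hS hSR => ?_⟩
  obtain ⟨F, hF, hcov⟩ := h R hR k
  obtain ⟨s₀, hs₀⟩ := hS
  have hch : ∀ x : E, ∃ s ∈ S, (∃ y ∈ S, dist y x ≤ R / 2 ^ k) → dist s x ≤ R / 2 ^ k := by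
    intro x
    by_cases hx : ∃ y ∈ S, dist y x ≤ R / 2 ^ k
    · obtain ⟨y, hy, hyx⟩ := hx
      exact ⟨y, hy, fun _ => hyx⟩
    · exact ⟨s₀, hs₀, fun h => absurd h hx⟩
  choose g hgS hg using hch
  have hcov' : ∀ y ∈ S, ∃ x ∈ F.image g, dist y x ≤ 2 * (R / 2 ^ k) := fun y hy => by
    obtain ⟨x, hx, hyx⟩ := hcov y (hSR hy)
    refine ⟨g x, Finset.mem_image_of_mem _ hx, ?_⟩
    have := hg x ⟨y, hy, hyx⟩
    linarith [dist_triangle_right y (g x) x]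
  refine ⟨F.image g, ?_, Finset.card_image_le.trans hF, ?_, hcov'⟩
  · obtain ⟨x, hx, -⟩ := hcov' s₀ hs₀
    exact ⟨x, hx⟩
  · intro x hx
    obtain ⟨z, -, rfl⟩ := Finset.mem_image.1 hx
    exact hgS z

/-- A bounded holomorphic function is Lipschitz at the center of a ball. -/
theorem norm_sub_le_of_differentiableOn_ball {E : Type v} [NormedAddCommGroup E] [NormedSpace ℂ E]
    {f : E → ℂ} {x y : E} {r A : ℝ} (hf : DifferentiableOn ℂ f (ball x r))
    (hA : ∀ z ∈ ball x r, ‖f z‖ ≤ A) (hy : y ∈ ball x r) :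
    ‖f y - f x‖ ≤ 2 * A / r * dist y x := by
  have hx : x ∈ ball x r := mem_ball_self (pos_of_mem_ball hy)
  rw [← dist_eq_norm]
  refine Complex.dist_le_div_mul_dist_of_mapsTo_ball hf (fun z hz => ?_) hy
  rw [mem_closedBall, dist_eq_norm]
  linarith [norm_sub_le (f z) (f x), hA z hz, hA x hx]

/-- The values of a bounded holomorphic function on a smaller ball are controlled by an absolutely
convergent series of its values on a fixed sequence of points of the larger ball. -/
theorem exists_seq_norm_le_tsum_of_differentiableOn_ball (E : Type v) [NormedAddCommGroup E]
    [NormedSpace ℂ E] [FiniteDimensional ℂ E] {R : ℝ} (hR : 0 < R) :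
    ∃ (y : ℕ → E) (c : ℕ → ℝ), (∀ j, y j ∈ ball (0 : E) R) ∧ (∀ j, 0 ≤ c j) ∧ Summable c ∧
      ∀ f : E → ℂ, DifferentiableOn ℂ f (ball 0 R) → ∀ A : ℝ, (∀ x ∈ ball (0 : E) R, ‖f x‖ ≤ A) →
        ∀ x ∈ ball (0 : E) (R / 2), ‖f x‖ ≤ ∑' j, c j * ‖f (y j)‖ := by
  obtain ⟨m, hm, hnet⟩ := exists_finset_net_subset E
  obtain ⟨q, hq⟩ := pow_unbounded_of_one_lt (32 * m : ℝ) (one_lt_two)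
  have hm' : (1 : ℝ) ≤ m := by exact_mod_cast hm
  set ε : ℝ := 16 / 2 ^ q with hε
  have hεpos : 0 < ε := by positivity
  have hεm : ε * m ≤ 1 / 2 := by
    rw [hε, div_mul_eq_mul_div, div_le_iff₀ (by positivity)]; linarith
  have hε1 : ε ≤ 1 / 2 := by nlinarith
  set r : ℕ → ℝ := fun k => R * (1 - 1 / 2 ^ (k + 1)) with hr
  have hgap : ∀ k, r k + R / 2 ^ (k + 2) = r (k + 1) := fun k => by
    simp only [hr, pow_succ]; field_simp; ring
  have hrpos : ∀ k, 0 < r k := fun k => by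
    have : (1 : ℝ) / 2 ^ (k + 1) < 1 := by
      rw [div_lt_one (by positivity)]; exact one_lt_pow₀ one_lt_two (by omega)
    exact mul_pos hR (by linarith)
  have hrR : ∀ k, r k < R := fun k => by
    have : (0 : ℝ) < 1 / 2 ^ (k + 1) := by positivity
    simp only [hr]; nlinarith
  have hF : ∀ k, ∃ F : Finset E, F.Nonempty ∧ F.card ≤ m ^ (k + q) ∧ (∀ x ∈ F, x ∈ ball 0 (r k)) ∧
      ∀ y ∈ ball 0 (r k), ∃ x ∈ F, dist y x ≤ 2 * (R / 2 ^ (k + q)) := fun k =>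
    hnet R hR (k + q) (ball 0 (r k)) ⟨0, mem_ball_self (hrpos k)⟩
      (ball_subset_closedBall.trans (closedBall_subset_closedBall (hrR k).le))
  choose F hFne hFcard hFsub hFcov using hF
  have : ∀ k, Nonempty (F k) := fun k => (hFne k).to_subtype
  have : Infinite (Σ k, F k) := Infinite.of_surjective (Sigma.fst) fun k =>
    ⟨⟨k, Classical.arbitrary _⟩, rfl⟩
  obtain ⟨eqv⟩ := nonempty_equiv_of_countable (α := ℕ) (β := Σ k, F k)
  let c' : (Σ k, F k) → ℝ := fun i => ε ^ i.1
  let y' : (Σ k, F k) → E := fun i => i.2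
  have hc' : Summable c' := by
    refine (summable_sigma_of_nonneg fun i => by positivity).2
      ⟨fun k => (hasSum_fintype _).summable, ?_⟩
    refine Summable.of_nonneg_of_le (fun k => tsum_nonneg fun _ => by positivity) (fun k => ?_)
      (summable_geometric_two.mul_left ((m : ℝ) ^ q))
    rw [tsum_fintype]
    simp only [c', Finset.sum_const, Finset.card_univ, Fintype.card_coe, nsmul_eq_mul]
    have : ((F k).card : ℝ) ≤ (m : ℝ) ^ (k + q) := by exact_mod_cast hFcard k
    calc ((F k).card : ℝ) * ε ^ k ≤ (m : ℝ) ^ (k + q) * ε ^ k := by gcongr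
      _ = (m : ℝ) ^ q * (ε * m) ^ k := by ring
      _ ≤ _ := by gcongr
  have hyR : ∀ i, y' i ∈ ball (0 : E) R := fun i =>
    ball_subset_ball (hrR _).le (hFsub _ _ i.2.2)
  refine ⟨y' ∘ eqv, c' ∘ eqv, fun j => hyR _, fun j => pow_nonneg hεpos.le _,
    (eqv.summable_iff).2 hc', fun f hf A hA x hx => ?_⟩
  have hsum : Summable fun i => c' i * ‖f (y' i)‖ :=
    Summable.of_nonneg_of_le (fun i => by positivity)
      (fun i => mul_le_mul_of_nonneg_left (hA _ (hyR i)) (by positivity)) (hc'.mul_right A)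
  have hA0 : 0 ≤ A := (norm_nonneg _).trans (hA 0 (mem_ball_self hR))
  have step : ∀ n i, ∀ z ∈ ball (0 : E) (r i),
      ‖f z‖ ≤ ∑ k ∈ Finset.range n, ε ^ k * ∑ p ∈ F (i + k), ‖f p‖ + ε ^ n * A := by
    intro n
    induction n with
    | zero => intro i z hz; simpa using hA z (ball_subset_ball (hrR i).le hz)
    | succ n ih =>
      intro i z hz
      obtain ⟨p, hp, hzp⟩ := hFcov i z hz
      set B := ∑ k ∈ Finset.range n, ε ^ k * ∑ p ∈ F (i + 1 + k), ‖f p‖ + ε ^ n * A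
      have hB0 : 0 ≤ B := by positivity
      have hsub : ball p (R / 2 ^ (i + 2)) ⊆ ball 0 (r (i + 1)) := by
        refine ball_subset_ball' ?_
        rw [← hgap i]
        linarith [mem_ball.1 (hFsub i p hp)]
      have hdist : 2 * (R / 2 ^ (i + q)) = ε / 2 * (R / 2 ^ (i + 2)) := by
        rw [hε]; simp only [pow_add]; field_simp; norm_num
      have hpos : 0 < R / 2 ^ (i + 2) := by positivity
      have hzb : z ∈ ball p (R / 2 ^ (i + 2)) := by
        rw [mem_ball]; nlinarith
      have h1 := norm_sub_le_of_differentiableOn_ball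
        (hf.mono (hsub.trans (ball_subset_ball (hrR _).le))) (fun w hw => ih (i + 1) w (hsub hw)) hzb
      have h2 : 2 * B / (R / 2 ^ (i + 2)) * dist z p ≤ ε * B := by
        calc _ ≤ 2 * B / (R / 2 ^ (i + 2)) * (ε / 2 * (R / 2 ^ (i + 2))) := by
              gcongr; linarith
          _ = ε * B := by field_simp
      have h3 : ‖f p‖ ≤ ∑ p ∈ F i, ‖f p‖ :=
        Finset.single_le_sum (f := fun p => ‖f p‖) (fun _ _ => norm_nonneg _) hp
      have h4 : ‖f z‖ ≤ ‖f z - f p‖ + ‖f p‖ := by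
        simpa using norm_add_le (f z - f p) (f p)
      have h5 : ε * B = ∑ k ∈ Finset.range n, ε ^ (k + 1) * ∑ p ∈ F (i + (k + 1)), ‖f p‖
          + ε ^ (n + 1) * A := by
        simp only [B, mul_add, Finset.mul_sum]
        congr 1
        · refine Finset.sum_congr rfl fun k _ => ?_
          rw [show i + 1 + k = i + (k + 1) by ring]
          exact Finset.sum_congr rfl fun _ _ => by ring
        · ring
      rw [Finset.sum_range_succ']
      simp only [pow_zero, one_mul, add_zero]
      linarith
  have hx0 : x ∈ ball (0 : E) (r 0) := by
    have : r 0 = R / 2 := by simp only [hr]; norm_num; ring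
    rwa [this]
  rw [show (∑' j, (c' ∘ eqv) j * ‖f ((y' ∘ eqv) j)‖) = ∑' i, c' i * ‖f (y' i)‖ from
    eqv.tsum_eq fun i => c' i * ‖f (y' i)‖]
  have hlim : Filter.Tendsto (fun n : ℕ => (∑' i, c' i * ‖f (y' i)‖) + ε ^ n * A) Filter.atTop
      (𝓝 ((∑' i, c' i * ‖f (y' i)‖) + 0 * A)) :=
    tendsto_const_nhds.add ((tendsto_pow_atTop_nhds_zero_of_lt_one hεpos.le
      (by linarith)).mul_const A)
  rw [zero_mul, add_zero] at hlim
  refine ge_of_tendsto' hlim fun n => (step n 0 x hx0).trans ?_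
  gcongr
  have := hsum.sum_le_tsum ((Finset.range n).sigma fun k => (Finset.univ : Finset (F k)))
    (fun i _ => by positivity)
  rw [Finset.sum_sigma] at this
  refine le_trans (Finset.sum_le_sum fun k _ => ?_) this
  rw [zero_add, Finset.mul_sum, ← Finset.sum_coe_sort (F k)]

end LocalEstimate

section NuclearExpansion

open scoped ENNReal

/-- The map into `ℓ²` given by a bounded sequence of functionals and a summable sequence of
weights. -/
theorem exists_linearMap_lp_two {V : Type*} [AddCommGroup V] [Module ℂ V] {κ : Type*}
    {d : κ → ℝ} (hd0 : ∀ j, 0 ≤ d j) (hd : Summable d) (h : κ → V →ₗ[ℂ] ℂ)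
    (hb : ∀ x, ∃ A : ℝ, ∀ j, ‖h j x‖ ≤ A) :
    ∃ S : V →ₗ[ℂ] lp (fun _ : κ => ℂ) 2, ∀ x j, S x j = (Real.sqrt (d j) : ℂ) * h j x := by
  have key : ∀ x, Memℓp (fun j => (Real.sqrt (d j) : ℂ) * h j x) 2 := fun x => by
    obtain ⟨A, hA⟩ := hb x
    refine memℓp_gen ?_
    simp only [ENNReal.toReal_ofNat, Real.rpow_ofNat, norm_mul, mul_pow, Complex.norm_real,
      Real.norm_eq_abs, sq_abs]
    refine Summable.of_nonneg_of_le (fun j => by positivity) (fun j => ?_) (hd.mul_right (A ^ 2))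
    rw [Real.sq_sqrt (hd0 j)]
    exact mul_le_mul_of_nonneg_left (pow_le_pow_left₀ (norm_nonneg _) (hA j) 2) (hd0 j)
  refine ⟨{ toFun := fun x => ⟨_, key x⟩
            map_add' := fun x y => ?_
            map_smul' := fun a x => ?_ }, fun x j => rfl⟩
  · ext j
    exact (congrArg _ (map_add (h j) x y)).trans (mul_add _ _ _)
  · ext j
    simp; ring

/-- A linear map has dense range in the closure of its range. -/
theorem denseRange_codRestrict_topologicalClosure {V : Type*} [AddCommGroup V] [Module ℂ V]
    {H : Type*} [NormedAddCommGroup H] [NormedSpace ℂ H] (S : V →ₗ[ℂ] H) :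
    DenseRange (S.codRestrict (LinearMap.range S).topologicalClosure
      fun x => Submodule.le_topologicalClosure _ ⟨x, rfl⟩) := by
  intro z
  rw [Topology.IsInducing.subtypeVal.closure_eq_preimage_closure_image]
  have : (Subtype.val '' Set.range (S.codRestrict (LinearMap.range S).topologicalClosure
      fun x => Submodule.le_topologicalClosure _ ⟨x, rfl⟩)) = (LinearMap.range S : Set H) := by
    rw [← Set.range_comp]; rfl
  exact (Set.ext_iff.1 (congrArg closure this) _).2 z.2

/-- A linear map dominated by the norm of another one factors through it. -/
theorem exists_continuousLinearMap_factor {V : Type*} [AddCommGroup V] [Module ℂ V]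
    {H : Type*} [NormedAddCommGroup H] [NormedSpace ℂ H]
    {Y : Type*} [NormedAddCommGroup Y] [NormedSpace ℂ Y] [CompleteSpace Y] (S : V →ₗ[ℂ] H)
    (φ : V →ₗ[ℂ] Y) {C : ℝ} (hC : ∀ x, ‖φ x‖ ≤ C * ‖S x‖) :
    ∃ Φ : (LinearMap.range S).topologicalClosure →L[ℂ] Y, (∀ z, ‖Φ z‖ ≤ C * ‖z‖) ∧
      ∀ x (hx : S x ∈ (LinearMap.range S).topologicalClosure), Φ ⟨S x, hx⟩ = φ x := by
  have hdense := denseRange_codRestrict_topologicalClosure S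
  exact ⟨φ.extendOfNorm _, LinearMap.norm_extendOfNorm_apply_le hdense C hC,
    fun x _ => LinearMap.extendOfNorm_eq hdense ⟨C, hC⟩ x⟩

/-- The closure of the range of `S` is dense-inducted from the range. -/
theorem topologicalClosure_range_induction {V : Type*} [AddCommGroup V] [Module ℂ V]
    {H : Type*} [NormedAddCommGroup H] [NormedSpace ℂ H] (S : V →ₗ[ℂ] H)
    {p : (LinearMap.range S).topologicalClosure → Prop} (hp : IsClosed {z | p z})
    (h : ∀ x (hx : S x ∈ (LinearMap.range S).topologicalClosure), p ⟨S x, hx⟩) (z) : p z := by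
  exact (denseRange_codRestrict_topologicalClosure S).induction_on z hp fun x => h x _

/-- The composition of two quasi-nuclear maps is nuclear: if `φ` is dominated by an absolutely
convergent series in functionals `g i`, each of them dominated by an absolutely convergent series
in functionals `h j`, then `φ` is the sum of an absolutely convergent series in the `h j`. -/
theorem exists_nuclear_expansion {V : Type*} [AddCommGroup V] [Module ℂ V]
    {Y : Type*} [NormedAddCommGroup Y] [NormedSpace ℂ Y] [CompleteSpace Y] {ι κ : Type*}
    (φ : V →ₗ[ℂ] Y) {c : ι → ℝ} {d : κ → ℝ} (hc0 : ∀ i, 0 ≤ c i) (hd0 : ∀ j, 0 ≤ d j)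
    (hc : Summable c) (hd : Summable d) (g : ι → V →ₗ[ℂ] ℂ) (h : κ → V →ₗ[ℂ] ℂ)
    (hφ : ∀ x, ‖φ x‖ ≤ ∑' i, c i * ‖g i x‖) (hg : ∀ i x, ‖g i x‖ ≤ ∑' j, d j * ‖h j x‖)
    (hb : ∀ x, ∃ A : ℝ, ∀ j, ‖h j x‖ ≤ A) :
    ∃ (γ : κ → ℝ) (b : κ → Y), (∀ j, 0 ≤ γ j) ∧ Summable γ ∧ (∀ j, ‖b j‖ ≤ 1) ∧
      (∀ j, b j ∈ closure (Set.range φ)) ∧ ∀ x, HasSum (fun j => (γ j : ℂ) • h j x • b j) (φ x) := by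
  classical
  obtain ⟨S, hS⟩ := exists_linearMap_lp_two hd0 hd h hb
  set D := ∑' j, d j with hD
  set C := ∑' i, c i with hCdef
  have hD0 : 0 ≤ D := tsum_nonneg hd0
  have hC0 : 0 ≤ C := tsum_nonneg hc0
  have hnormS : ∀ x, HasSum (fun j => d j * ‖h j x‖ ^ 2) (‖S x‖ ^ 2) := fun x => by
    have := lp.hasSum_norm (p := 2) (by norm_num) (S x)
    simp only [ENNReal.toReal_ofNat, Real.rpow_ofNat, hS, norm_mul, mul_pow, Complex.norm_real,
      Real.norm_eq_abs, sq_abs, Real.sq_sqrt (hd0 _)] at this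
    exact this
  have hgS : ∀ i x, ‖g i x‖ ≤ Real.sqrt D * ‖S x‖ := fun i x => by
    refine (hg i x).trans ?_
    obtain ⟨A, hA⟩ := hb x
    have hs : Summable fun j => d j * ‖h j x‖ :=
      Summable.of_nonneg_of_le (fun j => mul_nonneg (hd0 j) (norm_nonneg _))
        (fun j => mul_le_mul_of_nonneg_left (hA j) (hd0 j)) (hd.mul_right A)
    refine hs.tsum_le_of_sum_le fun s => ?_
    rw [← Real.sqrt_sq (norm_nonneg (S x)), ← Real.sqrt_mul hD0]
    refine Real.le_sqrt_of_sq_le ?_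
    have h1 : (∑ j ∈ s, d j * ‖h j x‖) ^ 2 ≤ (∑ j ∈ s, d j) * ∑ j ∈ s, d j * ‖h j x‖ ^ 2 :=
      Finset.sum_sq_le_sum_mul_sum_of_sq_le_mul s (fun j _ => hd0 j)
        (fun j _ => mul_nonneg (hd0 j) (sq_nonneg _)) fun j _ => le_of_eq (by ring)
    refine h1.trans (mul_le_mul (hd.sum_le_tsum s fun j _ => hd0 j)
      (sum_le_hasSum s (fun j _ => mul_nonneg (hd0 j) (sq_nonneg _)) (hnormS x))
      (Finset.sum_nonneg fun j _ => mul_nonneg (hd0 j) (sq_nonneg _)) hD0)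
  have hφS : ∀ x, ‖φ x‖ ≤ C * Real.sqrt D * ‖S x‖ := fun x => by
    refine (hφ x).trans ?_
    rw [mul_assoc, ← hc.tsum_mul_right]
    exact Summable.tsum_le_tsum (fun i => mul_le_mul_of_nonneg_left (hgS i x) (hc0 i))
      (Summable.of_nonneg_of_le (fun i => mul_nonneg (hc0 i) (norm_nonneg _))
        (fun i => mul_le_mul_of_nonneg_left (hgS i x) (hc0 i)) (hc.mul_right _)) (hc.mul_right _)
  set Z := (LinearMap.range S).topologicalClosure with hZ
  choose G hGn hG using fun i => exists_continuousLinearMap_factor S (g i) (hgS i)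
  obtain ⟨Φ, hΦn, hΦ⟩ := exists_continuousLinearMap_factor S φ hφS
  have : CompleteSpace Z := (Submodule.isClosed_topologicalClosure _).completeSpace_coe
  have hGsum : ∀ z : Z, Summable fun i => c i * ‖G i z‖ := fun z =>
    Summable.of_nonneg_of_le (fun i => mul_nonneg (hc0 i) (norm_nonneg _))
      (fun i => mul_le_mul_of_nonneg_left (hGn i z) (hc0 i)) (hc.mul_right _)
  have hcont : Continuous fun z : Z => ∑' i, c i * ‖G i z‖ := by
    rw [continuous_iff_continuousAt]
    intro z₀
    have hon : ContinuousOn (fun z : Z => ∑' i, c i * ‖G i z‖) (Metric.ball z₀ 1) := by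
      refine continuousOn_tsum (u := fun i => c i * (Real.sqrt D * (‖z₀‖ + 1)))
        (fun i => by fun_prop) (hc.mul_right _) fun i z hz => ?_
      rw [Real.norm_of_nonneg (mul_nonneg (hc0 i) (norm_nonneg _))]
      refine mul_le_mul_of_nonneg_left ((hGn i z).trans ?_) (hc0 i)
      have : ‖z‖ ≤ ‖z₀‖ + 1 := by
        have := norm_le_norm_add_norm_sub' z z₀
        rw [mem_ball_iff_norm] at hz
        linarith
      gcongr
    exact hon.continuousAt (Metric.ball_mem_nhds _ one_pos)
  have hΦG : ∀ z : Z, ‖Φ z‖ ≤ ∑' i, c i * ‖G i z‖ :=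
    topologicalClosure_range_induction S (isClosed_le (by fun_prop) hcont) fun x hx => by
      simp only [hΦ, hG]; exact hφ x
  have hΦcl : ∀ z : Z, Φ z ∈ closure (Set.range φ) :=
    topologicalClosure_range_induction S (isClosed_closure.preimage Φ.continuous) fun x hx => by
      simp only [hΦ]; exact subset_closure ⟨x, rfl⟩
  let e : κ → lp (fun _ : κ => ℂ) 2 := fun j => lp.single 2 j 1
  have he : Orthonormal ℂ e := by
    rw [orthonormal_iff_ite]
    intro i j
    simp only [e, lp.inner_single_left, lp.coeFn_single]
    by_cases hij : i = j
    · subst hij; simp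
    · simp [hij]
  let P := Z.orthogonalProjectionOnto
  let f : κ → Y := fun j => Φ (P (e j))
  have hGe : ∀ i (s : Finset κ), ∑ j ∈ s, ‖G i (P (e j))‖ ^ 2 ≤ D := fun i s => by
    let k := (InnerProductSpace.toDual ℂ _).symm ((G i).comp P)
    have hk : ∀ x, G i (P x) = inner ℂ k x := fun x =>
      (InnerProductSpace.toDual_symm_apply (y := (G i).comp P)).symm
    have hkn : ‖k‖ ≤ Real.sqrt D := by
      rw [LinearIsometryEquiv.norm_map]
      refine ContinuousLinearMap.opNorm_le_bound _ (Real.sqrt_nonneg _) fun x => ?_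
      refine (hGn i _).trans (mul_le_mul_of_nonneg_left ?_ (Real.sqrt_nonneg _))
      exact Z.norm_orthogonalProjectionOnto_apply_le x
    calc ∑ j ∈ s, ‖G i (P (e j))‖ ^ 2 = ∑ j ∈ s, ‖inner ℂ (e j) k‖ ^ 2 :=
          Finset.sum_congr rfl fun j _ => by rw [hk, norm_inner_symm]
      _ ≤ ‖k‖ ^ 2 := he.sum_inner_products_le k
      _ ≤ Real.sqrt D ^ 2 := by gcongr
      _ = D := Real.sq_sqrt hD0
  have hfsum : Summable fun j => ‖f j‖ ^ 2 := by
    refine summable_of_sum_le (c := C * (C * D)) (fun j => sq_nonneg _) fun s => ?_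
    have hterm : ∀ j, Summable fun i => c i * ‖G i (P (e j))‖ ^ 2 := fun j => by
      refine Summable.of_nonneg_of_le (fun i => mul_nonneg (hc0 i) (sq_nonneg _))
        (fun i => mul_le_mul_of_nonneg_left ?_ (hc0 i)) (hc.mul_right D)
      simpa using hGe i {j}
    have h1 : ∀ j, ‖f j‖ ^ 2 ≤ C * ∑' i, c i * ‖G i (P (e j))‖ ^ 2 := fun j => by
      have h2 : ‖f j‖ ≤ Real.sqrt (C * ∑' i, c i * ‖G i (P (e j))‖ ^ 2) := by
        refine (hΦG _).trans ((hGsum _).tsum_le_of_sum_le fun t => Real.le_sqrt_of_sq_le ?_)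
        refine (Finset.sum_sq_le_sum_mul_sum_of_sq_le_mul t (fun i _ => hc0 i)
          (g := fun i => c i * ‖G i (P (e j))‖ ^ 2)
          (fun i _ => mul_nonneg (hc0 i) (sq_nonneg _)) fun i _ => le_of_eq (by ring)).trans ?_
        exact mul_le_mul (hc.sum_le_tsum t fun i _ => hc0 i)
          ((hterm j).sum_le_tsum t fun i _ => mul_nonneg (hc0 i) (sq_nonneg _))
          (Finset.sum_nonneg fun i _ => mul_nonneg (hc0 i) (sq_nonneg _)) hC0
      have h3 : 0 ≤ C * ∑' i, c i * ‖G i (P (e j))‖ ^ 2 :=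
        mul_nonneg hC0 (tsum_nonneg fun i => mul_nonneg (hc0 i) (sq_nonneg _))
      calc ‖f j‖ ^ 2 ≤ _ ^ 2 := pow_le_pow_left₀ (norm_nonneg _) h2 2
        _ = _ := Real.sq_sqrt h3
    calc ∑ j ∈ s, ‖f j‖ ^ 2 ≤ ∑ j ∈ s, C * ∑' i, c i * ‖G i (P (e j))‖ ^ 2 :=
          Finset.sum_le_sum fun j _ => h1 j
      _ = C * ∑' i, c i * ∑ j ∈ s, ‖G i (P (e j))‖ ^ 2 := by
          rw [← Finset.mul_sum, ← Summable.tsum_finsetSum fun j _ => hterm j]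
          simp only [Finset.mul_sum]
      _ ≤ C * (C * D) := by
          refine mul_le_mul_of_nonneg_left ?_ hC0
          rw [← hc.tsum_mul_right]
          have hle : ∀ i, c i * ∑ j ∈ s, ‖G i (P (e j))‖ ^ 2 ≤ c i * D := fun i =>
            mul_le_mul_of_nonneg_left (hGe i s) (hc0 i)
          exact Summable.tsum_le_tsum hle (Summable.of_nonneg_of_le
            (fun i => mul_nonneg (hc0 i) (Finset.sum_nonneg fun _ _ => sq_nonneg _)) hle
            (hc.mul_right D)) (hc.mul_right D)
  refine ⟨fun j => Real.sqrt (d j) * ‖f j‖, fun j => ((‖f j‖ : ℂ))⁻¹ • f j,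
    fun j => by positivity, ?_, fun j => ?_, fun j => ?_, fun x => ?_⟩
  · refine Summable.of_nonneg_of_le (fun j => by positivity) (fun j => ?_) (hd.add hfsum)
    have := Real.sq_sqrt (hd0 j)
    nlinarith [sq_nonneg (Real.sqrt (d j) - ‖f j‖), Real.sqrt_nonneg (d j), norm_nonneg (f j)]
  · rw [norm_smul, norm_inv, Complex.norm_real, norm_norm]
    exact inv_mul_le_one
  · have : ((‖f j‖ : ℂ))⁻¹ • f j = Φ (((‖f j‖ : ℂ))⁻¹ • P (e j)) := by rw [map_smul]
    exact Set.mem_of_eq_of_mem this (hΦcl _)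
  · have hxZ : S x ∈ Z := Submodule.le_topologicalClosure _ ⟨x, rfl⟩
    have h1 : HasSum (fun j => lp.single 2 j (S x j)) (S x) := lp.hasSum_single (by norm_num) (S x)
    have h2 := h1.mapL (Φ.comp P)
    have h3 : (Φ.comp P) (S x) = φ x := by
      have : P (S x) = ⟨S x, hxZ⟩ := Z.orthogonalProjectionOnto_mem_subspace_eq_self ⟨S x, hxZ⟩
      rw [ContinuousLinearMap.comp_apply, this, hΦ]
    rw [h3] at h2
    convert h2 using 2 with j
    have h4 : lp.single (E := fun _ : κ => ℂ) 2 j (S x j) = (S x j) • e j := by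
      rw [← lp.single_smul]; simp
    rw [h4, map_smul, hS]
    change _ = _ • f j
    rcases eq_or_ne (f j) 0 with hf | hf
    · simp [hf]
    · have : (‖f j‖ : ℂ) ≠ 0 := by exact_mod_cast norm_ne_zero_iff.2 hf
      simp only [smul_smul]
      congr 1
      push_cast
      field_simp

end NuclearExpansion

section Weierstrass

open Metric

/-- A function which is uniformly approximated by holomorphic functions on a ball is holomorphic. -/
theorem differentiableAt_of_forall_exists_norm_sub_le {E : Type v} [NormedAddCommGroup E]
    [NormedSpace ℂ E] {F : E → ℂ} {x : E} {R : ℝ} (hR : 0 < R)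
    (h : ∀ ε : ℝ, 0 < ε → ∃ f : E → ℂ, DifferentiableOn ℂ f (ball x R) ∧
      ∀ y ∈ ball x R, ‖f y - F y‖ ≤ ε) : DifferentiableAt ℂ F x := by
  choose f hf hfF using fun n : ℕ => h (1 / (n + 1)) Nat.one_div_pos_of_nat
  have hlim : Filter.Tendsto (fun n : ℕ => (1 : ℝ) / (n + 1)) Filter.atTop (𝓝 0) :=
    tendsto_one_div_add_atTop_nhds_zero_nat
  have hball : ∀ z ∈ ball x (R / 2), ball z (R / 2) ⊆ ball x R := fun z hz =>
    ball_subset_ball' (by linarith [mem_ball.1 hz])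
  have hdiff : ∀ n, ∀ z ∈ ball x (R / 2), HasFDerivAt (f n) (fderiv ℂ (f n) z) z := fun n z hz =>
    ((hf n).differentiableAt (isOpen_ball.mem_nhds
      (ball_subset_ball (by linarith) hz))).hasFDerivAt
  have hbound : ∀ m n : ℕ, ∀ z ∈ ball x (R / 2), ‖fderiv ℂ (f m) z - fderiv ℂ (f n) z‖
      ≤ 2 * (1 / (m + 1) + 1 / (n + 1)) / (R / 2) := fun m n z hz => by
    have hle : ∀ w ∈ ball x R, ‖f m w - f n w‖ ≤ 1 / (m + 1) + 1 / (n + 1) := fun w hw => by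
      have := norm_sub_le (f m w - F w) (f n w - F w)
      rw [sub_sub_sub_cancel_right] at this
      linarith [hfF m w hw, hfF n w hw]
    have hz' := hball z hz
    rw [← ((hdiff m z hz).sub (hdiff n z hz)).fderiv]
    refine Complex.norm_fderiv_le_div_of_mapsTo_ball
      (((hf m).mono hz').sub ((hf n).mono hz')) (fun w hw => ?_) (by linarith)
    have h1 := hle w (hz' hw)
    have h2 := hle z (hz' (mem_ball_self (by linarith)))
    rw [mem_closedBall, dist_eq_norm]
    exact (norm_sub_le _ _).trans (by simp only [Pi.sub_apply]; linarith)
  have hcauchy : UniformCauchySeqOn (fun n => fderiv ℂ (f n)) Filter.atTop (ball x (R / 2)) := by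
    rw [Metric.uniformCauchySeqOn_iff]
    intro ε hε
    obtain ⟨N, hN⟩ := (hlim.eventually_lt_const
      (show (0 : ℝ) < ε * R / 16 by positivity)).exists_forall_of_atTop
    refine ⟨N, fun m hm n hn z hz => ?_⟩
    rw [dist_eq_norm]
    refine (hbound m n z hz).trans_lt ?_
    rw [div_lt_iff₀ (by linarith)]
    nlinarith [hN m hm, hN n hn, mul_pos hε hR]
  have hptw : ∀ z, ∃ L, z ∈ ball x (R / 2) →
      Filter.Tendsto (fun n => fderiv ℂ (f n) z) Filter.atTop (𝓝 L) := fun z => by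
    by_cases hz : z ∈ ball x (R / 2)
    · obtain ⟨L, hL⟩ := cauchy_map_iff_exists_tendsto.1 (hcauchy.cauchy_map hz)
      exact ⟨L, fun _ => hL⟩
    · exact ⟨0, fun h => absurd h hz⟩
  choose g' hg' using hptw
  refine (hasFDerivAt_of_tendstoUniformlyOn isOpen_ball
    (hcauchy.tendstoUniformlyOn_of_tendsto hg') hdiff (fun z hz => ?_)
    (mem_ball_self (by linarith : 0 < R / 2))).differentiableAt
  rw [tendsto_iff_norm_sub_tendsto_zero]
  exact squeeze_zero (fun n => norm_nonneg _)
    (fun n => hfF n z (ball_subset_ball (by linarith) hz)) hlim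

end Weierstrass

section Group

variable {E : Type v} [NormedAddCommGroup E] [NormedSpace ℂ E]
variable {G : Type u} [TopologicalSpace G] [ChartedSpace E G] [Group G] [LieGroup 𝓘(ℂ, E) ω G]

open Metric

/-- Holomorphic coordinates near the unit of a complex Lie group. -/
theorem exists_coordinates_one (E : Type v) [NormedAddCommGroup E] [NormedSpace ℂ E]
    {G : Type u} [TopologicalSpace G] [ChartedSpace E G] [Group G] [LieGroup 𝓘(ℂ, E) ω G]
    {K : Set G} (hK : K ∈ 𝓝 1) :
    ∃ (R : ℝ) (ψ : E → G) (η : G → E), 0 < R ∧ MDifferentiableAt 𝓘(ℂ, E) 𝓘(ℂ, E) η 1 ∧ η 1 = 0 ∧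
      (∀ᶠ y in 𝓝 (1 : G), ψ (η y) = y) ∧ ψ 0 = 1 ∧ Set.MapsTo ψ (ball 0 R) K ∧
      MDifferentiableOn 𝓘(ℂ, E) 𝓘(ℂ, E) ψ (ball 0 R) := by
  have : IsManifold 𝓘(ℂ, E) 1 G := IsManifold.of_le (n := ω) le_top
  let e := chartAt E (1 : G)
  have h1 : (1 : G) ∈ e.source := mem_chart_source E 1
  have hc : ContinuousAt e.symm (e 1) := e.continuousAt_symm (e.map_source h1)
  have hK' : e.symm ⁻¹' K ∈ 𝓝 (e 1) := hc.preimage_mem_nhds (by rwa [e.left_inv h1])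
  obtain ⟨R, hR, hball⟩ := Metric.mem_nhds_iff.1
    (Filter.inter_mem hK' (e.open_target.mem_nhds (e.map_source h1)))
  have hadd : ∀ h ∈ ball (0 : E) R, h + e 1 ∈ ball (e 1) R := fun h hh => by
    simpa [mem_ball_iff_norm] using hh
  refine ⟨R, fun h => e.symm (h + e 1), fun y => e y - e 1, hR, ?_, sub_self _, ?_, ?_, ?_, ?_⟩
  · have : MDifferentiableAt 𝓘(ℂ, E) 𝓘(ℂ, E) e 1 :=
      mdifferentiableAt_atlas (chart_mem_atlas E 1) h1
    exact this.sub mdifferentiableAt_const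
  · filter_upwards [e.open_source.mem_nhds h1] with y hy
    simp [e.left_inv hy]
  · simp [e.left_inv h1]
  · exact fun h hh => (hball (hadd h hh)).1
  · have h2 : MDifferentiableOn 𝓘(ℂ, E) 𝓘(ℂ, E) e.symm e.target :=
      mdifferentiableOn_atlas_symm (chart_mem_atlas E 1)
    refine h2.comp (I' := 𝓘(ℂ, E)) ?_ fun h hh => (hball (hadd h hh)).2
    exact (differentiable_id.add_const _).mdifferentiable.mdifferentiableOn

theorem MDifferentiable.differentiableOn_comp_mul_left {f : G → ℂ} {ψ : E → G} {s : Set E}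
    (hf : MDifferentiable 𝓘(ℂ, E) 𝓘(ℂ, ℂ) f) (hψ : MDifferentiableOn 𝓘(ℂ, E) 𝓘(ℂ, E) ψ s) (g : G) :
    DifferentiableOn ℂ (fun h => f (g * ψ h)) s := by
  rw [← mdifferentiableOn_iff_differentiableOn]
  have h1 : MDifferentiable 𝓘(ℂ, E) 𝓘(ℂ, E) (fun x : G => g * x) :=
    (contMDiff_mul_left (I := 𝓘(ℂ, E)) (n := ω) (a := g)).mdifferentiable (by simp)
  exact (hf.comp h1).comp_mdifferentiableOn hψ

/-- A function on a complex Lie group which is uniformly approximated by holomorphic functions on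
all translates of a neighbourhood of the unit is holomorphic. -/
theorem mdifferentiable_of_forall_exists_norm_sub_le {K : Set G} (hK : K ∈ 𝓝 1) {F : G → ℂ}
    (h : ∀ (g : G) (ε : ℝ), 0 < ε → ∃ f : G → ℂ, MDifferentiable 𝓘(ℂ, E) 𝓘(ℂ, ℂ) f ∧
      ∀ k ∈ K, ‖f (g * k) - F (g * k)‖ ≤ ε) : MDifferentiable 𝓘(ℂ, E) 𝓘(ℂ, ℂ) F := by
  obtain ⟨R, ψ, η, hR, hη, hη1, hψη, -, hψK, hψ⟩ := exists_coordinates_one E hK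
  intro g
  have h1 : DifferentiableAt ℂ (fun h => F (g * ψ h)) 0 := by
    refine differentiableAt_of_forall_exists_norm_sub_le hR fun ε hε => ?_
    obtain ⟨f, hf, hfF⟩ := h g ε hε
    exact ⟨fun h => f (g * ψ h), hf.differentiableOn_comp_mul_left hψ g,
      fun y hy => hfF _ (hψK hy)⟩
  have h2 : MDifferentiableAt 𝓘(ℂ, E) 𝓘(ℂ, E) (fun x : G => g⁻¹ * x) g :=
    (contMDiff_mul_left (I := 𝓘(ℂ, E)) (n := ω) (a := g⁻¹)).mdifferentiable (by simp) g
  have h3 : MDifferentiableAt 𝓘(ℂ, E) 𝓘(ℂ, E) (fun x : G => η (g⁻¹ * x)) g :=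
    MDifferentiableAt.comp (I' := 𝓘(ℂ, E)) g (by rwa [inv_mul_cancel]) h2
  have h4 : MDifferentiableAt 𝓘(ℂ, E) 𝓘(ℂ, ℂ) ((fun h => F (g * ψ h)) ∘ fun x => η (g⁻¹ * x)) g :=
    MDifferentiableAt.comp (I' := 𝓘(ℂ, E)) g
      (by rw [inv_mul_cancel, hη1]; exact h1.mdifferentiableAt) h3
  refine h4.congr_of_eventuallyEq ?_
  have h5 : Filter.Tendsto (fun x : G => g⁻¹ * x) (𝓝 g) (𝓝 1) := by
    have := h2.continuousAt.tendsto
    rwa [inv_mul_cancel] at this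
  filter_upwards [h5.eventually hψη] with x hx
  simp [hx]

/-- Holomorphic functions on a complex Lie group are locally equicontinuous, uniformly with respect
to translations. -/
theorem exists_modulus_holomorphic (E : Type v) [NormedAddCommGroup E] [NormedSpace ℂ E]
    {G : Type u} [TopologicalSpace G] [ChartedSpace E G] [Group G] [LieGroup 𝓘(ℂ, E) ω G]
    {K : Set G} (hK : K ∈ 𝓝 1) :
    ∃ m : G → ℝ, Filter.Tendsto m (𝓝 1) (𝓝 0) ∧ ∀ᶠ y in 𝓝 (1 : G),
      ∀ f : G → ℂ, MDifferentiable 𝓘(ℂ, E) 𝓘(ℂ, ℂ) f → ∀ (g : G) (A : ℝ),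
        (∀ k ∈ K, ‖f (g * k)‖ ≤ A) → ‖f (g * y) - f g‖ ≤ A * m y := by
  obtain ⟨R, ψ, η, hR, hη, hη1, hψη, hψ0, hψK, hψ⟩ := exists_coordinates_one E hK
  have hηc : Filter.Tendsto η (𝓝 1) (𝓝 0) := hη1 ▸ hη.continuousAt.tendsto
  refine ⟨fun y => 2 / R * ‖η y‖, ?_, ?_⟩
  · simpa using hηc.norm.const_mul (2 / R)
  · filter_upwards [hψη, hηc.eventually (ball_mem_nhds 0 hR)] with y hy hyR f hf g A hA
    have := norm_sub_le_of_differentiableOn_ball (hf.differentiableOn_comp_mul_left hψ g)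
      (fun z hz => hA _ (hψK hz)) hyR
    rw [hy, hψ0, mul_one, dist_zero_right] at this
    exact this.trans_eq (by ring)

/-- The values of a holomorphic function near a point `g` are controlled by an absolutely
convergent series of its values in a translate of a compact neighbourhood of the unit. -/
theorem exists_seq_norm_le_tsum_nhds_one (E : Type v) [NormedAddCommGroup E] [NormedSpace ℂ E]
    [FiniteDimensional ℂ E] {G : Type u} [TopologicalSpace G] [ChartedSpace E G] [Group G]
    [LieGroup 𝓘(ℂ, E) ω G] {K : Set G} (hKc : IsCompact K) (hK : K ∈ 𝓝 1) :
    ∃ U ∈ 𝓝 (1 : G), ∃ (y : ℕ → G) (c : ℕ → ℝ), (∀ j, y j ∈ K) ∧ (∀ j, 0 ≤ c j) ∧ Summable c ∧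
      ∀ f : G → ℂ, MDifferentiable 𝓘(ℂ, E) 𝓘(ℂ, ℂ) f → ∀ g : G, ∀ x ∈ U,
        ‖f (g * x)‖ ≤ ∑' j, c j * ‖f (g * y j)‖ := by
  have : ContinuousMul G := continuousMul_of_contMDiffMul 𝓘(ℂ, E) ω
  obtain ⟨R, ψ, η, hR, hη, hη1, hψη, -, hψK, hψ⟩ := exists_coordinates_one E hK
  obtain ⟨y, c, hy, hc0, hc, h⟩ := exists_seq_norm_le_tsum_of_differentiableOn_ball E hR
  have hηc : Filter.Tendsto η (𝓝 1) (𝓝 0) := hη1 ▸ hη.continuousAt.tendsto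
  refine ⟨{x | ψ (η x) = x ∧ η x ∈ ball 0 (R / 2)},
    hψη.and (hηc.eventually (ball_mem_nhds 0 (by linarith))), fun j => ψ (y j), c,
    fun j => hψK (hy j), hc0, hc, fun f hf g x hx => ?_⟩
  obtain ⟨A, hA⟩ := hKc.exists_bound_of_continuousOn (f := fun x => f (g * x))
    (hf.continuous.comp (continuous_const.mul continuous_id)).continuousOn
  have := h _ (hf.differentiableOn_comp_mul_left hψ g) A (fun z hz => hA _ (hψK hz)) _ hx.2
  rwa [hx.1] at this

end Group

section Level

/-- Compact neighbourhoods of the unit whose powers cover the group. -/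
structure IsGeneratingNhd {G : Type u} [TopologicalSpace G] [Group G] (K : Set G) : Prop where
  isCompact : IsCompact K
  mem_nhds : K ∈ 𝓝 1
  iUnion_pow : ⋃ n : ℕ, K ^ n = Set.univ

/-- The least `n ≥ 1` with `x ∈ K ^ n`. -/
noncomputable def level {G : Type u} [Group G] (K : Set G) (x : G) : ℕ :=
  sInf {n | 1 ≤ n ∧ x ∈ K ^ n}

variable {G : Type u} [TopologicalSpace G] [Group G] {K : Set G}

theorem IsCompactlyGeneratedGroup.exists_isGeneratingNhd [WeaklyLocallyCompactSpace G]
    (h : IsCompactlyGeneratedGroup G) : ∃ K : Set G, IsGeneratingNhd K := by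
  obtain ⟨K, hK, hu⟩ := h
  obtain ⟨C, hC, hC1⟩ := exists_compact_mem_nhds (1 : G)
  refine ⟨K ∪ C, hK.union hC, Filter.mem_of_superset hC1 Set.subset_union_right, ?_⟩
  refine Set.eq_univ_of_univ_subset (hu ▸ Set.iUnion_mono fun n => ?_)
  exact Set.pow_subset_pow_left Set.subset_union_left

namespace IsGeneratingNhd

theorem one_mem (hK : IsGeneratingNhd K) : (1 : G) ∈ K := mem_of_mem_nhds hK.mem_nhds

theorem pow_subset_pow (hK : IsGeneratingNhd K) {m n : ℕ} (h : m ≤ n) : K ^ m ⊆ K ^ n :=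
  Set.pow_subset_pow_right hK.one_mem h

theorem level_spec (hK : IsGeneratingNhd K) (x : G) : 1 ≤ level K x ∧ x ∈ K ^ level K x := by
  have : (sInf {n | 1 ≤ n ∧ x ∈ K ^ n}) ∈ {n | 1 ≤ n ∧ x ∈ K ^ n} := by
    refine Nat.sInf_mem ?_
    obtain ⟨n, hn⟩ := Set.mem_iUnion.1 (hK.iUnion_pow ▸ Set.mem_univ x)
    exact ⟨n + 1, by omega, hK.pow_subset_pow n.le_succ hn⟩
  exact this

theorem one_le_level (hK : IsGeneratingNhd K) (x : G) : 1 ≤ level K x := (hK.level_spec x).1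

theorem mem_pow_level (hK : IsGeneratingNhd K) (x : G) : x ∈ K ^ level K x := (hK.level_spec x).2

theorem mem_pow_of_level_le (hK : IsGeneratingNhd K) {x : G} {n : ℕ} (h : level K x ≤ n) :
    x ∈ K ^ n := hK.pow_subset_pow h (hK.mem_pow_level x)

theorem level_mul_le (hK : IsGeneratingNhd K) (x y : G) :
    level K (x * y) ≤ level K x + level K y := by
  refine Nat.sInf_le ⟨by have := hK.one_le_level x; omega, ?_⟩
  rw [pow_add]
  exact Set.mul_mem_mul (hK.mem_pow_level x) (hK.mem_pow_level y)

theorem isCompact_pow [ContinuousMul G] (hK : IsGeneratingNhd K) (n : ℕ) : IsCompact (K ^ n) := by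
  induction n with
  | zero => simp
  | succ n ih => rw [pow_succ]; exact ih.mul hK.isCompact

theorem exists_nhds_level_le [IsTopologicalGroup G] (hK : IsGeneratingNhd K) (x : G) :
    ∃ U ∈ 𝓝 x, ∀ y ∈ U, level K y ≤ level K x + 1 := by
  refine ⟨(fun y => x⁻¹ * y) ⁻¹' K, (continuous_const.mul continuous_id).continuousAt.preimage_mem_nhds
    (by simpa using hK.mem_nhds), fun y hy => Nat.sInf_le ⟨by omega, ?_⟩⟩
  rw [pow_succ]
  exact ⟨x, hK.mem_pow_level x, x⁻¹ * y, hy, by simp⟩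

end IsGeneratingNhd

omit [TopologicalSpace G] in
theorem level_le {x : G} {n : ℕ} (hn : 1 ≤ n) (hx : x ∈ K ^ n) : level K x ≤ n :=
  Nat.sInf_le ⟨hn, hx⟩

end Level

section Group

variable {E : Type v} [NormedAddCommGroup E] [NormedSpace ℂ E]
variable {G : Type u} [TopologicalSpace G] [ChartedSpace E G] [Group G] [LieGroup 𝓘(ℂ, E) ω G]

/-- The values of a holomorphic function on `K ^ n` are controlled by an absolutely convergent
series of its values on `K ^ (2 * n + 1)`, whose coefficients grow at most exponentially. -/
theorem exists_seq_norm_le_tsum_pow (E : Type v) [NormedAddCommGroup E] [NormedSpace ℂ E]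
    [FiniteDimensional ℂ E] {G : Type u} [TopologicalSpace G] [ChartedSpace E G] [Group G]
    [IsTopologicalGroup G] [LieGroup 𝓘(ℂ, E) ω G] {K : Set G} (hK : IsGeneratingNhd K) :
    ∃ (C : ℝ) (m : ℕ) (z : ℕ → ℕ → G) (c : ℕ → ℕ → ℝ), 0 ≤ C ∧ 1 ≤ m ∧
      (∀ n j, z n j ∈ K ^ (2 * n + 1)) ∧ (∀ n j, 0 ≤ c n j) ∧ (∀ n, Summable (c n)) ∧
      (∀ n, ∑' j, c n j ≤ C * m ^ n) ∧
      ∀ f : G → ℂ, MDifferentiable 𝓘(ℂ, E) 𝓘(ℂ, ℂ) f → ∀ n, ∀ x ∈ K ^ n,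
        ‖f x‖ ≤ ∑' j, c n j * ‖f (z n j)‖ := by
  classical
  obtain ⟨U₀, hU₀, y, c, hy, hc0, hc, h⟩ := exists_seq_norm_le_tsum_nhds_one E hK.isCompact hK.mem_nhds
  set U := U₀ ∩ K with hUdef
  have hU : U ∈ 𝓝 1 := Filter.inter_mem hU₀ hK.mem_nhds
  obtain ⟨t, htK, ht⟩ := (hK.isCompact_pow 2).elim_nhds_subcover
    (fun g => (fun x => g⁻¹ * x) ⁻¹' U) fun g _ =>
      (continuous_const.mul continuous_id).continuousAt.preimage_mem_nhds (by simpa using hU)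
  have hcov : K ^ 2 ⊆ (t : Set G) * U := fun x hx => by
    obtain ⟨g, hg, hx'⟩ := Set.mem_iUnion₂.1 (ht hx)
    exact ⟨g, hg, g⁻¹ * x, hx', by simp⟩
  have hne : t.Nonempty := by
    obtain ⟨g, hg, -⟩ := hcov (Set.one_mem_pow hK.one_mem)
    exact ⟨g, hg⟩
  have hpow : ∀ n, K ^ n ⊆ ((t ^ n : Finset G) : Set G) * U := by
    intro n
    induction n with
    | zero =>
      rw [pow_zero, pow_zero, Finset.coe_one, one_mul]
      simpa using mem_of_mem_nhds hU
    | succ n ih =>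
      calc K ^ (n + 1) = K ^ n * K := pow_succ _ _
        _ ⊆ ((t ^ n : Finset G) : Set G) * U * K := Set.mul_subset_mul_right ih
        _ ⊆ ((t ^ n : Finset G) : Set G) * (K ^ 2) := by
          rw [mul_assoc, pow_two]
          exact Set.mul_subset_mul_left (Set.mul_subset_mul_right Set.inter_subset_right)
        _ ⊆ ((t ^ n : Finset G) : Set G) * ((t : Set G) * U) := Set.mul_subset_mul_left hcov
        _ = _ := by rw [pow_succ, Finset.coe_mul, mul_assoc]
  have htK' : ∀ n, ((t ^ n : Finset G) : Set G) ⊆ K ^ (2 * n) := fun n => by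
    rw [Finset.coe_pow, pow_mul]
    exact Set.pow_subset_pow_left htK
  have hinf : ∀ n, Nonempty (ℕ ≃ (t ^ n : Finset G) × ℕ) := fun n => by
    have : Nonempty (t ^ n : Finset G) := (hne.pow).to_subtype
    exact nonempty_equiv_of_countable
  let e : ∀ n, ℕ ≃ (t ^ n : Finset G) × ℕ := fun n => (hinf n).some
  let z' : ∀ n, (t ^ n : Finset G) × ℕ → G := fun n p => p.1 * y p.2
  have hz' : ∀ n p, z' n p ∈ K ^ (2 * n + 1) := fun n p => by
    rw [pow_succ]
    exact Set.mul_mem_mul (htK' n p.1.2) (hy _)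
  have hsum : ∀ n, HasSum (fun p : (t ^ n : Finset G) × ℕ => c p.2)
      ((t ^ n).card * ∑' j, c j) := fun n => by
    have hs : Summable (fun p : (t ^ n : Finset G) × ℕ => c p.2) :=
      (summable_prod_of_nonneg fun p => hc0 p.2).2 ⟨fun _ => hc, (hasSum_fintype _).summable⟩
    convert hs.hasSum using 1
    rw [hs.tsum_prod, tsum_fintype (β := (t ^ n : Finset G))]
    simp
  refine ⟨∑' j, c j, t.card, fun n j => z' n (e n j), fun n j => c (e n j).2, tsum_nonneg hc0,
    hne.card_pos, fun n j => hz' n _, fun n j => hc0 _, fun n => ?_, fun n => ?_,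
    fun f hf n x hx => ?_⟩
  · exact ((e n).summable_iff (f := fun p => c p.2)).2 (hsum n).summable
  · rw [(e n).tsum_eq fun p => c p.2, (hsum n).tsum_eq, mul_comm]
    refine mul_le_mul_of_nonneg_left ?_ (tsum_nonneg hc0)
    exact_mod_cast Finset.card_pow_le
  · rw [(e n).tsum_eq fun p => c p.2 * ‖f (z' n p)‖]
    obtain ⟨A, hA⟩ := (hK.isCompact_pow (2 * n + 1)).exists_bound_of_continuousOn
      hf.continuous.continuousOn
    have hs : Summable fun p : (t ^ n : Finset G) × ℕ => c p.2 * ‖f (z' n p)‖ :=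
      Summable.of_nonneg_of_le (fun p => mul_nonneg (hc0 _) (norm_nonneg _))
        (fun p => mul_le_mul_of_nonneg_left (hA _ (hz' n p)) (hc0 _)) ((hsum n).summable.mul_right A)
    obtain ⟨g, hg, w, hw, rfl⟩ := hpow n hx
    refine (h f hf g w hw.1).trans ?_
    rw [hs.tsum_prod, tsum_fintype (β := (t ^ n : Finset G))]
    exact Finset.single_le_sum
      (f := fun g : (t ^ n : Finset G) => ∑' j, c j * ‖f (z' n (g, j))‖)
      (fun _ _ => tsum_nonneg fun _ => mul_nonneg (hc0 _) (norm_nonneg _))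
      (Finset.mem_univ (⟨g, hg⟩ : (t ^ n : Finset G)))

variable (E) in
theorem isClosed_holomorphicFunctions [IsTopologicalGroup G] [WeaklyLocallyCompactSpace G] :
    IsClosed (holomorphicFunctions E G : Set C(G, ℂ)) := by
  refine isClosed_of_closure_subset fun F hF => ?_
  obtain ⟨K, hK, hK1⟩ := exists_compact_mem_nhds (1 : G)
  refine mdifferentiable_of_forall_exists_norm_sub_le hK1 fun g ε hε => ?_
  have : (𝓝[(holomorphicFunctions E G : Set C(G, ℂ))] F).NeBot :=
    mem_closure_iff_nhdsWithin_neBot.1 hF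
  have hlim : Filter.Tendsto (fun f : C(G, ℂ) => f)
      (𝓝[(holomorphicFunctions E G : Set C(G, ℂ))] F) (𝓝 F) := tendsto_nhdsWithin_of_tendsto_nhds
        Filter.tendsto_id
  have h1 := ContinuousMap.tendsto_iff_forall_isCompact_tendstoUniformlyOn.1 hlim _
    (hK.image (continuous_const_mul g))
  have h2 := Metric.tendstoUniformlyOn_iff.1 h1 ε hε
  obtain ⟨f, hf, hfO⟩ := (h2.and self_mem_nhdsWithin).exists
  refine ⟨f, hfO, fun k hk => ?_⟩
  rw [← dist_eq_norm, dist_comm]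
  exact (hf _ (Set.mem_image_of_mem _ hk)).le

/-- Montel's theorem for rectangles. -/
theorem isCompact_rectangle [IsTopologicalGroup G] [WeaklyLocallyCompactSpace G] {f : G → ℝ}
    (hf : ∀ x, ∃ U ∈ 𝓝 x, ∃ C : ℝ, ∀ y ∈ U, f y ≤ C) : IsCompact (rectangle E f) := by
  rw [Topology.IsInducing.subtypeVal.isCompact_iff]
  have : T2Space (UniformOnFun G ℂ {K | IsCompact K}) := UniformOnFun.t2Space_of_covering
    (Set.eq_univ_of_forall fun x => ⟨{x}, isCompact_singleton, rfl⟩)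
  have hS : Subtype.val '' rectangle E f
      = (holomorphicFunctions E G : Set C(G, ℂ)) ∩ {u | ∀ x, ‖u x‖ ≤ f x} := by
    ext u
    constructor
    · rintro ⟨u, hu, rfl⟩
      exact ⟨u.2, hu⟩
    · rintro ⟨hu, hu'⟩
      exact ⟨⟨u, hu⟩, hu', rfl⟩
  have hcl : IsClosed (Subtype.val '' rectangle E f) := by
    rw [hS, Set.ofPred_forall]
    exact (isClosed_holomorphicFunctions E).inter
      (isClosed_iInter fun x => isClosed_le (by fun_prop) continuous_const)
  refine (congrArg IsCompact hcl.closure_eq).mp ?_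
  refine ArzelaAscoli.isCompact_closure_of_isClosedEmbedding (F := fun u : C(G, ℂ) => (u : G → ℂ))
    (𝔖 := {K | IsCompact K}) (fun K hK => hK)
    ContinuousMap.isUniformEmbedding_toUniformOnFunIsCompact.isClosedEmbedding
    (fun K _ => Equicontinuous.equicontinuousOn (fun x => ?_) K)
    fun K _ x _ => ⟨Metric.closedBall 0 (f x), isCompact_closedBall _ _, ?_⟩
  · obtain ⟨U, hU, C, hC⟩ := hf x
    have hV : (fun y => x * y) ⁻¹' U ∈ 𝓝 (1 : G) :=
      (continuous_const_mul x).continuousAt.preimage_mem_nhds (by simpa using hU)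
    obtain ⟨m, hm, hmod⟩ := exists_modulus_holomorphic E hV
    rw [Metric.equicontinuousAt_iff_right]
    intro ε hε
    have hlim : Filter.Tendsto (fun y : G => x⁻¹ * y) (𝓝 x) (𝓝 1) := by
      simpa using (continuous_const_mul x⁻¹).tendsto x
    have hsmall : ∀ᶠ y in 𝓝 (1 : G), C * m y < ε := by
      have := hm.const_mul C
      rw [mul_zero] at this
      exact this.eventually_lt_const hε
    filter_upwards [hlim.eventually hmod, hlim.eventually hsmall] with y h1 h2
    rintro ⟨_, u, hu, rfl⟩
    have := h1 u.1 u.2 x C fun k hk => (hu _).trans (hC _ hk)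
    rw [mul_inv_cancel_left] at this
    rw [dist_comm, dist_eq_norm]
    exact this.trans_lt h2
  · rintro _ ⟨u, hu, rfl⟩
    simpa using hu x

end Group

section AbsolutelySumming

variable {E : Type v} [NormedAddCommGroup E] [NormedSpace ℂ E]
variable {G : Type u} [TopologicalSpace G] [ChartedSpace E G] [Group G]

theorem norm_le_of_mem_diskSpan_powerRectangle {K : Set G} {N : ℕ} {u : holomorphicFunctions E G}
    (hu : u ∈ diskSpan (powerRectangle E K N)) :
    ∃ A : ℝ, 0 ≤ A ∧ ∀ n : ℕ, 1 ≤ n → ∀ x ∈ K ^ n, ‖u.1 x‖ ≤ A * (N : ℝ) ^ n := by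
  obtain ⟨r, hr, v, hv, rfl⟩ := hu
  refine ⟨r, hr.le, fun n hn x hx => ?_⟩
  change ‖(r : ℂ) * v.1 x‖ ≤ _
  rw [norm_mul, Complex.norm_real, Real.norm_of_nonneg hr.le]
  exact mul_le_mul_of_nonneg_left (hv n hn x hx) hr.le

theorem gauge_powerRectangle_le {K : Set G} {M : ℕ} {u : holomorphicFunctions E G} {T : ℝ}
    (hT : 0 ≤ T) (h : ∀ n : ℕ, 1 ≤ n → ∀ x ∈ K ^ n, ‖u.1 x‖ ≤ T * (M : ℝ) ^ n) :
    gauge (powerRectangle E K M) u ≤ T := by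
  refine le_of_forall_gt fun t ht => ?_
  obtain ⟨s, hs, hst⟩ := exists_between ht
  have hs0 : 0 < s := hT.trans_lt hs
  refine (gauge_le_of_mem hs0.le ?_).trans_lt hst
  rw [Set.mem_smul_set_iff_inv_smul_mem₀ hs0.ne']
  intro n hn x hx
  change ‖((s⁻¹ : ℝ) : ℂ) * u.1 x‖ ≤ _
  rw [norm_mul, Complex.norm_real, Real.norm_of_nonneg (by positivity), inv_mul_le_iff₀ hs0]
  exact (h n hn x hx).trans (by gcongr)

theorem exists_isAbsolutelySummingInclusion [FiniteDimensional ℂ E] [IsTopologicalGroup G]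
    [LieGroup 𝓘(ℂ, E) ω G] {K : Set G} (hK : IsGeneratingNhd K) {N : ℕ} (hN : 1 ≤ N) :
    ∃ M : ℕ, N < M ∧
      IsAbsolutelySummingInclusion (powerRectangle E K N) (powerRectangle E K M) := by
  obtain ⟨C, m, z, c, hC, hm, hz, hc0, hc, hcC, h⟩ := exists_seq_norm_le_tsum_pow E hK
  have hN' : (1 : ℝ) ≤ N := by exact_mod_cast hN
  have hm' : (1 : ℝ) ≤ m := by exact_mod_cast hm
  have hNM : N < 2 * m * N ^ 2 := by nlinarith [Nat.mul_le_mul hm hN, Nat.mul_le_mul hN hN]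
  refine ⟨2 * m * N ^ 2, hNM, ?_, 2 * C * N + 1, by positivity, fun l x hx S hS => ?_⟩
  · rintro u ⟨r, hr, v, hv, rfl⟩
    exact ⟨r, hr, v, fun n hn x hx => (hv n hn x hx).trans (by gcongr), rfl⟩
  set M : ℕ := 2 * m * N ^ 2 with hM
  have hMpos : (0 : ℝ) < M := by exact_mod_cast (by omega : 0 < M)
  have hgeom : ∀ n : ℕ, C * (m : ℝ) ^ n * (N : ℝ) ^ (2 * n + 1) / (M : ℝ) ^ n
      = C * N * (1 / 2) ^ n := fun n => by
    rw [hM]; push_cast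
    rw [div_eq_iff (by positivity), mul_pow, mul_pow, pow_succ, pow_mul, ← pow_mul]
    have : (1 / 2 : ℝ) ^ n * 2 ^ n = 1 := by rw [← mul_pow]; norm_num
    linear_combination (-C * N * m ^ n * (N : ℝ) ^ (2 * n)) * this
  choose A hA0 hA using fun i => norm_le_of_mem_diskSpan_powerRectangle (hx i)
  have hS0 : 0 ≤ S := by simpa using hS 0 (by simp)
  have hval : ∀ n j, ∑ i, ‖(x i).1 (z n j)‖ ≤ (N : ℝ) ^ (2 * n + 1) * S := fun n j => by
    have hpos : (0 : ℝ) < (N : ℝ) ^ (2 * n + 1) := by positivity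
    have := hS ((((N : ℝ) ^ (2 * n + 1))⁻¹ : ℂ) •
      ((ContinuousMap.evalCLM ℂ (z n j)).comp (holomorphicFunctions E G).subtypeL)) (fun a ha => by
        change ‖(((N : ℝ) ^ (2 * n + 1))⁻¹ : ℂ) * a.1 (z n j)‖ ≤ 1
        rw [norm_mul, norm_inv, norm_pow, Complex.norm_real, Real.norm_of_nonneg (by positivity),
          inv_mul_le_iff₀ hpos, mul_one]
        exact ha _ (by omega) _ (hz n j))
    have heq : ∀ i, ‖((((N : ℝ) ^ (2 * n + 1))⁻¹ : ℂ) • ((ContinuousMap.evalCLM ℂ (z n j)).comp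
        (holomorphicFunctions E G).subtypeL)) (x i)‖
        = ((N : ℝ) ^ (2 * n + 1))⁻¹ * ‖(x i).1 (z n j)‖ := fun i => by
      change ‖(((N : ℝ) ^ (2 * n + 1))⁻¹ : ℂ) * (x i).1 (z n j)‖ = _
      rw [norm_mul, norm_inv, norm_pow, Complex.norm_real, Real.norm_of_nonneg (by positivity)]
    simp only [heq, ← Finset.mul_sum] at this
    rwa [inv_mul_le_iff₀ hpos] at this
  have hsum1 : ∀ i n, Summable fun j => c n j * ‖(x i).1 (z n j)‖ := fun i n =>
    Summable.of_nonneg_of_le (fun j => mul_nonneg (hc0 n j) (norm_nonneg _))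
      (fun j => mul_le_mul_of_nonneg_left (hA i _ (by omega) _ (hz n j)) (hc0 n j))
      ((hc n).mul_right _)
  let T : Fin l → ℕ → ℝ := fun i n => (∑' j, c n j * ‖(x i).1 (z n j)‖) / (M : ℝ) ^ n
  have hT0 : ∀ i n, 0 ≤ T i n := fun i n =>
    div_nonneg (tsum_nonneg fun j => mul_nonneg (hc0 n j) (norm_nonneg _)) (by positivity)
  have hTle : ∀ n, ∑ i, T i n ≤ C * N * (1 / 2) ^ n * S := fun n => by
    simp only [T]
    rw [← Finset.sum_div, ← Summable.tsum_finsetSum fun i _ => hsum1 i n]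
    have h1 : ∑' j, ∑ i, c n j * ‖(x i).1 (z n j)‖ ≤ C * m ^ n * ((N : ℝ) ^ (2 * n + 1) * S) := by
      refine le_trans ?_ (mul_le_mul_of_nonneg_right (hcC n) (by positivity))
      rw [← (hc n).tsum_mul_right]
      refine Summable.tsum_le_tsum (fun j => ?_) (summable_sum fun i _ => hsum1 i n)
        ((hc n).mul_right _)
      rw [← Finset.mul_sum]
      exact mul_le_mul_of_nonneg_left (hval n j) (hc0 n j)
    rw [← hgeom n, div_mul_eq_mul_div]
    gcongr
    linarith
  have hgsum : Summable fun n : ℕ => C * N * (1 / 2 : ℝ) ^ n * S :=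
    (summable_geometric_two.mul_left (C * N)).mul_right S
  have hTsum : ∀ i, Summable (T i) := fun i =>
    Summable.of_nonneg_of_le (hT0 i) (fun n => (Finset.single_le_sum (f := fun i => T i n)
      (fun i _ => hT0 i n) (Finset.mem_univ i)).trans (hTle n)) hgsum
  have hgauge : ∀ i, gauge (powerRectangle E K M) (x i) ≤ ∑' n, T i n := fun i => by
    refine gauge_powerRectangle_le (tsum_nonneg (hT0 i)) fun n _ y hy => ?_
    refine (h _ (x i).2 n y hy).trans ?_
    have : ∑' j, c n j * ‖(x i).1 (z n j)‖ = T i n * (M : ℝ) ^ n := by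
      simp only [T]; field_simp
    rw [this]
    exact mul_le_mul_of_nonneg_right ((hTsum i).le_tsum n fun n _ => hT0 i n) (by positivity)
  calc ∑ i, gauge (powerRectangle E K M) (x i) ≤ ∑ i, ∑' n, T i n :=
        Finset.sum_le_sum fun i _ => hgauge i
    _ = ∑' n, ∑ i, T i n := (Summable.tsum_finsetSum fun i _ => hTsum i).symm
    _ ≤ ∑' n : ℕ, C * N * (1 / 2 : ℝ) ^ n * S :=
        Summable.tsum_le_tsum hTle (summable_sum fun i _ => hTsum i) hgsum
    _ = 2 * C * N * S := by
        rw [tsum_mul_right, tsum_mul_left, tsum_geometric_two]; ring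
    _ ≤ (2 * C * N + 1) * S := by linarith

end AbsolutelySumming

section LevelBounds

variable {G : Type u} [TopologicalSpace G] [Group G] {K : Set G}

theorem IsGeneratingNhd.isSemicharacter_pow_level [IsTopologicalGroup G] (hK : IsGeneratingNhd K)
    {N : ℕ} (hN : 1 ≤ N) : IsSemicharacter fun x : G => (N : ℝ) ^ level K x := by
  have hN' : (1 : ℝ) ≤ N := by exact_mod_cast hN
  refine ⟨fun x => one_le_pow₀ hN', fun x => ?_, fun x y => ?_⟩
  · obtain ⟨U, hU, h⟩ := hK.exists_nhds_level_le x
    exact ⟨U, hU, _, fun y hy => pow_le_pow_right₀ hN' (h y hy)⟩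
  · rw [← pow_add]
    exact pow_le_pow_right₀ hN' (hK.level_mul_le x y)

theorem IsSemicharacter.exists_le_pow_level (hK : IsGeneratingNhd K) {f : G → ℝ}
    (hf : IsSemicharacter f) : ∃ N : ℕ, 1 ≤ N ∧ ∀ x, f x ≤ (N : ℝ) ^ level K x := by
  have hb : ∃ C : ℝ, ∀ x ∈ K, f x ≤ C := by
    refine hK.isCompact.induction_on (p := fun s => ∃ C : ℝ, ∀ x ∈ s, f x ≤ C) ⟨0, by simp⟩
      (fun s t hst ⟨C, hC⟩ => ⟨C, fun x hx => hC x (hst hx)⟩) ?_ fun x _ => ?_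
    · rintro s t ⟨C, hC⟩ ⟨D, hD⟩
      exact ⟨max C D, fun x hx => hx.elim (fun h => (hC x h).trans (le_max_left _ _))
        fun h => (hD x h).trans (le_max_right _ _)⟩
    · obtain ⟨U, hU, C, hC⟩ := hf.locallyBounded x
      exact ⟨U, mem_nhdsWithin_of_mem_nhds hU, C, hC⟩
  obtain ⟨C, hC⟩ := hb
  obtain ⟨N, hN⟩ := exists_nat_ge (max C 1)
  have hN1 : (1 : ℝ) ≤ N := (le_max_right _ _).trans hN
  have key : ∀ n : ℕ, ∀ x ∈ K ^ (n + 1), f x ≤ (N : ℝ) ^ (n + 1) := by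
    intro n
    induction n with
    | zero => intro x hx; simpa using (hC x (by simpa using hx)).trans ((le_max_left _ _).trans hN)
    | succ n ih =>
      intro x hx
      rw [pow_succ] at hx
      obtain ⟨a, ha, b, hb, rfl⟩ := hx
      rw [pow_succ]
      exact (hf.submul a b).trans (mul_le_mul (ih a ha)
        ((hC b hb).trans ((le_max_left _ _).trans hN)) (zero_le_one.trans (hf.one_le b))
        (by positivity))
  refine ⟨N, by exact_mod_cast hN1, fun x => ?_⟩
  obtain ⟨n, hn⟩ := Nat.exists_eq_add_of_le' (hK.one_le_level x)
  have := key n x (hn ▸ hK.mem_pow_level x)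
  rwa [← hn] at this

end LevelBounds

section OExp

variable (E : Type v) [NormedAddCommGroup E] [NormedSpace ℂ E]
variable {G : Type u} [TopologicalSpace G] [ChartedSpace E G] [Group G]

/-- Functions of exponential type as holomorphic functions. -/
noncomputable def OExp.toHolomorphic : OExp E G →ₗ[ℂ] holomorphicFunctions E G where
  toFun u := ⟨u.1, u.2.1⟩
  map_add' _ _ := rfl
  map_smul' _ _ := rfl

/-- The evaluation of a function of exponential type at a point. -/
noncomputable def OExp.eval (x : G) : OExp E G →ₗ[ℂ] ℂ where
  toFun u := u.1 x
  map_add' _ _ := rfl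
  map_smul' _ _ := rfl

variable {E}

theorem OExp.mdifferentiable (u : OExp E G) :
    MDifferentiable 𝓘(ℂ, E) 𝓘(ℂ, ℂ) fun x => OExp.eval E x u := u.2.1

theorem OExp.ext_eval {u v : OExp E G} (h : ∀ x, OExp.eval E x u = OExp.eval E x v) : u = v :=
  Subtype.ext (ContinuousMap.ext h)

variable (E) in
/-- The functions of exponential type bounded by `N ^ n` on `K ^ n` for all `n ≥ 1`. -/
def expBall (K : Set G) (N : ℕ) : Set (OExp E G) :=
  {u | ∀ x, ‖OExp.eval E x u‖ ≤ (N : ℝ) ^ level K x}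

variable {K : Set G}

theorem exists_oExp_of_le (hK : IsGeneratingNhd K) [IsTopologicalGroup G] {F : G → ℂ}
    (hF : MDifferentiable 𝓘(ℂ, E) 𝓘(ℂ, ℂ) F) {N : ℕ} (hN : 1 ≤ N) {A : ℝ}
    (h : ∀ x, ‖F x‖ ≤ A * (N : ℝ) ^ level K x) :
    ∃ u : OExp E G, ∀ x, OExp.eval E x u = F x := by
  refine ⟨⟨⟨F, hF.continuous⟩, hF, _, (IsSemicharacter.const (le_max_left 1 A)).mul
    (hK.isSemicharacter_pow_level hN), fun x => (h x).trans ?_⟩, fun x => rfl⟩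
  gcongr
  exact le_max_right _ _

theorem exists_mem_expBall (hK : IsGeneratingNhd K) (u : OExp E G) :
    ∃ N : ℕ, 1 ≤ N ∧ u ∈ expBall E K N := by
  obtain ⟨f, hf, hu⟩ := u.2.2
  obtain ⟨N, hN, h⟩ := hf.exists_le_pow_level hK
  exact ⟨N, hN, fun x => (hu x).trans (h x)⟩

theorem expBall_mono {M N : ℕ} (h : N ≤ M) : expBall E K N ⊆ expBall E K M :=
  fun _ hu x => (hu x).trans (by gcongr)

theorem le_mul_pow_level (hK : IsGeneratingNhd K) {r : ℕ} {N : ℝ} (hN : 0 ≤ N) (hr : 1 ≤ r)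
    (x : G) : r * N ^ level K x ≤ (r * N) ^ level K x := by
  rw [mul_pow]
  have : (1 : ℝ) ≤ r := by exact_mod_cast hr
  gcongr
  exact le_self_pow₀ this (by have := hK.one_le_level x; omega)

theorem smul_mem_expBall (hK : IsGeneratingNhd K) {N r : ℕ} {a : ℂ} (hr : 1 ≤ r) (ha : ‖a‖ ≤ r)
    {u : OExp E G} (hu : u ∈ expBall E K N) : a • u ∈ expBall E K (r * N) := fun x => by
  rw [map_smul, norm_smul]
  calc ‖a‖ * ‖OExp.eval E x u‖ ≤ r * (N : ℝ) ^ level K x := by gcongr; exact hu x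
    _ ≤ _ := by push_cast; exact le_mul_pow_level hK (by positivity) hr x

theorem mem_smul_expBall {N : ℕ} {r : ℝ} (hr : 0 < r) {u : OExp E G}
    (h : ∀ x, ‖OExp.eval E x u‖ ≤ r * (N : ℝ) ^ level K x) :
    ((r⁻¹ : ℝ) : ℂ) • u ∈ expBall E K N := fun x => by
  rw [map_smul, norm_smul, Complex.norm_real, Real.norm_of_nonneg (by positivity),
    inv_mul_le_iff₀ hr]
  exact h x

theorem seminorm_le_of_le (p : Seminorm ℂ (OExp E G)) {N : ℕ} {C : ℝ}
    (hp : ∀ u ∈ expBall E K N, p u ≤ C) {r : ℝ} (hr : 0 < r) {u : OExp E G}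
    (h : ∀ x, ‖OExp.eval E x u‖ ≤ r * (N : ℝ) ^ level K x) : p u ≤ r * C := by
  have := hp _ (mem_smul_expBall hr h)
  rw [map_smul_eq_mul, Complex.norm_real, Real.norm_of_nonneg (by positivity),
    inv_mul_le_iff₀ hr] at this
  exact this

/-- The inclusion of the rectangle of a semicharacter. -/
def rectangleToOExp {f : G → ℝ} (hf : IsSemicharacter f) (u : rectangle E f) : OExp E G :=
  ⟨u.1.1, u.1.2, f, hf, u.2⟩

/-- The rectangle of a semicharacter, with the compact-open topology, is continuously embedded into
the space of functions of exponential type. -/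
theorem continuous_rectangleToOExp {f : G → ℝ} (hf : IsSemicharacter f) :
    Continuous (rectangleToOExp (E := E) hf) := by
  have h1 : ∀ u : rectangle E f, u.1 ∈ ((1 : ℝ) : ℂ) • rectangle E f := fun u =>
    ⟨u.1, u.2, by simp⟩
  have h2 : Continuous fun u : rectangle E f =>
      (⟨u.1, h1 u⟩ : (((1 : ℝ) : ℂ) • rectangle E f : Set (holomorphicFunctions E G))) :=
    Continuous.subtype_mk continuous_subtype_val _
  have h3 : Continuous[inferInstance, kelleyTopology (rectangle E f)]
      (Set.inclusion (smul_subset_diskSpan (rectangle E f) ⟨1, one_pos⟩)) :=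
    continuous_iff_coinduced_le.2 (le_iSup (fun r : {r : ℝ // 0 < r} =>
      TopologicalSpace.coinduced (Set.inclusion (smul_subset_diskSpan (rectangle E f) r))
        inferInstance) ⟨1, one_pos⟩)
  have h4 := (oExp_topology_mem E G).2.2.2 f hf
  exact @Continuous.comp _ _ _ _ (kelleyTopology (rectangle E f)) _ _ _ h4
    (@Continuous.comp _ _ _ _ _ (kelleyTopology (rectangle E f)) _ _ h3 h2)

variable [LieGroup 𝓘(ℂ, E) ω G] [IsTopologicalGroup G]

theorem isCompact_expBall [WeaklyLocallyCompactSpace G] (hK : IsGeneratingNhd K) {N : ℕ}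
    (hN : 1 ≤ N) : IsCompact (expBall E K N) := by
  have hf := hK.isSemicharacter_pow_level hN
  have : CompactSpace (rectangle E fun x : G => (N : ℝ) ^ level K x) :=
    isCompact_iff_compactSpace.1 (isCompact_rectangle hf.locallyBounded)
  have h := isCompact_range (continuous_rectangleToOExp (E := E) hf)
  have heq : expBall E K N = Set.range (rectangleToOExp (E := E) hf) := by
    refine Set.ext fun u => ⟨?_, ?_⟩
    · intro hu
      exact ⟨⟨⟨u.1, u.2.1⟩, hu⟩, rfl⟩
    · rintro ⟨u, rfl⟩
      exact u.2
  rwa [heq]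

omit [LieGroup 𝓘(ℂ, E) ω G] in
/-- A seminorm which is bounded on the sets `expBall E K N` is continuous. -/
theorem continuous_seminorm_oExp (hK : IsGeneratingNhd K) (p : Seminorm ℂ (OExp E G))
    (hp : ∀ N : ℕ, 1 ≤ N → ∃ C : ℝ, ∀ u ∈ expBall E K N, p u ≤ C) : Continuous p := by
  let inst : SeminormedAddCommGroup (OExp E G) := p.toSeminormedAddCommGroup
  let t : TopologicalSpace (OExp E G) := inst.toUniformSpace.toTopologicalSpace
  have hinst : @ContinuousSMul ℂ (OExp E G) _ _ t := by
    let _ : NormedSpace ℂ (OExp E G) := ⟨fun a x => (map_smul_eq_mul p a x).le⟩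
    exact inferInstance
  have hlc : @LocallyConvexSpace ℝ (OExp E G) _ _ _ _ t := by
    let _ : NormedSpace ℂ (OExp E G) := ⟨fun a x => (map_smul_eq_mul p a x).le⟩
    let _ : NormedSpace ℝ (OExp E G) := NormedSpace.restrictScalars ℝ ℂ (OExp E G)
    exact NormedSpace.toLocallyConvexSpace
  have ht : t ∈ oExpAdmissibleTopologies E G := by
    refine ⟨inst.toIsTopologicalAddGroup, hinst, hlc, fun f hf => ?_⟩
    obtain ⟨N, hN, hfN⟩ := hf.exists_le_pow_level hK
    refine continuous_iSup_dom.2 fun r => continuous_coinduced_dom.2 ?_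
    obtain ⟨q, hq⟩ := exists_nat_ge (2 * (r : ℝ))
    have hr := r.2
    have hq1 : 1 ≤ q := by
      have : (0 : ℝ) < q := by linarith
      exact_mod_cast this
    obtain ⟨C, hC⟩ := hp (2 * (q * N)) (by nlinarith)
    rw [continuous_iff_continuousAt]
    intro u₀
    refine Metric.tendsto_nhds.2 fun ε hε => ?_
    have hC0 : 0 ≤ C := (apply_nonneg p 0).trans (hC 0 fun x => by simp; positivity)
    obtain ⟨n₀, hn₀⟩ := exists_pow_lt_of_lt_one (show 0 < ε / (C + 1) by positivity)
      (show (1 / 2 : ℝ) < 1 by norm_num)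
    set δ : ℝ := (1 / 2) ^ n₀ with hδ
    have hδ0 : 0 < δ := by positivity
    have hcont : ContinuousAt (fun u : (((r : ℝ) : ℂ) • rectangle E f :
        Set (holomorphicFunctions E G)) => u.1.1) u₀ :=
      (continuous_subtype_val.comp continuous_subtype_val).continuousAt
    have hunif := Metric.tendstoUniformlyOn_iff.1
      (ContinuousMap.tendsto_iff_forall_isCompact_tendstoUniformlyOn.1 hcont _
        (hK.isCompact_pow n₀)) δ hδ0
    have hbound : ∀ u : (((r : ℝ) : ℂ) • rectangle E f : Set (holomorphicFunctions E G)), ∀ x,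
        ‖u.1.1 x‖ ≤ r * (N : ℝ) ^ level K x := by
      rintro ⟨_, v, hv, rfl⟩ x
      change ‖((r : ℝ) : ℂ) * v.1 x‖ ≤ _
      rw [norm_mul, Complex.norm_real, Real.norm_of_nonneg hr.le]
      exact mul_le_mul_of_nonneg_left ((hv x).trans (hfN x)) hr.le
    filter_upwards [hunif] with u hu
    refine (@dist_eq_norm _ inst _ _).trans_lt ?_
    refine (seminorm_le_of_le (K := K) p hC hδ0 fun x => ?_).trans_lt (b := δ * C) ?_
    · change ‖u.1.1 x - u₀.1.1 x‖ ≤ _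
      have hone : (1 : ℝ) ≤ ((2 * (q * N) : ℕ) : ℝ) ^ level K x := by
        refine one_le_pow₀ ?_
        exact_mod_cast (by nlinarith : 1 ≤ 2 * (q * N))
      rcases le_or_gt (level K x) n₀ with hx | hx
      · have := hu x (hK.mem_pow_of_level_le hx)
        rw [dist_comm, dist_eq_norm] at this
        exact this.le.trans (le_mul_of_one_le_right hδ0.le hone)
      · have h1 : ‖u.1.1 x - u₀.1.1 x‖ ≤ ((q * N : ℕ) : ℝ) ^ level K x := by
          calc ‖u.1.1 x - u₀.1.1 x‖ ≤ ‖u.1.1 x‖ + ‖u₀.1.1 x‖ := norm_sub_le _ _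
            _ ≤ 2 * r * (N : ℝ) ^ level K x := by linarith [hbound u x, hbound u₀ x]
            _ ≤ q * (N : ℝ) ^ level K x := by gcongr
            _ ≤ _ := by push_cast; exact le_mul_pow_level hK (by positivity) hq1 x
        refine h1.trans ?_
        have h2 : (1 / 2 : ℝ) ^ level K x ≤ δ :=
          pow_le_pow_of_le_one (by norm_num) (by norm_num) hx.le
        calc ((q * N : ℕ) : ℝ) ^ level K x
            = (1 / 2 : ℝ) ^ level K x * ((2 * (q * N) : ℕ) : ℝ) ^ level K x := by
              rw [← mul_pow]; push_cast; congr 1; ring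
          _ ≤ _ := by gcongr
    · have h3 : δ * (C + 1) < ε := by rwa [lt_div_iff₀ (by positivity)] at hn₀
      nlinarith
  have hle : instTopologicalSpaceOExp E G ≤ t := sInf_le ht
  have hcont : @Continuous _ _ t _ p := @continuous_norm (OExp E G) inst.toSeminormedAddGroup
  exact continuous_le_dom hle hcont

omit [LieGroup 𝓘(ℂ, E) ω G] in
/-- An absolutely convex set which absorbs the sets `expBall E K N` is a neighbourhood of zero. -/
theorem mem_nhds_zero_oExp (hK : IsGeneratingNhd K) {Q : Set (OExp E G)} (hQ : Balanced ℂ Q)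
    (hQc : Convex ℝ Q) (h : ∀ N : ℕ, 1 ≤ N → ∃ r : ℝ, 0 < r ∧ ∀ u ∈ expBall E K N, (r : ℂ) • u ∈ Q) :
    Q ∈ 𝓝 0 := by
  have hmem : ∀ N : ℕ, 1 ≤ N → ∃ r : ℝ, 0 < r ∧ ∀ u ∈ expBall E K N, u ∈ r • Q := fun N hN => by
    obtain ⟨r, hr, hrQ⟩ := h N hN
    refine ⟨r⁻¹, by positivity, fun u hu => ?_⟩
    rw [Set.mem_smul_set_iff_inv_smul_mem₀ (by positivity), inv_inv]
    exact hrQ u hu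
  have h0 : (0 : OExp E G) ∈ Q := by
    obtain ⟨r, hr, hrQ⟩ := h 1 le_rfl
    simpa using hrQ 0 fun x => by simp
  have habs : Absorbent ℝ Q := by
    refine absorbent_iff_eventually_nhdsNE_zero.2 fun u => ?_
    obtain ⟨N, hN, hu⟩ := exists_mem_expBall hK u
    obtain ⟨r, hr, hrQ⟩ := h N hN
    have hball : Metric.ball (0 : ℝ) r ∈ 𝓝[≠] (0 : ℝ) :=
      mem_nhdsWithin_of_mem_nhds (Metric.ball_mem_nhds 0 hr)
    filter_upwards [hball] with c hc
    have : c • u = ((c / r : ℝ) : ℂ) • ((r : ℂ) • u) := by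
      rw [smul_smul, ← Complex.ofReal_mul, div_mul_cancel₀ _ hr.ne']
      rfl
    rw [this]
    refine hQ.smul_mem ?_ (hrQ u hu)
    rw [Complex.norm_real, norm_div, Real.norm_of_nonneg hr.le, div_le_one hr]
    exact (mem_ball_zero_iff.1 hc).le
  have hcont := continuous_seminorm_oExp hK (gaugeSeminorm hQ hQc habs) fun N hN => by
    obtain ⟨r, hr, hrQ⟩ := hmem N hN
    exact ⟨r, fun u hu => gauge_le_of_mem hr.le (hrQ u hu)⟩
  have hlt : {u | gaugeSeminorm hQ hQc habs u < 1} ∈ 𝓝 (0 : OExp E G) :=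
    (isOpen_lt hcont continuous_const).mem_nhds (by simp)
  exact Filter.mem_of_superset hlt (setOfPred_gauge_lt_one_subset_self hQc h0 habs)

omit [LieGroup 𝓘(ℂ, E) ω G] in
/-- A linear functional which is bounded on the sets `expBall E K N` is continuous. -/
theorem continuous_linearMap_oExp (hK : IsGeneratingNhd K) (α : OExp E G →ₗ[ℂ] ℂ)
    (h : ∀ N : ℕ, 1 ≤ N → ∃ C : ℝ, ∀ u ∈ expBall E K N, ‖α u‖ ≤ C) : Continuous α := by
  have hcont := continuous_seminorm_oExp hK ((normSeminorm ℂ ℂ).comp α) h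
  refine continuous_of_continuousAt_zero α ?_
  rw [ContinuousAt, map_zero, tendsto_zero_iff_norm_tendsto_zero]
  have := hcont.tendsto 0
  rwa [map_zero] at this

omit [LieGroup 𝓘(ℂ, E) ω G] in
/-- Each totally bounded set of functions of exponential type is contained in some
`expBall E K N`. -/
theorem exists_subset_expBall (hK : IsGeneratingNhd K) {S : Set (OExp E G)}
    (hS : @TotallyBounded _ (IsTopologicalAddGroup.rightUniformSpace (OExp E G)) S) :
    ∃ N : ℕ, 1 ≤ N ∧ S ⊆ expBall E K N := by
  have hb : Bornology.IsVonNBounded ℂ S := by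
    let _ : UniformSpace (OExp E G) := IsTopologicalAddGroup.rightUniformSpace (OExp E G)
    have : IsUniformAddGroup (OExp E G) := isUniformAddGroup_of_addCommGroup
    exact hS.isVonNBounded ℂ
  by_contra! hcon
  have hx : ∀ N : ℕ, 1 ≤ N → ∃ u ∈ S, ∃ x, (N : ℝ) ^ (2 * level K x) < ‖OExp.eval E x u‖ := by
    intro N hN
    obtain ⟨u, hu, hu'⟩ := Set.not_subset.1 (hcon (N ^ 2) (Nat.one_le_pow _ _ hN))
    simp only [expBall, Set.mem_ofPred_eq, not_forall, not_le] at hu'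
    obtain ⟨x, hx⟩ := hu'
    refine ⟨u, hu, x, ?_⟩
    rwa [pow_mul, ← Nat.cast_pow]
  choose! u huS x hux using hx
  set Q : Set (OExp E G) :=
    {v | ∀ N : ℕ, 1 ≤ N → ‖OExp.eval E (x N) v‖ ≤ (N : ℝ) ^ level K (x N)} with hQdef
  have hQ : Q ∈ 𝓝 0 := by
    refine mem_nhds_zero_oExp hK ?_ ?_ fun M hM => ?_
    · rw [balanced_iff_smul_mem]
      intro a ha v hv N hN
      rw [map_smul, norm_smul]
      exact (mul_le_of_le_one_left (norm_nonneg _) ha).trans (hv N hN)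
    · intro v hv w hw a b ha hb' hab N hN
      have : OExp.eval E (x N) (a • v + b • w)
          = (a : ℂ) * OExp.eval E (x N) v + (b : ℂ) * OExp.eval E (x N) w := rfl
      rw [this]
      refine (norm_add_le _ _).trans ?_
      rw [norm_mul, norm_mul, Complex.norm_real, Complex.norm_real, Real.norm_of_nonneg ha,
        Real.norm_of_nonneg hb']
      calc _ ≤ a * (N : ℝ) ^ level K (x N) + b * (N : ℝ) ^ level K (x N) := by
            gcongr
            exacts [hv N hN, hw N hN]
        _ = _ := by rw [← add_mul, hab, one_mul]
    · obtain ⟨D, hD⟩ : ∃ D : ℝ, D = ∑ N ∈ Finset.range M, (M : ℝ) ^ level K (x N) + 1 := ⟨_, rfl⟩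
      have hD1 : 1 ≤ D := by
        have : 0 ≤ ∑ N ∈ Finset.range M, (M : ℝ) ^ level K (x N) := by positivity
        linarith
      have hD0 : 0 < D := by linarith
      refine ⟨D⁻¹, inv_pos.2 hD0, fun v hv N hN => ?_⟩
      rw [map_smul, norm_smul, Complex.norm_real, Real.norm_of_nonneg (inv_pos.2 hD0).le,
        inv_mul_le_iff₀ hD0]
      have hN' : (1 : ℝ) ≤ N := by exact_mod_cast hN
      refine (hv (x N)).trans ?_
      rcases le_or_gt M N with h | h
      · calc (M : ℝ) ^ level K (x N) ≤ (N : ℝ) ^ level K (x N) := by gcongr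
          _ ≤ _ := le_mul_of_one_le_left (by positivity) hD1
      · calc (M : ℝ) ^ level K (x N) ≤ ∑ N ∈ Finset.range M, (M : ℝ) ^ level K (x N) :=
              Finset.single_le_sum (f := fun N => (M : ℝ) ^ level K (x N))
                (fun _ _ => by positivity) (Finset.mem_range.2 h)
          _ ≤ D := by linarith
          _ ≤ _ := le_mul_of_one_le_right hD0.le (one_le_pow₀ hN')
  obtain ⟨R, hR, hSR⟩ := (hb hQ).exists_pos
  obtain ⟨N, hN⟩ := exists_nat_ge (max R 1)
  have hN1 : (1 : ℝ) ≤ N := (le_max_right _ _).trans hN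
  have hN1' : 1 ≤ N := by exact_mod_cast hN1
  obtain ⟨v, hv, hvu⟩ := hSR (N : ℂ) (by simpa using (le_max_left _ _).trans hN) (huS N hN1')
  have h1 := hux N hN1'
  rw [← hvu] at h1
  simp only [map_smul, norm_smul, Complex.norm_natCast] at h1
  have h2 := hv N hN1'
  have h3 : (N : ℝ) * (N : ℝ) ^ level K (x N) ≤ (N : ℝ) ^ (2 * level K (x N)) := by
    rw [← pow_succ']
    exact pow_le_pow_right₀ hN1 (by have := hK.one_le_level (x N); omega)
  nlinarith

end OExp

section OExp

variable {E : Type v} [NormedAddCommGroup E] [NormedSpace ℂ E]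
variable {G : Type u} [TopologicalSpace G] [ChartedSpace E G] [Group G]
variable {K : Set G}

theorem OExp.continuous_eval [IsTopologicalGroup G] (hK : IsGeneratingNhd K) (x : G) :
    Continuous (OExp.eval E x) :=
  continuous_linearMap_oExp hK _ fun _ _ => ⟨_, fun _ hu => hu x⟩

variable [LieGroup 𝓘(ℂ, E) ω G] [IsTopologicalGroup G]

/-- If a continuous seminorm is small on the functions with growth bounded by `a`, then it is small
on the functions whose growth is bounded by `a` on some power of `K` and by `N ^ n` outside. -/
theorem exists_nat_forall_seminorm_lt [WeaklyLocallyCompactSpace G] (hK : IsGeneratingNhd K)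
    {p : Seminorm ℂ (OExp E G)} (hp : Continuous p) {T : ℝ} {a : ℕ → ℝ} {N : ℕ} (hN : 1 ≤ N)
    (ha : ∀ n, a n ≤ (N : ℝ) ^ n) (h : ∀ u, (∀ x, ‖OExp.eval E x u‖ ≤ a (level K x)) → p u < T)
    (k₀ : ℕ) : ∃ k, k₀ ≤ k ∧ ∀ u, (∀ x, ‖OExp.eval E x u‖ ≤
      if level K x ≤ k then a (level K x) else (N : ℝ) ^ level K x) → p u < T := by
  by_contra! hcon
  let t : ℕ → Set (OExp E G) := fun k => {u | (∀ x, ‖OExp.eval E x u‖ ≤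
      if level K x ≤ k₀ + k then a (level K x) else (N : ℝ) ^ level K x) ∧ T ≤ p u}
  have hcl : ∀ k, IsClosed (t k) := fun k => by
    have heq : t k = (⋂ x, {u | ‖OExp.eval E x u‖ ≤ if level K x ≤ k₀ + k then a (level K x)
        else (N : ℝ) ^ level K x}) ∩ {u | T ≤ p u} := by
      ext u
      simp only [Set.mem_inter_iff, Set.mem_iInter]
      rfl
    rw [heq]
    exact (isClosed_iInter fun x => isClosed_le (OExp.continuous_eval hK x).norm
      continuous_const).inter (isClosed_le continuous_const hp)
  have hle : ∀ k n, (if n ≤ k then a n else (N : ℝ) ^ n) ≤ (N : ℝ) ^ n := fun k n => by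
    split_ifs
    exacts [ha n, le_rfl]
  have hdec : ∀ k, t (k + 1) ⊆ t k := fun k u hu => by
    refine ⟨fun x => (hu.1 x).trans ?_, hu.2⟩
    by_cases hx : level K x ≤ k₀ + k
    · rw [if_pos hx, if_pos (by omega)]
    · rw [if_neg hx]
      exact hle _ _
  obtain ⟨u, hu⟩ := IsCompact.nonempty_iInter_of_sequence_nonempty_isCompact_isClosed t hdec
    (fun k => hcon (k₀ + k) (by omega))
    ((isCompact_expBall hK hN).of_isClosed_subset (hcl 0) fun u hu x => (hu.1 x).trans (hle _ _))
    hcl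
  rw [Set.mem_iInter] at hu
  refine absurd (h u fun x => ?_) (not_lt.2 (hu 0).2)
  have := (hu (level K x)).1 x
  rwa [if_pos (by omega)] at this

/-- Each continuous seminorm on the space of functions of exponential type is dominated by a
weighted supremum norm, for a weight which grows faster than all exponential functions. -/
theorem exists_weight_seminorm_le [WeaklyLocallyCompactSpace G] (hK : IsGeneratingNhd K)
    {p : Seminorm ℂ (OExp E G)} (hp : Continuous p) :
    ∃ w : ℕ → ℝ, (∀ n, 0 < w n) ∧ (∀ N : ℕ, 1 ≤ N → ∃ A : ℝ, ∀ n, (N : ℝ) ^ n ≤ A * w n) ∧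
      ∀ (u : OExp E G) (t : ℝ), 0 ≤ t → (∀ x, ‖OExp.eval E x u‖ ≤ t * w (level K x)) →
        p u ≤ t := by
  obtain ⟨C, hC⟩ := (isCompact_expBall (E := E) hK le_rfl).exists_bound_of_continuousOn
    hp.continuousOn
  obtain ⟨T, hT0, hCT⟩ : ∃ T : ℝ, 0 < T ∧ C < T := ⟨|C| + 1, by positivity, by
    linarith [le_abs_self C]⟩
  let P : ℕ → (ℕ → ℝ) × ℕ → Prop := fun j s => (∀ n, s.1 n ≤ ((j + 1 : ℕ) : ℝ) ^ n) ∧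
    (∀ n, 1 ≤ s.1 n) ∧ (∀ n, s.2 < n → s.1 n = ((j + 1 : ℕ) : ℝ) ^ n) ∧
    (∀ u, (∀ x, ‖OExp.eval E x u‖ ≤ s.1 (level K x)) → p u < T) ∧ j ≤ s.2
  let R : (ℕ → ℝ) × ℕ → (ℕ → ℝ) × ℕ → Prop := fun s s' =>
    (∀ n ≤ s'.2, s'.1 n = s.1 n) ∧ s.2 < s'.2 ∧ ∀ n, s.1 n ≤ s'.1 n
  have h0 : P 0 (fun _ => 1, 0) := by
    refine ⟨fun n => by simp, fun n => le_rfl, fun n _ => by simp, fun u hu => ?_, le_rfl⟩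
    refine ((le_abs_self _).trans (hC u fun x => ?_)).trans_lt hCT
    simpa using hu x
  have hstep : ∀ j s, P j s → ∃ s', P (j + 1) s' ∧ R s s' := by
    rintro j ⟨a, k⟩ ⟨h1, h2, h3, h4, h5⟩
    have h1' : ∀ n, a n ≤ ((j + 1 + 1 : ℕ) : ℝ) ^ n := fun n =>
      (h1 n).trans (by gcongr; omega)
    obtain ⟨k', hk', hlt⟩ := exists_nat_forall_seminorm_lt hK hp (by omega) h1' h4 (k + 1)
    have hk : k < k' := hk'
    refine ⟨(fun n => if n ≤ k' then a n else ((j + 1 + 1 : ℕ) : ℝ) ^ n, k'),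
      ⟨fun n => ?_, fun n => ?_, fun n hn => if_neg (not_le.2 hn), hlt, ?_⟩,
      fun n hn => if_pos hn, hk, fun n => ?_⟩
    · dsimp only
      split_ifs
      exacts [h1' n, le_rfl]
    · dsimp only
      split_ifs
      exacts [h2 n, (h2 n).trans (h1' n)]
    · have : j ≤ k := h5
      change j + 1 ≤ k'
      omega
    · dsimp only
      split_ifs
      exacts [le_rfl, h1' n]
  choose next hP hR using hstep
  let s : ∀ j, {s // P j s} := fun j =>
    Nat.rec ⟨_, h0⟩ (fun j s => ⟨next j s.1 s.2, hP j s.1 s.2⟩) j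
  have hs : ∀ j, R (s j).1 (s (j + 1)).1 := fun j => hR j (s j).1 (s j).2
  let a : ℕ → ℕ → ℝ := fun j => (s j).1.1
  let k : ℕ → ℕ := fun j => (s j).1.2
  have hak : ∀ j, P j (a j, k j) := fun j => (s j).2
  have hmono : ∀ n, Monotone fun j => a j n := fun n =>
    monotone_nat_of_le_succ fun j => (hs j).2.2 n
  have hkmono : StrictMono k := strictMono_nat_of_lt_succ fun j => (hs j).2.1
  have hstab : ∀ j n, n ≤ k j → ∀ i, j ≤ i → a i n = a j n := by
    intro j n hn i hi
    induction i, hi using Nat.le_induction with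
    | base => rfl
    | succ i hi ih =>
      rw [← ih]
      exact (hs i).1 n (hn.trans (hkmono.monotone (hi.trans i.le_succ)))
  have hdiag : ∀ j n, n ≤ j → a j n = a n n := fun j n hn => hstab n n (hak n).2.2.2.2 j hn
  have hge : ∀ j n, a j n ≤ a n n := fun j n => by
    rcases le_total n j with h | h
    exacts [(hdiag j n h).le, hmono n h]
  have hone : ∀ n, 1 ≤ a n n := fun n => (hak n).2.1 n
  refine ⟨fun n => a n n / T, fun n => div_pos (zero_lt_one.trans_le (hone n)) hT0,
    fun N hN => ?_, fun u t ht hu => ?_⟩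
  · obtain ⟨j, rfl⟩ := Nat.exists_eq_add_of_le' hN
    refine ⟨((j + 1 : ℕ) : ℝ) ^ k j * T, fun n => ?_⟩
    have hN1 : (1 : ℝ) ≤ ((j + 1 : ℕ) : ℝ) := by exact_mod_cast hN
    rw [mul_assoc, mul_div_cancel₀ _ hT0.ne']
    rcases le_or_gt n (k j) with h | h
    · calc ((j + 1 : ℕ) : ℝ) ^ n ≤ ((j + 1 : ℕ) : ℝ) ^ k j := pow_le_pow_right₀ hN1 h
        _ ≤ _ := le_mul_of_one_le_right (by positivity) (hone n)
    · rw [← (hak j).2.2.1 n h]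
      exact (hge j n).trans (le_mul_of_one_le_left (zero_le_one.trans (hone n)) (one_le_pow₀ hN1))
  · have main : ∀ u : OExp E G, (∀ x, ‖OExp.eval E x u‖ ≤ a (level K x) (level K x)) → p u < T := by
      intro u hu
      obtain ⟨N, hN, huN⟩ := exists_mem_expBall hK u
      obtain ⟨j, rfl⟩ := Nat.exists_eq_add_of_le' hN
      refine (hak j).2.2.2.1 u fun x => ?_
      rcases le_or_gt (level K x) (k j) with h | h
      · refine (hu x).trans_eq ?_
        rcases le_total (level K x) j with h' | h'
        exacts [(hdiag j _ h').symm, hstab j _ h _ h']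
      · exact (huN x).trans_eq ((hak j).2.2.1 _ h).symm
    rcases ht.eq_or_lt with rfl | ht
    · have : u = 0 := OExp.ext_eval fun x => by simpa using hu x
      simp [this]
    · have := main (((T / t : ℝ) : ℂ) • u) fun x => by
        rw [map_smul, norm_smul, Complex.norm_real, Real.norm_of_nonneg (by positivity)]
        calc T / t * ‖OExp.eval E x u‖
            ≤ T / t * (t * (a (level K x) (level K x) / T)) := by gcongr; exact hu x
          _ = _ := by field_simp
      rw [map_smul_eq_mul, Complex.norm_real, Real.norm_of_nonneg (by positivity),
        div_mul_eq_mul_div, div_lt_iff₀ ht] at this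
      exact (lt_of_mul_lt_mul_left this hT0.le).le

end OExp

section Dual

variable {E : Type v} [NormedAddCommGroup E] [NormedSpace ℂ E]
variable {G : Type u} [TopologicalSpace G] [ChartedSpace E G] [Group G]

variable (E) in
/-- The polar of `expBall E K N`. -/
def dualBall (K : Set G) (N : ℕ) : Set (StereotypeDual (OExp E G)) :=
  {α | ∀ u ∈ expBall E K N, ‖α u‖ ≤ 1}

variable {K : Set G}

theorem mem_dualBall_of_forall_smul (hK : IsGeneratingNhd K) {N r : ℕ} (hr : 1 ≤ r)
    {α : StereotypeDual (OExp E G)} (hα : α ∈ dualBall E K (r * N)) {u : OExp E G}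
    (hu : u ∈ expBall E K N) : ‖α u‖ ≤ 1 / r := by
  have hr' : (0 : ℝ) < r := by exact_mod_cast hr
  have := hα _ (smul_mem_expBall hK hr (a := (r : ℂ)) (by simp) hu)
  rw [map_smul, norm_smul, Complex.norm_natCast] at this
  rw [le_div_iff₀ hr']
  linarith

/-- The polars of the totally bounded sets of a locally convex space are a base of neighbourhoods of
zero of its stereotype dual. -/
theorem StereotypeDual.hasBasis_nhds_zero (X : Type u) [AddCommGroup X] [Module ℂ X]
    [TopologicalSpace X] [IsTopologicalAddGroup X] :
    (𝓝 (0 : StereotypeDual X)).HasBasis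
      (fun Sr : Set X × ℝ =>
        @TotallyBounded X (IsTopologicalAddGroup.rightUniformSpace X) Sr.1 ∧ 0 < Sr.2)
      fun Sr => {f | ∀ x ∈ Sr.1, ‖f x‖ ≤ Sr.2} := by
  have := UniformConvergenceCLM.hasBasis_nhds_zero_of_basis (RingHom.id ℂ) ℂ
    {S : Set X | @TotallyBounded X (IsTopologicalAddGroup.rightUniformSpace X) S}
    ⟨∅, @totallyBounded_empty X (IsTopologicalAddGroup.rightUniformSpace X)⟩
    (fun S hS T hT => ⟨S ∪ T, @TotallyBounded.union X (IsTopologicalAddGroup.rightUniformSpace X)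
      S T hS hT, Set.subset_union_left, Set.subset_union_right⟩)
    (Metric.nhds_basis_closedBall (x := (0 : ℂ)))
  simpa only [mem_closedBall_zero_iff] using! this

variable [LieGroup 𝓘(ℂ, E) ω G] [IsTopologicalGroup G]

theorem hasBasis_nhds_zero_dual [WeaklyLocallyCompactSpace G] (hK : IsGeneratingNhd K) :
    (𝓝 (0 : StereotypeDual (OExp E G))).HasBasis (fun N : ℕ => 1 ≤ N) (dualBall E K) := by
  refine (StereotypeDual.hasBasis_nhds_zero (OExp E G)).to_hasBasis ?_ ?_
  · rintro ⟨S, r⟩ ⟨hS, hr⟩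
    obtain ⟨N, hN, hSN⟩ := exists_subset_expBall hK hS
    obtain ⟨q, hq⟩ := exists_nat_ge (1 / r)
    have hr' : 0 < 1 / r := by positivity
    have hq1 : 1 ≤ q := by exact_mod_cast (hr'.trans_le hq : (0 : ℝ) < q)
    refine ⟨q * N, Nat.mul_pos hq1 hN, fun α hα u hu => ?_⟩
    refine (mem_dualBall_of_forall_smul hK hq1 hα (hSN hu)).trans ?_
    exact (one_div_le (by exact_mod_cast hq1) hr).2 hq
  · intro N hN
    refine ⟨(expBall E K N, 1), ⟨?_, one_pos⟩, fun α hα => hα⟩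
    let _ : UniformSpace (OExp E G) := IsTopologicalAddGroup.rightUniformSpace (OExp E G)
    exact (isCompact_expBall hK hN).totallyBounded

end Dual

section NuclearMaps

theorem mem_smul_closedBall_iff {Y : Type w} [NormedAddCommGroup Y] [NormedSpace ℂ Y] {r : ℝ}
    (hr : 0 < r) {y : Y} : y ∈ (r : ℂ) • Metric.closedBall (0 : Y) 1 ↔ ‖y‖ ≤ r := by
  have hr' : (r : ℂ) ≠ 0 := by exact_mod_cast hr.ne'
  rw [smul_closedBall _ _ zero_le_one, smul_zero, mem_closedBall_zero_iff, mul_one,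
    Complex.norm_real, Real.norm_of_nonneg hr.le]

theorem isBanachDisk_closedBall (Y : Type w) [NormedAddCommGroup Y] [NormedSpace ℂ Y]
    [CompleteSpace Y] : IsBanachDisk (Metric.closedBall (0 : Y) 1) where
  nonempty := ⟨0, by simp⟩
  balanced := balanced_closedBall_zero
  convex := convex_closedBall 0 1
  isClosed := Metric.isClosed_closedBall
  bounded := NormedSpace.isVonNBounded_closedBall ℂ Y 1
  complete := fun x _ hx => by
    have hc : CauchySeq x := by
      rw [Metric.cauchySeq_iff]
      intro ε hε
      obtain ⟨n₀, h⟩ := hx (ε / 2) (by linarith)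
      refine ⟨n₀, fun m hm n hn => ?_⟩
      rw [dist_eq_norm]
      exact ((mem_smul_closedBall_iff (by linarith)).1 (h m hm n hn)).trans_lt (by linarith)
    obtain ⟨a, ha⟩ := cauchySeq_tendsto_of_complete hc
    refine ⟨a, ⟨‖a‖ + 1, by positivity, (mem_smul_closedBall_iff (by positivity)).2 (by linarith)⟩,
      fun ε hε => ?_⟩
    obtain ⟨n₀, h⟩ := Metric.tendsto_atTop.1 ha ε hε
    exact ⟨n₀, fun n hn => (mem_smul_closedBall_iff hε).2 (by
      rw [← dist_eq_norm]; exact (h n hn).le)⟩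

theorem equicontinuous_of_mem_nhds_zero {X : Type u} [AddCommGroup X] [Module ℂ X]
    [TopologicalSpace X] [IsTopologicalAddGroup X] [ContinuousSMul ℂ X] {ι : Type*}
    (f : ι → X →L[ℂ] ℂ) (h : {x | ∀ i, ‖f i x‖ ≤ 1} ∈ 𝓝 (0 : X)) :
    Equicontinuous fun i (x : X) => f i x := by
  intro x
  rw [Metric.equicontinuousAt_iff_right]
  intro ε hε
  have hlim : Filter.Tendsto (fun y => ((2 / ε : ℝ) : ℂ) • (y - x)) (𝓝 x) (𝓝 0) := by
    have : Continuous fun y => ((2 / ε : ℝ) : ℂ) • (y - x) :=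
      (continuous_id.sub continuous_const).const_smul _
    simpa using this.tendsto x
  filter_upwards [hlim.eventually h] with y hy i
  have := hy i
  rw [map_smul, norm_smul, Complex.norm_real, Real.norm_of_nonneg (by positivity), map_sub,
    ← dist_eq_norm, dist_comm, div_mul_eq_mul_div, div_le_one hε] at this
  linarith

theorem IsNuclearMap.of_hasSum {X : Type u} [AddCommGroup X] [Module ℂ X]
    [TopologicalSpace X] [IsTopologicalAddGroup X] [ContinuousSMul ℂ X]
    {Y : Type w} [NormedAddCommGroup Y] [NormedSpace ℂ Y] [CompleteSpace Y] {φ : X →L[ℂ] Y}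
    (f : ℕ → X →L[ℂ] ℂ) (b : ℕ → Y) (c : ℕ → ℝ) (hf : {x | ∀ n, ‖f n x‖ ≤ 1} ∈ 𝓝 (0 : X))
    (hb : ∀ n, ‖b n‖ ≤ 1) (hc0 : ∀ n, 0 ≤ c n) (hc : Summable c)
    (h : ∀ x, HasSum (fun n => (c n : ℂ) • f n x • b n) (φ x)) : IsNuclearMap φ :=
  ⟨f, b, c, _, equicontinuous_of_mem_nhds_zero f hf, isBanachDisk_closedBall Y,
    fun n => by simpa using hb n, hc0, hc, h⟩

end NuclearMaps

section Sampling

variable (E : Type v) [NormedAddCommGroup E] [NormedSpace ℂ E]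
variable {G : Type u} [TopologicalSpace G] [ChartedSpace E G] [Group G]

/-- Points and coefficients which control the values of the holomorphic functions on `K ^ n` by
their values on `K ^ (2 * n + 1)`. -/
structure SamplingData (K : Set G) where
  C : ℝ
  m : ℕ
  z : ℕ → ℕ → G
  c : ℕ → ℕ → ℝ
  C_nonneg : 0 ≤ C
  one_le_m : 1 ≤ m
  z_mem : ∀ n j, z n j ∈ K ^ (2 * n + 1)
  c_nonneg : ∀ n j, 0 ≤ c n j
  summable : ∀ n, Summable (c n)
  tsum_le : ∀ n, ∑' j, c n j ≤ C * m ^ n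
  norm_le : ∀ f : G → ℂ, MDifferentiable 𝓘(ℂ, E) 𝓘(ℂ, ℂ) f → ∀ n, ∀ x ∈ K ^ n,
    ‖f x‖ ≤ ∑' j, c n j * ‖f (z n j)‖

variable {E} {K : Set G}

theorem nonempty_samplingData [FiniteDimensional ℂ E] [IsTopologicalGroup G]
    [LieGroup 𝓘(ℂ, E) ω G] (hK : IsGeneratingNhd K) : Nonempty (SamplingData E K) := by
  obtain ⟨C, m, z, c, h1, h2, h3, h4, h5, h6, h7⟩ := exists_seq_norm_le_tsum_pow E hK
  exact ⟨⟨C, m, z, c, h1, h2, h3, h4, h5, h6, h7⟩⟩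

namespace SamplingData

/-- The coefficients in the comparison of weighted supremum norms. -/
noncomputable def coeff (D : SamplingData E K) (a b : ℕ → ℝ) (p : ℕ × ℕ) : ℝ :=
  D.c p.1 p.2 * (a (2 * p.1 + 1) / b p.1)

variable (D : SamplingData E K) {a b : ℕ → ℝ}

theorem coeff_nonneg (ha : ∀ n, 0 < a n) (hb : ∀ n, 0 < b n) (p : ℕ × ℕ) : 0 ≤ D.coeff a b p :=
  mul_nonneg (D.c_nonneg _ _) (div_pos (ha _) (hb _)).le

theorem summable_coeff (ha : ∀ n, 0 < a n) (hb : ∀ n, 0 < b n)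
    (hab : ∀ n, a (2 * n + 1) * (2 * D.m) ^ n ≤ b n) : Summable (D.coeff a b) := by
  refine (summable_prod_of_nonneg (D.coeff_nonneg ha hb)).2
    ⟨fun n => (D.summable n).mul_right (a (2 * n + 1) / b n), ?_⟩
  refine Summable.of_nonneg_of_le (fun n => tsum_nonneg fun j => D.coeff_nonneg ha hb _)
    (fun n => ?_) (summable_geometric_two.mul_left D.C)
  have hm : (0 : ℝ) < D.m := by exact_mod_cast D.one_le_m
  simp only [coeff]
  rw [(D.summable n).tsum_mul_right]
  have h1 : a (2 * n + 1) / b n ≤ 1 / (2 * D.m) ^ n := by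
    rw [div_le_div_iff₀ (hb n) (by positivity), one_mul]
    exact hab n
  calc (∑' j, D.c n j) * (a (2 * n + 1) / b n) ≤ D.C * D.m ^ n * (1 / (2 * D.m) ^ n) :=
        mul_le_mul (D.tsum_le n) h1 (div_pos (ha _) (hb _)).le
          (mul_nonneg D.C_nonneg (by positivity))
    _ = D.C * (1 / 2) ^ n := by
        rw [mul_pow, one_div_pow]; field_simp

theorem summable_coeff_mul (ha : ∀ n, 0 < a n) (hb : ∀ n, 0 < b n)
    (hab : ∀ n, a (2 * n + 1) * (2 * D.m) ^ n ≤ b n) {f : G → ℂ} {A : ℝ}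
    (hA : ∀ n, ∀ x ∈ K ^ n, ‖f x‖ ≤ A * a n) :
    Summable fun p : ℕ × ℕ => D.coeff a b p * (‖f (D.z p.1 p.2)‖ / a (2 * p.1 + 1)) := by
  refine Summable.of_nonneg_of_le
    (fun p => mul_nonneg (D.coeff_nonneg ha hb p) (div_nonneg (norm_nonneg _) (ha _).le))
    (fun p => mul_le_mul_of_nonneg_left ?_ (D.coeff_nonneg ha hb p))
    ((D.summable_coeff ha hb hab).mul_right A)
  rw [div_le_iff₀ (ha _)]
  exact hA _ _ (D.z_mem _ _)

theorem norm_div_le (ha : ∀ n, 0 < a n) (hb : ∀ n, 0 < b n)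
    (hab : ∀ n, a (2 * n + 1) * (2 * D.m) ^ n ≤ b n) {f : G → ℂ}
    (hf : MDifferentiable 𝓘(ℂ, E) 𝓘(ℂ, ℂ) f) {A : ℝ} (hA : ∀ n, ∀ x ∈ K ^ n, ‖f x‖ ≤ A * a n)
    {n : ℕ} {x : G} (hx : x ∈ K ^ n) : ‖f x‖ / b n
      ≤ ∑' p : ℕ × ℕ, D.coeff a b p * (‖f (D.z p.1 p.2)‖ / a (2 * p.1 + 1)) := by
  have hs := D.summable_coeff_mul ha hb hab hA
  have h1 : ‖f x‖ / b n
      ≤ ∑' j, D.coeff a b (n, j) * (‖f (D.z n j)‖ / a (2 * n + 1)) := by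
    have hs' : Summable fun j => D.coeff a b (n, j) * (‖f (D.z n j)‖ / a (2 * n + 1)) :=
      hs.comp_injective (Prod.mk_right_injective n)
    rw [div_le_iff₀ (hb n), ← hs'.tsum_mul_right]
    refine (D.norm_le f hf n x hx).trans_eq (tsum_congr fun j => ?_)
    have := (ha (2 * n + 1)).ne'
    have := (hb n).ne'
    simp only [coeff]
    field_simp
  rw [hs.tsum_prod]
  refine h1.trans (hs.prod.le_tsum n fun i _ => tsum_nonneg fun j =>
    mul_nonneg (D.coeff_nonneg ha hb _) (div_nonneg (norm_nonneg _) (ha _).le))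

/-- A linear map dominated by a weighted supremum norm has a nuclear expansion in point evaluations
on functions whose growth is bounded by a sufficiently smaller weight. -/
theorem exists_nuclear_expansion {w₀ w₁ w₂ : ℕ → ℝ} (h₀ : ∀ n, 0 < w₀ n) (h₁ : ∀ n, 0 < w₁ n)
    (h₂ : ∀ n, 0 < w₂ n) (h₁₀ : ∀ n, w₁ (2 * n + 1) * (2 * D.m) ^ n ≤ w₀ n)
    (h₂₁ : ∀ n, w₂ (2 * n + 1) * (2 * D.m) ^ n ≤ w₁ n) (hK : IsGeneratingNhd K)
    {V : Type*} [AddCommGroup V] [Module ℂ V] (τ : V →ₗ[ℂ] holomorphicFunctions E G)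
    {Y : Type*} [NormedAddCommGroup Y] [NormedSpace ℂ Y] [CompleteSpace Y] (φ : V →ₗ[ℂ] Y)
    (hτ : ∀ v, ∃ A : ℝ, ∀ n, ∀ x ∈ K ^ n, ‖(τ v).1 x‖ ≤ A * w₂ n)
    (hφ : ∀ v (t : ℝ), 0 ≤ t → (∀ x, ‖(τ v).1 x‖ ≤ t * w₀ (level K x)) → ‖φ v‖ ≤ t) :
    ∃ (γ : ℕ × ℕ → ℝ) (b : ℕ × ℕ → Y), (∀ p, 0 ≤ γ p) ∧ Summable γ ∧ (∀ p, ‖b p‖ ≤ 1) ∧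
      (∀ p, b p ∈ closure (Set.range φ)) ∧ ∀ v, HasSum
        (fun p => (γ p : ℂ) • (((w₂ (2 * p.1 + 1))⁻¹ : ℝ) * (τ v).1 (D.z p.1 p.2) : ℂ) • b p)
        (φ v) := by
  let ev : (ℕ → ℝ) → ℕ × ℕ → V →ₗ[ℂ] ℂ := fun a p => (((a (2 * p.1 + 1))⁻¹ : ℝ) : ℂ) •
    ((ContinuousMap.evalCLM ℂ (D.z p.1 p.2)).toLinearMap ∘ₗ (holomorphicFunctions E G).subtype ∘ₗ τ)
  have hev : ∀ a p v, ev a p v = (((a (2 * p.1 + 1))⁻¹ : ℝ) : ℂ) * (τ v).1 (D.z p.1 p.2) :=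
    fun a p v => rfl
  have hevn : ∀ a : ℕ → ℝ, (∀ n, 0 < a n) → ∀ p v,
      ‖ev a p v‖ = ‖(τ v).1 (D.z p.1 p.2)‖ / a (2 * p.1 + 1) := fun a ha p v => by
    rw [hev, norm_mul, Complex.norm_real, Real.norm_of_nonneg (inv_pos.2 (ha _)).le, div_eq_inv_mul]
  have hτ₁ : ∀ v, ∃ A : ℝ, ∀ n, ∀ x ∈ K ^ n, ‖(τ v).1 x‖ ≤ A * w₁ n := fun v => by
    obtain ⟨A, hA⟩ := hτ v
    refine ⟨_, fun n x hx => (div_le_iff₀ (h₁ n)).1 (D.norm_div_le h₂ h₁ h₂₁ (τ v).2 hA hx)⟩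
  refine _root_.exists_nuclear_expansion φ (D.coeff_nonneg h₁ h₀) (D.coeff_nonneg h₂ h₁)
    (D.summable_coeff h₁ h₀ h₁₀) (D.summable_coeff h₂ h₁ h₂₁) (ev w₁) (ev w₂)
    (fun v => ?_) (fun p v => ?_) (fun v => ?_)
  · obtain ⟨A, hA⟩ := hτ₁ v
    simp only [hevn w₁ h₁]
    refine hφ v _ (tsum_nonneg fun p => mul_nonneg (D.coeff_nonneg h₁ h₀ _)
      (div_nonneg (norm_nonneg _) (h₁ _).le)) fun x => ?_
    rw [← div_le_iff₀ (h₀ _)]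
    exact D.norm_div_le h₁ h₀ h₁₀ (τ v).2 hA (hK.mem_pow_level x)
  · obtain ⟨A, hA⟩ := hτ v
    simp only [hevn w₂ h₂]
    rw [hevn w₁ h₁]
    exact D.norm_div_le h₂ h₁ h₂₁ (τ v).2 hA (D.z_mem _ _)
  · obtain ⟨A, hA⟩ := hτ v
    refine ⟨A, fun p => ?_⟩
    rw [hevn w₂ h₂, div_le_iff₀ (h₂ _)]
    exact hA _ _ (D.z_mem _ _)

end SamplingData

/-- The largest weight `w'` with `w' (2 * n + 1) * m ^ n ≤ w n`. -/
noncomputable def slowWeight (m : ℕ) (w : ℕ → ℝ) (k : ℕ) : ℝ := w ((k - 1) / 2) / m ^ ((k - 1) / 2)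

theorem slowWeight_pos {m : ℕ} (hm : 1 ≤ m) {w : ℕ → ℝ} (hw : ∀ n, 0 < w n) (k : ℕ) :
    0 < slowWeight m w k :=
  div_pos (hw _) (pow_pos (by exact_mod_cast hm) _)

theorem slowWeight_mul {m : ℕ} (hm : 1 ≤ m) (w : ℕ → ℝ) (n : ℕ) :
    slowWeight m w (2 * n + 1) * m ^ n = w n := by
  have hm' : (0 : ℝ) < m := by exact_mod_cast hm
  simp only [slowWeight, Nat.add_sub_cancel, Nat.mul_div_cancel_left n two_pos]
  field_simp

theorem slowWeight_growth {m : ℕ} (hm : 1 ≤ m) {w : ℕ → ℝ}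
    (h : ∀ N : ℕ, 1 ≤ N → ∃ A : ℝ, ∀ n, (N : ℝ) ^ n ≤ A * w n) (N : ℕ) (hN : 1 ≤ N) :
    ∃ A : ℝ, ∀ n, (N : ℝ) ^ n ≤ A * slowWeight m w n := by
  obtain ⟨A, hA⟩ := h (m * N ^ 2) (Nat.mul_pos hm (pow_pos hN 2))
  have hm' : (0 : ℝ) < m := by exact_mod_cast hm
  have hN' : (1 : ℝ) ≤ N := by exact_mod_cast hN
  refine ⟨N ^ 2 * A, fun k => ?_⟩
  set q := (k - 1) / 2 with hq
  have hk : k ≤ 2 + 2 * q := by omega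
  have h1 := hA q
  push_cast at h1
  rw [mul_pow, ← pow_mul] at h1
  calc (N : ℝ) ^ k ≤ (N : ℝ) ^ (2 + 2 * q) := pow_le_pow_right₀ hN' hk
    _ = N ^ 2 * ((m : ℝ) ^ q * (N : ℝ) ^ (2 * q)) / (m : ℝ) ^ q := by
        rw [pow_add]; field_simp
    _ ≤ N ^ 2 * (A * w q) / (m : ℝ) ^ q := by gcongr
    _ = N ^ 2 * A * slowWeight m w k := by simp only [slowWeight, ← hq]; ring

theorem norm_le_mul_of_mem_expBall (hK : IsGeneratingNhd K) {w : ℕ → ℝ} {N : ℕ}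
    {A : ℝ} (hN : 1 ≤ N) (hA : ∀ n, (N : ℝ) ^ n ≤ A * w n) {u : OExp E G}
    (hu : u ∈ expBall E K N) {n : ℕ} {x : G} (hx : x ∈ K ^ n) :
    ‖OExp.eval E x u‖ ≤ N * A * w n := by
  have hN' : (1 : ℝ) ≤ N := by exact_mod_cast hN
  have hlev : level K x ≤ n + 1 := level_le (by omega) (hK.pow_subset_pow n.le_succ hx)
  calc ‖OExp.eval E x u‖ ≤ (N : ℝ) ^ level K x := hu x
    _ ≤ (N : ℝ) ^ (n + 1) := pow_le_pow_right₀ hN' hlev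
    _ = N * (N : ℝ) ^ n := pow_succ' _ _
    _ ≤ N * (A * w n) := by gcongr; exact hA n
    _ = _ := by ring

/-- Continuous linear maps from the space of functions of exponential type into Banach spaces are
nuclear. -/
theorem isNuclearMap_oExp [FiniteDimensional ℂ E] [LieGroup 𝓘(ℂ, E) ω G] [IsTopologicalGroup G]
    [WeaklyLocallyCompactSpace G] (hK : IsGeneratingNhd K) {Y : Type w} [NormedAddCommGroup Y]
    [NormedSpace ℂ Y] [CompleteSpace Y] (φ : OExp E G →L[ℂ] Y) : IsNuclearMap φ := by
  obtain ⟨D⟩ := nonempty_samplingData (E := E) hK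
  let p : Seminorm ℂ (OExp E G) := (normSeminorm ℂ Y).comp φ.toLinearMap
  have hp : Continuous p := φ.continuous.norm
  obtain ⟨w, hw0, hw, hpw⟩ := exists_weight_seminorm_le hK hp
  have hm : 1 ≤ 2 * D.m := by have := D.one_le_m; omega
  set w₁ := slowWeight (2 * D.m) w
  set w₂ := slowWeight (2 * D.m) w₁
  have h₁0 : ∀ n, 0 < w₁ n := slowWeight_pos hm hw0
  have h₂0 : ∀ n, 0 < w₂ n := slowWeight_pos hm h₁0
  have h₂ := slowWeight_growth hm (slowWeight_growth hm hw)
  obtain ⟨γ, b, hγ0, hγ, hb, -, hsum⟩ := D.exists_nuclear_expansion hw0 h₁0 h₂0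
    (fun n => le_of_eq (by have := slowWeight_mul hm w n; push_cast at this; exact this))
    (fun n => le_of_eq (by have := slowWeight_mul hm w₁ n; push_cast at this; exact this))
    hK (OExp.toHolomorphic E) φ.toLinearMap
    (fun u => by
      obtain ⟨N, hN, hu⟩ := exists_mem_expBall hK u
      obtain ⟨A, hA⟩ := h₂ N hN
      exact ⟨N * A, fun n x hx => norm_le_mul_of_mem_expBall hK hN hA hu hx⟩)
    hpw
  obtain ⟨e⟩ := nonempty_equiv_of_countable (α := ℕ) (β := ℕ × ℕ)
  let f : ℕ × ℕ → OExp E G →L[ℂ] ℂ := fun p =>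
    (((w₂ (2 * p.1 + 1))⁻¹ : ℝ) : ℂ) • ⟨OExp.eval E (D.z p.1 p.2), OExp.continuous_eval hK _⟩
  have hf : ∀ p u, f p u = (((w₂ (2 * p.1 + 1))⁻¹ : ℝ) : ℂ) * OExp.eval E (D.z p.1 p.2) u :=
    fun p u => rfl
  refine IsNuclearMap.of_hasSum (f ∘ e) (b ∘ e) (γ ∘ e) ?_ (fun n => hb _) (fun n => hγ0 _)
    (e.summable_iff.2 hγ) fun u => ?_
  · refine mem_nhds_zero_oExp hK ?_ ?_ fun N hN => ?_
    · rw [balanced_iff_smul_mem]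
      intro a ha u hu n
      rw [map_smul, norm_smul]
      exact (mul_le_of_le_one_left (norm_nonneg _) ha).trans (hu n)
    · rw [Set.ofPred_forall]
      refine convex_iInter fun n => ?_
      have : {u : OExp E G | ‖(f ∘ e) n u‖ ≤ 1} = ((normSeminorm ℂ ℂ).comp
          ((f ∘ e) n).toLinearMap).closedBall 0 1 := by
        ext u; simp
      rw [this]
      exact Seminorm.convex_closedBall _ _ _
    · obtain ⟨A, hA⟩ := h₂ N hN
      have hNpos : (0 : ℝ) < N := by exact_mod_cast hN
      have hApos : 0 < A := by
        have h1 := hA 0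
        rw [pow_zero] at h1
        by_contra hneg
        nlinarith [h₂0 0]
      refine ⟨(N * A)⁻¹, by positivity, fun u hu n => ?_⟩
      change ‖f (e n) _‖ ≤ 1
      rw [hf, map_smul, norm_mul, norm_smul, Complex.norm_real, Complex.norm_real,
        Real.norm_of_nonneg (inv_pos.2 (h₂0 _)).le, Real.norm_of_nonneg (by positivity),
        inv_mul_le_iff₀ (h₂0 _), inv_mul_le_iff₀ (by positivity), mul_one]
      exact norm_le_mul_of_mem_expBall hK hN hA hu (D.z_mem _ _)
  · exact e.hasSum_iff.2 (hsum u)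

end Sampling

section Series

theorem HasSum.norm_sub_sum_le {ι F : Type*} [NormedAddCommGroup F] {g : ι → F} {h : ι → ℝ}
    {a : F} {b : ℝ} (hg : HasSum g a) (hh : HasSum h b) (hle : ∀ i, ‖g i‖ ≤ h i) (s : Finset ι) :
    ‖a - ∑ i ∈ s, g i‖ ≤ b - ∑ i ∈ s, h i := by
  have h1 : HasSum (fun i : {i // i ∉ s} => g i) (a - ∑ i ∈ s, g i) :=
    s.hasSum_compl_iff.2 (by simpa using hg)
  have h2 : HasSum (fun i : {i // i ∉ s} => h i) (b - ∑ i ∈ s, h i) :=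
    s.hasSum_compl_iff.2 (by simpa using hh)
  exact h1.norm_le_of_bounded h2 fun i => hle i

theorem hasSum_of_norm_sub_sum_le {ι F : Type*} [NormedAddCommGroup F] {g : ι → F} {a : F}
    {r : Finset ι → ℝ} (hr : Filter.Tendsto r Filter.atTop (𝓝 0))
    (h : ∀ s, ‖a - ∑ i ∈ s, g i‖ ≤ r s) : HasSum g a := by
  rw [HasSum, SummationFilter.unconditional_filter, tendsto_iff_norm_sub_tendsto_zero]
  refine squeeze_zero (fun s => norm_nonneg _) (fun s => ?_) hr
  rw [norm_sub_rev]
  exact h s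

theorem HasSum.tendsto_mul_sub_sum {ι : Type*} {h : ι → ℝ} {b : ℝ} (hh : HasSum h b) (C : ℝ) :
    Filter.Tendsto (fun s : Finset ι => C * (b - ∑ i ∈ s, h i)) Filter.atTop (𝓝 0) := by
  rw [HasSum, SummationFilter.unconditional_filter] at hh
  simpa using (hh.const_sub b).const_mul C

end Series

section DualExpansion

theorem StereotypeDual.sum_smul_apply {X : Type u} [AddCommGroup X] [Module ℂ X]
    [TopologicalSpace X] [IsTopologicalAddGroup X] {ι : Type*} (c a : ι → ℂ)
    (f : ι → StereotypeDual X) (s : Finset ι) (x : X) :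
    (∑ j ∈ s, (c j * a j) • f j) x = ∑ j ∈ s, c j * f j x * a j := by
  classical
  induction s using Finset.induction_on with
  | empty => rfl
  | insert j s hj ih =>
    rw [Finset.sum_insert hj, Finset.sum_insert hj, ← ih, mul_right_comm]
    rfl

variable {E : Type v} [NormedAddCommGroup E] [NormedSpace ℂ E]
variable {G : Type u} [TopologicalSpace G] [ChartedSpace E G] [Group G] {K : Set G}

theorem norm_dual_le_of_le {α : StereotypeDual (OExp E G)} {N : ℕ} {C : ℝ}
    (hα : ∀ u ∈ expBall E K N, ‖α u‖ ≤ C) {r : ℝ} (hr : 0 ≤ r) {u : OExp E G}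
    (h : ∀ x, ‖OExp.eval E x u‖ ≤ r * (N : ℝ) ^ level K x) : ‖α u‖ ≤ r * C := by
  rcases hr.eq_or_lt with rfl | hr
  · have : u = 0 := OExp.ext_eval fun x => by simpa using h x
    simp [this]
  · exact seminorm_le_of_le ((normSeminorm ℂ ℂ).comp (α : OExp E G →L[ℂ] ℂ).toLinearMap) hα hr h

variable [LieGroup 𝓘(ℂ, E) ω G] [IsTopologicalGroup G] [WeaklyLocallyCompactSpace G]

theorem exists_norm_dual_le (hK : IsGeneratingNhd K) (α : StereotypeDual (OExp E G)) {N : ℕ}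
    (hN : 1 ≤ N) : ∃ C : ℝ, 0 ≤ C ∧ ∀ u ∈ expBall E K N, ‖α u‖ ≤ C := by
  obtain ⟨C, hC⟩ := (isCompact_expBall (E := E) hK hN).exists_bound_of_continuousOn
    (map_continuous (α : OExp E G →L[ℂ] ℂ)).continuousOn
  exact ⟨C, (norm_nonneg _).trans (hC 0 fun x => by simp), hC⟩

omit [WeaklyLocallyCompactSpace G] in
/-- A function on `G` which is approximated by functions of exponential type in a weighted supremum
norm is of exponential type. -/
theorem exists_oExp_of_approx (hK : IsGeneratingNhd K) {F : G → ℂ} {N : ℕ} (hN : 1 ≤ N) {A : ℝ}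
    (hF : ∀ x, ‖F x‖ ≤ A * (N : ℝ) ^ level K x)
    (h : ∀ ε : ℝ, 0 < ε → ∃ u : OExp E G, ∀ x,
      ‖OExp.eval E x u - F x‖ ≤ ε * (N : ℝ) ^ level K x) :
    ∃ u : OExp E G, ∀ x, OExp.eval E x u = F x := by
  have hN' : (1 : ℝ) ≤ N := by exact_mod_cast hN
  refine exists_oExp_of_le hK (mdifferentiable_of_forall_exists_norm_sub_le hK.mem_nhds
    fun g ε hε => ?_) hN hF
  obtain ⟨u, hu⟩ := h (ε / (N : ℝ) ^ (level K g + 1)) (by positivity)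
  refine ⟨_, u.mdifferentiable, fun k hk => (hu _).trans ?_⟩
  have hlev : level K (g * k) ≤ level K g + 1 := by
    refine level_le (by omega) ?_
    rw [pow_succ]
    exact Set.mul_mem_mul (hK.mem_pow_level g) hk
  calc ε / (N : ℝ) ^ (level K g + 1) * (N : ℝ) ^ level K (g * k)
      ≤ ε / (N : ℝ) ^ (level K g + 1) * (N : ℝ) ^ (level K g + 1) := by gcongr
    _ = ε := by field_simp

/-- Absolutely convergent series in the space of functions of exponential type. -/
theorem exists_oExp_hasSum (hK : IsGeneratingNhd K) {M : ℕ} (hM : 1 ≤ M) {b : ℕ → OExp E G}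
    (hb : ∀ j, b j ∈ expBall E K M) {γ : ℕ → ℝ} (hγ : Summable γ) {a : ℕ → ℂ}
    (ha : ∀ j, ‖a j‖ ≤ γ j) :
    ∃ u : OExp E G, ∀ α : StereotypeDual (OExp E G), HasSum (fun j => a j * α (b j)) (α u) := by
  have hterm : ∀ x j, ‖a j * OExp.eval E x (b j)‖ ≤ γ j * (M : ℝ) ^ level K x := fun x j => by
    rw [norm_mul]
    exact mul_le_mul (ha j) (hb j x) (norm_nonneg _) ((norm_nonneg _).trans (ha j))
  have hsum : ∀ x, HasSum (fun j => a j * OExp.eval E x (b j)) (∑' j, a j * OExp.eval E x (b j)) :=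
    fun x => (Summable.of_norm_bounded (hγ.mul_right _) (hterm x)).hasSum
  have hγs : ∀ x, HasSum (fun j => γ j * (M : ℝ) ^ level K x) ((∑' j, γ j) * (M : ℝ) ^ level K x) :=
    fun x => hγ.hasSum.mul_right _
  have happrox : ∀ (s : Finset ℕ) (x : G),
      ‖(∑' j, a j * OExp.eval E x (b j)) - OExp.eval E x (∑ j ∈ s, a j • b j)‖
        ≤ (∑' j, γ j - ∑ j ∈ s, γ j) * (M : ℝ) ^ level K x := fun s x => by
    have := (hsum x).norm_sub_sum_le (hγs x) (hterm x) s
    rw [← Finset.sum_mul, ← sub_mul] at this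
    simpa only [map_sum, map_smul, smul_eq_mul] using this
  obtain ⟨u, hu⟩ := exists_oExp_of_approx (E := E) hK hM (fun x => by
      simpa using happrox ∅ x) fun ε hε => by
    have hlim := hγ.hasSum.tendsto_mul_sub_sum 1
    obtain ⟨s, hs⟩ := (hlim.eventually_lt_const hε).exists
    refine ⟨∑ j ∈ s, a j • b j, fun x => ?_⟩
    rw [norm_sub_rev]
    refine (happrox s x).trans ?_
    gcongr
    linarith
  refine ⟨u, fun α => ?_⟩
  obtain ⟨C, hC, hαC⟩ := exists_norm_dual_le hK α hM
  refine hasSum_of_norm_sub_sum_le (hγ.hasSum.tendsto_mul_sub_sum C) fun s => ?_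
  have h1 : α u - ∑ j ∈ s, a j * α (b j) = α (u - ∑ j ∈ s, a j • b j) := by
    rw [map_sub, map_sum]
    simp only [map_smul, smul_eq_mul]
  rw [h1, mul_comm]
  refine norm_dual_le_of_le hαC (sub_nonneg.2 (hγ.sum_le_tsum s fun j _ =>
    (norm_nonneg _).trans (ha j))) fun x => ?_
  rw [map_sub, hu]
  exact happrox s x

/-- The inclusions of the spaces generated by the sets `expBall E K N` are nuclear, with functionals
which are continuous on the whole space of functions of exponential type. -/
theorem exists_dual_expansion [FiniteDimensional ℂ E] (hK : IsGeneratingNhd K) {N : ℕ}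
    (hN : 1 ≤ N) : ∃ (M : ℕ) (γ : ℕ → ℝ) (f : ℕ → StereotypeDual (OExp E G)) (b : ℕ → OExp E G),
      1 ≤ M ∧ (∀ j, 0 ≤ γ j) ∧ Summable γ ∧ (∀ j, f j ∈ dualBall E K N) ∧
      (∀ j, b j ∈ expBall E K M) ∧ ∀ (α : StereotypeDual (OExp E G)), ∀ u ∈ expBall E K N,
        HasSum (fun j => (γ j : ℂ) * f j u * α (b j)) (α u) := by
  obtain ⟨D⟩ := nonempty_samplingData (E := E) hK
  have hN' : (1 : ℝ) ≤ N := by exact_mod_cast hN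
  have hN0 : (0 : ℝ) < N := by linarith
  have hm0 : (0 : ℝ) < D.m := by exact_mod_cast D.one_le_m
  obtain ⟨P, hP⟩ : ∃ P : ℕ, P = 2 * D.m * N ^ 2 := ⟨_, rfl⟩
  obtain ⟨Q, hQ⟩ : ∃ Q : ℕ, Q = 2 * D.m * P ^ 2 := ⟨_, rfl⟩
  have hP1 : 1 ≤ P := by rw [hP]; exact Nat.mul_pos (Nat.mul_pos two_pos D.one_le_m) (pow_pos hN 2)
  have hQ1 : 1 ≤ Q := by rw [hQ]; exact Nat.mul_pos (Nat.mul_pos two_pos D.one_le_m) (pow_pos hP1 2)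
  have hP0 : (0 : ℝ) < P := by exact_mod_cast hP1
  have hQ0 : (0 : ℝ) < Q := by exact_mod_cast hQ1
  have hM1 : 1 ≤ N * P * Q := Nat.mul_pos (Nat.mul_pos hN hP1) hQ1
  obtain ⟨W, hW⟩ : ∃ W : G → ℝ, ∀ x, W x = N * P * (Q : ℝ) ^ level K x := ⟨_, fun _ => rfl⟩
  have hW0 : ∀ x, 0 < W x := fun x => by rw [hW]; positivity
  have hWM : ∀ x, W x ≤ ((N * P * Q : ℕ) : ℝ) ^ level K x := fun x => by
    rw [hW]
    have := le_mul_pow_level hK (r := N * P) hQ0.le (Nat.mul_pos hN hP1) x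
    push_cast at this ⊢
    exact this
  let V : Submodule ℂ (OExp E G) :=
    { carrier := {u | ∃ A : ℝ, 0 ≤ A ∧ ∀ x, ‖OExp.eval E x u‖ ≤ A * (N : ℝ) ^ level K x}
      add_mem' := by
        rintro u v ⟨A, hA0, hA⟩ ⟨B, hB0, hB⟩
        refine ⟨A + B, add_nonneg hA0 hB0, fun x => ?_⟩
        rw [map_add, add_mul]
        exact (norm_add_le _ _).trans (add_le_add (hA x) (hB x))
      zero_mem' := ⟨0, le_rfl, fun x => by simp⟩
      smul_mem' := by
        rintro a u ⟨A, hA0, hA⟩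
        refine ⟨‖a‖ * A, by positivity, fun x => ?_⟩
        rw [map_smul, norm_smul, mul_assoc]
        exact mul_le_mul_of_nonneg_left (hA x) (norm_nonneg a) }
  have hVW : ∀ u ∈ V, ∃ A : ℝ, ∀ x, ‖OExp.eval E x u / (W x : ℂ)‖ ≤ A := by
    rintro u ⟨A, hA0, hA⟩
    refine ⟨A, fun x => ?_⟩
    rw [norm_div, Complex.norm_real, Real.norm_of_nonneg (hW0 x).le, div_le_iff₀ (hW0 x)]
    refine (hA x).trans (mul_le_mul_of_nonneg_left ?_ hA0)
    rw [hW]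
    have h1 : (N : ℝ) ≤ Q := by
      have : N ≤ Q := by
        rw [hQ, hP]
        have := D.one_le_m
        calc N ≤ N ^ 2 := Nat.le_self_pow two_ne_zero N
          _ ≤ 2 * D.m * N ^ 2 := Nat.le_mul_of_pos_left _ (by omega)
          _ ≤ (2 * D.m * N ^ 2) ^ 2 := Nat.le_self_pow two_ne_zero _
          _ ≤ _ := Nat.le_mul_of_pos_left _ (by omega)
      exact_mod_cast this
    have h2 : (1 : ℝ) ≤ N * P := by exact_mod_cast Nat.mul_pos hN hP1
    calc (N : ℝ) ^ level K x ≤ (Q : ℝ) ^ level K x := by gcongr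
      _ ≤ _ := le_mul_of_one_le_left (by positivity) h2
  let φ : V →ₗ[ℂ] lp (fun _ : G => ℂ) ⊤ :=
    { toFun := fun u => ⟨fun x => OExp.eval E x u.1 / (W x : ℂ), memℓp_infty (by
        obtain ⟨A, hA⟩ := hVW u.1 u.2
        exact ⟨A, by rintro _ ⟨x, rfl⟩; exact hA x⟩)⟩
      map_add' := fun u v => by
        ext x
        change OExp.eval E x (u.1 + v.1) / (W x : ℂ) = _ / _ + _ / _
        rw [map_add, add_div]
      map_smul' := fun a u => by
        ext x
        change OExp.eval E x (a • u.1) / (W x : ℂ) = a * (_ / _)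
        rw [map_smul, smul_eq_mul, mul_div_assoc] }
  have hφ : ∀ u x, φ u x = OExp.eval E x u.1 / (W x : ℂ) := fun u x => rfl
  obtain ⟨γ, b, hγ0, hγ, hb1, hbcl, hsum⟩ := D.exists_nuclear_expansion
    (w₀ := fun n => N * P * (Q : ℝ) ^ n) (w₁ := fun n => N * (P : ℝ) ^ n) (w₂ := fun n => (N : ℝ) ^ n)
    (fun n => by positivity) (fun n => by positivity) (fun n => by positivity)
    (fun n => by
      rw [hQ]; push_cast
      rw [mul_pow _ ((P : ℝ) ^ 2), ← pow_mul, pow_succ]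
      exact le_of_eq (by ring))
    (fun n => by
      rw [hP]; push_cast
      rw [mul_pow _ ((N : ℝ) ^ 2), ← pow_mul, pow_succ]
      exact le_of_eq (by ring))
    hK (OExp.toHolomorphic E ∘ₗ V.subtype) φ
    (by
      rintro ⟨u, A, hA0, hA⟩
      refine ⟨A * N, fun n x hx => (hA x).trans ?_⟩
      have hlev : level K x ≤ n + 1 := level_le (by omega) (hK.pow_subset_pow n.le_succ hx)
      rw [mul_assoc, ← pow_succ']
      gcongr)
    (fun v t ht h => lp.norm_le_of_forall_le ht fun x => by
      rw [hφ, norm_div, Complex.norm_real, Real.norm_of_nonneg (hW0 x).le, div_le_iff₀ (hW0 x), hW]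
      exact h x)
  have hWn : ∀ x, (W x : ℂ) ≠ 0 := fun x => by exact_mod_cast (hW0 x).ne'
  have hlift : ∀ p, ∃ u : OExp E G, ∀ x, OExp.eval E x u = b p x * W x := fun p => by
    have hbx : ∀ x, ‖b p x * (W x : ℂ)‖ ≤ 1 * ((N * P * Q : ℕ) : ℝ) ^ level K x := fun x => by
      rw [norm_mul, Complex.norm_real, Real.norm_of_nonneg (hW0 x).le]
      exact mul_le_mul ((lp.norm_apply_le_norm ENNReal.top_ne_zero (b p) x).trans (hb1 p)) (hWM x)
        (hW0 x).le zero_le_one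
    refine exists_oExp_of_approx hK hM1 hbx fun ε hε => ?_
    obtain ⟨_, ⟨v, rfl⟩, hv⟩ := Metric.mem_closure_iff.1 (hbcl p) ε hε
    refine ⟨v.1, fun x => ?_⟩
    have h1 : OExp.eval E x v.1 - b p x * W x = (φ v - b p) x * W x := by
      rw [lp.coeFn_sub, Pi.sub_apply, hφ, sub_mul, div_mul_cancel₀ _ (hWn x)]
    have h2 : ‖(φ v - b p) x‖ ≤ ε := by
      refine (lp.norm_apply_le_norm ENNReal.top_ne_zero _ x).trans ?_
      rw [← dist_eq_norm, dist_comm]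
      exact hv.le
    rw [h1, norm_mul, Complex.norm_real, Real.norm_of_nonneg (hW0 x).le]
    exact mul_le_mul h2 (hWM x) (hW0 x).le hε.le
  choose B hB using hlift
  obtain ⟨e⟩ := nonempty_equiv_of_countable (α := ℕ) (β := ℕ × ℕ)
  let f : ℕ × ℕ → OExp E G →L[ℂ] ℂ := fun p =>
    ((((N : ℝ) ^ (2 * p.1 + 1))⁻¹ : ℝ) : ℂ) • ⟨OExp.eval E (D.z p.1 p.2), OExp.continuous_eval hK _⟩
  have hf : ∀ p u, f p u = ((((N : ℝ) ^ (2 * p.1 + 1))⁻¹ : ℝ) : ℂ) * OExp.eval E (D.z p.1 p.2) u :=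
    fun p u => rfl
  refine ⟨N * P * Q, γ ∘ e, fun n => UniformConvergenceCLM.ofFun _ _ _ (f (e n)), B ∘ e, hM1,
    fun j => hγ0 _, e.summable_iff.2 hγ, fun j u hu => ?_, fun j x => ?_, fun α u hu => ?_⟩
  · change ‖f (e j) u‖ ≤ 1
    rw [hf, norm_mul, Complex.norm_real, Real.norm_of_nonneg (by positivity),
      inv_mul_le_iff₀ (by positivity), mul_one]
    exact (hu _).trans (pow_le_pow_right₀ hN' (level_le (by omega) (D.z_mem _ _)))
  · rw [Function.comp_apply, hB, norm_mul, Complex.norm_real, Real.norm_of_nonneg (hW0 x).le]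
    exact (mul_le_of_le_one_left (hW0 x).le ((lp.norm_apply_le_norm ENNReal.top_ne_zero _ x).trans
      (hb1 _))).trans (hWM x)
  · have hmain : HasSum (fun p => (γ p : ℂ) * f p u * α (B p)) (α u) := by
      have huV : u ∈ V := ⟨1, zero_le_one, fun x => by simpa using hu x⟩
      obtain ⟨C, hC, hαC⟩ := exists_norm_dual_le hK α hM1
      have hs := hsum ⟨u, huV⟩
      rw [HasSum, SummationFilter.unconditional_filter, tendsto_iff_norm_sub_tendsto_zero] at hs
      have hs' := hs.mul_const C
      rw [zero_mul] at hs'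
      refine hasSum_of_norm_sub_sum_le hs' fun s => ?_
      have h1 : α u - ∑ p ∈ s, (γ p : ℂ) * f p u * α (B p)
          = α (u - ∑ p ∈ s, ((γ p : ℂ) * f p u) • B p) := by
        rw [map_sub, map_sum]
        simp only [map_smul, smul_eq_mul]
      rw [h1]
      refine norm_dual_le_of_le hαC (norm_nonneg _) fun x => ?_
      rw [norm_sub_rev (∑ p ∈ s, _)]
      set y : lp (fun _ : G => ℂ) ⊤ := φ ⟨u, huV⟩ - _ with hy
      have h2 : OExp.eval E x (u - ∑ p ∈ s, ((γ p : ℂ) * f p u) • B p) = y x * W x := by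
        rw [hy, lp.coeFn_sub, Pi.sub_apply, hφ, sub_mul, div_mul_cancel₀ _ (hWn x), map_sub, map_sum,
          lp.coeFn_sum, Finset.sum_apply, Finset.sum_mul]
        congr 1
        refine Finset.sum_congr rfl fun p _ => ?_
        rw [map_smul, hB]
        change (γ p * f p u : ℂ) * _ = (γ p : ℂ) * (_ * b p x) * _
        rw [hf]
        change _ = (γ p : ℂ) * ((((N : ℝ) ^ (2 * p.1 + 1))⁻¹ : ℝ) * OExp.eval E (D.z p.1 p.2) u
          * b p x) * _
        ring
      rw [h2, norm_mul, Complex.norm_real, Real.norm_of_nonneg (hW0 x).le]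
      exact mul_le_mul (lp.norm_apply_le_norm ENNReal.top_ne_zero y x) (hWM x) (hW0 x).le
        (norm_nonneg _)
    exact e.hasSum_iff.2 hmain

/-- Continuous linear maps from the stereotype dual of the space of functions of exponential type
into normed spaces have nuclear expansions in evaluations. -/
theorem exists_hasSum_dual [FiniteDimensional ℂ E] (hK : IsGeneratingNhd K) {Y : Type w}
    [NormedAddCommGroup Y] [NormedSpace ℂ Y] (ψ : StereotypeDual (OExp E G) →L[ℂ] Y) :
    ∃ (M : ℕ) (γ : ℕ → ℝ) (y : ℕ → Y) (b : ℕ → OExp E G), 1 ≤ M ∧ (∀ j, 0 ≤ γ j) ∧ Summable γ ∧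
      (∀ j, ‖y j‖ ≤ 1) ∧ (∀ j, b j ∈ expBall E K M) ∧
      ∀ α, HasSum (fun j => (γ j : ℂ) • α (b j) • y j) (ψ α) := by
  have hnhds : {α | ‖ψ α‖ ≤ 1} ∈ 𝓝 (0 : StereotypeDual (OExp E G)) := by
    have : Filter.Tendsto (fun α => ‖ψ α‖) (𝓝 0) (𝓝 0) := by
      simpa using (map_continuous ψ).norm.tendsto 0
    exact (this.eventually_lt_const one_pos).mono fun α h => h.le
  obtain ⟨N, hN, hNψ⟩ := (hasBasis_nhds_zero_dual hK).mem_iff.1 hnhds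
  have hψ : ∀ (β : StereotypeDual (OExp E G)) (r : ℝ), 0 ≤ r →
      (∀ u ∈ expBall E K N, ‖β u‖ ≤ r) → ‖ψ β‖ ≤ r := fun β r hr hβ => by
    refine le_of_forall_pos_le_add fun ε hε => ?_
    have hrε : 0 < r + ε := by linarith
    have h1 : (((r + ε)⁻¹ : ℝ) : ℂ) • β ∈ dualBall E K N := fun u hu => by
      change ‖(((r + ε)⁻¹ : ℝ) : ℂ) * β u‖ ≤ 1
      rw [norm_mul, Complex.norm_real, Real.norm_of_nonneg (by positivity), inv_mul_le_iff₀ hrε]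
      linarith [hβ u hu]
    have h2 : ‖ψ ((((r + ε)⁻¹ : ℝ) : ℂ) • β)‖ ≤ 1 := hNψ h1
    rwa [map_smul, norm_smul, Complex.norm_real, Real.norm_of_nonneg (by positivity),
      inv_mul_le_iff₀ hrε, mul_one] at h2
  obtain ⟨M, γ, f, b, hM, hγ0, hγ, hf, hb, hsum⟩ := exists_dual_expansion (E := E) hK hN
  refine ⟨M, γ, fun j => ψ (f j), b, hM, hγ0, hγ, fun j => hNψ (hf j), hb, fun α => ?_⟩
  obtain ⟨C, hC, hαC⟩ := exists_norm_dual_le hK α hM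
  refine hasSum_of_norm_sub_sum_le (hγ.hasSum.tendsto_mul_sub_sum C) fun s => ?_
  have h1 : ψ α - ∑ j ∈ s, (γ j : ℂ) • α (b j) • ψ (f j)
      = ψ (α - ∑ j ∈ s, ((γ j : ℂ) * α (b j)) • f j) := by
    rw [map_sub, map_sum]
    simp only [map_smul, mul_smul]
  rw [h1]
  refine hψ _ _ (mul_nonneg hC (sub_nonneg.2 (hγ.sum_le_tsum s fun j _ => hγ0 j))) fun u hu => ?_
  have h2 := (hsum α u hu).norm_sub_sum_le (hγ.hasSum.mul_left C) (fun j => by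
    rw [norm_mul, norm_mul, Complex.norm_real, Real.norm_of_nonneg (hγ0 j), mul_comm C]
    exact mul_le_mul (mul_le_of_le_one_right (hγ0 j) (hf j u hu)) (hαC _ (hb j)) (norm_nonneg _)
      (hγ0 j)) s
  rw [← Finset.mul_sum, ← mul_sub] at h2
  have h4 : (α - ∑ j ∈ s, ((γ j : ℂ) * α (b j)) • f j) u
      = α u - ∑ j ∈ s, (γ j : ℂ) * f j u * α (b j) := by
    rw [← StereotypeDual.sum_smul_apply]
    rfl
  rw [h4]
  exact h2

end DualExpansion

section StereotypeDuality

namespace StereotypeDual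

variable (X : Type u) [AddCommGroup X] [Module ℂ X] [TopologicalSpace X] [IsTopologicalAddGroup X]

theorem locallyConvexSpace : LocallyConvexSpace ℝ (StereotypeDual X) := by
  refine LocallyConvexSpace.ofBasisZero _ _ _ _ (hasBasis_nhds_zero X) ?_
  rintro ⟨S, r⟩ - f hf g hg a b ha hb hab x hx
  have hx' : a • f x + b • g x ∈ Metric.closedBall (0 : ℂ) r :=
    convex_closedBall (0 : ℂ) r (mem_closedBall_zero_iff.2 (hf x hx))
      (mem_closedBall_zero_iff.2 (hg x hx)) ha hb hab
  exact mem_closedBall_zero_iff.1 hx'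

theorem continuousSMul [ContinuousSMul ℂ X] : ContinuousSMul ℂ (StereotypeDual X) := by
  let _ : UniformSpace X := IsTopologicalAddGroup.rightUniformSpace X
  have : IsUniformAddGroup X := isUniformAddGroup_of_addCommGroup
  exact UniformConvergenceCLM.continuousSMul _ _ _ fun S hS => hS.isVonNBounded ℂ

theorem t2Space : T2Space (StereotypeDual X) := by
  refine UniformConvergenceCLM.t2Space _ _ _ (Set.eq_univ_of_forall fun y => Set.mem_sUnion.2
    ⟨{y}, ?_, rfl⟩)
  exact @totallyBounded_singleton X (IsTopologicalAddGroup.rightUniformSpace X) y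

variable {X} {Y : Type u} [AddCommGroup Y] [Module ℂ Y] [TopologicalSpace Y]
  [IsTopologicalAddGroup Y]

/-- The transpose of a continuous linear map. -/
noncomputable def transpose (L : X →L[ℂ] Y) : StereotypeDual Y →L[ℂ] StereotypeDual X :=
  ContinuousLinearMap.precompUniformConvergenceCLM ℂ _ _ L fun S hS => by
    let _ : UniformSpace X := IsTopologicalAddGroup.rightUniformSpace X
    let _ : UniformSpace Y := IsTopologicalAddGroup.rightUniformSpace Y
    have : IsUniformAddGroup X := isUniformAddGroup_of_addCommGroup
    have : IsUniformAddGroup Y := isUniformAddGroup_of_addCommGroup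
    exact TotallyBounded.image hS L.uniformContinuous

end StereotypeDual

namespace IsStereotype

variable {X : Type u} [AddCommGroup X] [Module ℂ X] [TopologicalSpace X] [IsTopologicalAddGroup X]

variable (X) in
/-- The natural map to the second dual as a linear map. -/
noncomputable def evalLinearMap : X →ₗ[ℂ] StereotypeDual (StereotypeDual X) where
  toFun := stereotypeEval X
  map_add' := fun x y => by
    ext f
    exact map_add f x y
  map_smul' := fun c x => by
    ext f
    exact map_smul f c x

/-- The natural isomorphism of a stereotype space with its second dual. -/
noncomputable def evalEquiv (h : IsStereotype X) : X ≃L[ℂ] StereotypeDual (StereotypeDual X) where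
  toLinearEquiv := LinearEquiv.ofBijective (evalLinearMap X) h.isHomeomorph.bijective
  continuous_toFun := h.isHomeomorph.continuous
  continuous_invFun := (Equiv.continuous_symm_iff
    (LinearEquiv.ofBijective (evalLinearMap X) h.isHomeomorph.bijective).toEquiv).2
      h.isHomeomorph.isOpenMap

/-- The dual of a stereotype space is stereotype. -/
theorem dual (h : IsStereotype X) : IsStereotype (StereotypeDual X) where
  continuousSMul := have := h.continuousSMul; StereotypeDual.continuousSMul X
  locallyConvex := StereotypeDual.locallyConvexSpace X
  isHomeomorph := by
    let T : StereotypeDual (StereotypeDual (StereotypeDual X)) →L[ℂ] StereotypeDual X :=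
      StereotypeDual.transpose (h.evalEquiv : X →L[ℂ] _)
    let S : StereotypeDual X →L[ℂ] StereotypeDual (StereotypeDual (StereotypeDual X)) :=
      StereotypeDual.transpose (h.evalEquiv.symm : _ →L[ℂ] X)
    have hS : ⇑S = stereotypeEval (StereotypeDual X) := by
      ext f φ
      obtain ⟨x, rfl⟩ := h.evalEquiv.surjective φ
      change f (h.evalEquiv.symm (h.evalEquiv x)) = f x
      rw [h.evalEquiv.symm_apply_apply]
    rw [← hS]
    refine isHomeomorph_iff_exists_inverse.2 ⟨S.continuous, T, fun f => ?_, fun φ => ?_,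
      T.continuous⟩
    · ext x
      change f (h.evalEquiv.symm (h.evalEquiv x)) = f x
      rw [h.evalEquiv.symm_apply_apply]
    · ext y
      change φ (h.evalEquiv (h.evalEquiv.symm y)) = φ y
      rw [h.evalEquiv.apply_symm_apply]

end IsStereotype

/-- Each neighbourhood of zero of a locally convex space contains the open unit ball of a continuous
seminorm. -/
theorem exists_continuous_seminorm_ball_subset {X : Type u} [AddCommGroup X] [Module ℂ X]
    [TopologicalSpace X] [IsTopologicalAddGroup X] [ContinuousSMul ℂ X] [LocallyConvexSpace ℝ X]
    {U : Set X} (hU : U ∈ 𝓝 0) :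
    ∃ p : Seminorm ℂ X, Continuous p ∧ ∀ x, p x < 1 → x ∈ U := by
  open scoped ComplexOrder in
  have : LocallyConvexSpace ℂ X := (locallyConvexSpace_iff_exists_convex_subset_zero ℂ X).2
    fun V hV => by
      obtain ⟨S, hS, hc, hSV⟩ := (locallyConvexSpace_iff_exists_convex_subset_zero ℝ X).1
        inferInstance V hV
      exact ⟨S, hS, convex_of_nonneg_surjective_algebraMap _
        (fun _ hx => RCLike.nonneg_iff_exists_ofReal.mp hx) hc, hSV⟩
  have : ContinuousSMul ℝ X := IsScalarTower.continuousSMul ℂ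
  obtain ⟨s, hs, hsU⟩ := (nhds_hasBasis_absConvex_open ℂ X).mem_iff.1 hU
  let t : AbsConvexOpenSets ℂ X := ⟨s, hs⟩
  refine ⟨gaugeSeminormFamily ℂ X t, with_gaugeSeminormFamily.continuous_seminorm t,
    fun x hx => hsU ?_⟩
  have hxt : x ∈ (gaugeSeminormFamily ℂ X t).ball 0 1 := by rwa [Seminorm.mem_ball_zero]
  rw [gaugeSeminormFamily_ball] at hxt
  exact hxt

end StereotypeDuality

section OExpDual

variable {E : Type v} [NormedAddCommGroup E] [NormedSpace ℂ E]
variable {G : Type u} [TopologicalSpace G] [ChartedSpace E G] [Group G] {K : Set G}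

variable [LieGroup 𝓘(ℂ, E) ω G] [IsTopologicalGroup G] [WeaklyLocallyCompactSpace G]

theorem isCountablyGenerated_nhds_dual (hK : IsGeneratingNhd K) :
    (𝓝 (0 : StereotypeDual (OExp E G))).IsCountablyGenerated :=
  (hasBasis_nhds_zero_dual hK).isCountablyGenerated

theorem exists_tendsto_dual (hK : IsGeneratingNhd K) {α : ℕ → StereotypeDual (OExp E G)}
    (hα : ∀ N : ℕ, 1 ≤ N → ∃ n₀, ∀ m ≥ n₀, ∀ n ≥ n₀, α m - α n ∈ dualBall E K N) :
    ∃ β, Filter.Tendsto α Filter.atTop (𝓝 β) := by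
  have hc : ∀ u, CauchySeq fun n => α n u := fun u => by
    obtain ⟨N, hN, hu⟩ := exists_mem_expBall hK u
    rw [Metric.cauchySeq_iff]
    intro ε hε
    obtain ⟨r, hr⟩ := exists_nat_gt (1 / ε)
    have hr0 : (0 : ℝ) < r := (by positivity : (0 : ℝ) < 1 / ε).trans hr
    have hr1 : 1 ≤ r := by exact_mod_cast hr0
    obtain ⟨n₀, h⟩ := hα (r * N) (Nat.mul_pos hr1 hN)
    refine ⟨n₀, fun m hm n hn => ?_⟩
    rw [dist_eq_norm]
    exact (mem_dualBall_of_forall_smul hK hr1 (h m hm n hn) hu).trans_lt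
      ((one_div_lt hε hr0).1 hr)
  choose g hg using fun u => cauchySeq_tendsto_of_complete (hc u)
  let L : OExp E G →ₗ[ℂ] ℂ := linearMapOfTendsto g (fun n => (α n : OExp E G →L[ℂ] ℂ).toLinearMap)
    (tendsto_pi_nhds.2 hg)
  have hbound : ∀ N : ℕ, 1 ≤ N → ∃ n₀, ∀ n ≥ n₀, ∀ u ∈ expBall E K N, ‖α n u - L u‖ ≤ 1 :=
    fun N hN => by
      obtain ⟨n₀, h⟩ := hα N hN
      refine ⟨n₀, fun n hn u hu => le_of_tendsto ((hg u).const_sub (α n u)).norm ?_⟩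
      filter_upwards [Filter.eventually_ge_atTop n₀] with m hm
      exact h n hn m hm u hu
  have hL : Continuous L := continuous_linearMap_oExp hK L fun N hN => by
    obtain ⟨n₀, h⟩ := hbound N hN
    obtain ⟨C, hC, hCα⟩ := exists_norm_dual_le hK (α n₀) hN
    refine ⟨C + 1, fun u hu => ?_⟩
    calc ‖L u‖ = ‖α n₀ u - (α n₀ u - L u)‖ := by rw [sub_sub_cancel]
      _ ≤ ‖α n₀ u‖ + ‖α n₀ u - L u‖ := norm_sub_le _ _
      _ ≤ C + 1 := add_le_add (hCα u hu) (h n₀ le_rfl u hu)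
  let β : StereotypeDual (OExp E G) := UniformConvergenceCLM.ofFun _ _ _ ⟨L, hL⟩
  refine ⟨β, tendsto_sub_nhds_zero_iff.1 ((hasBasis_nhds_zero_dual hK).tendsto_right_iff.2
    fun N hN => ?_)⟩
  obtain ⟨n₀, h⟩ := hbound N hN
  filter_upwards [Filter.eventually_ge_atTop n₀] with n hn
  exact h n hn

theorem isFrechetSpace_dual (hK : IsGeneratingNhd K) :
    IsFrechetSpace (StereotypeDual (OExp E G)) := by
  let _ : UniformSpace (StereotypeDual (OExp E G)) := IsTopologicalAddGroup.rightUniformSpace _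
  have : IsUniformAddGroup (StereotypeDual (OExp E G)) := isUniformAddGroup_of_addCommGroup
  have := isCountablyGenerated_nhds_dual (E := E) hK
  have : (uniformity (StereotypeDual (OExp E G))).IsCountablyGenerated :=
    IsUniformAddGroup.uniformity_countably_generated
  have := StereotypeDual.t2Space (OExp E G)
  refine ⟨StereotypeDual.continuousSMul _, StereotypeDual.locallyConvexSpace _,
    UniformSpace.metrizableSpace, UniformSpace.complete_of_cauchySeq_tendsto fun α hα => ?_⟩
  refine exists_tendsto_dual hK fun N hN => ?_
  have hN' : {p : StereotypeDual (OExp E G) × StereotypeDual (OExp E G) |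
      p.2 - p.1 ∈ dualBall E K N} ∈ uniformity _ := by
    rw [uniformity_eq_comap_nhds_zero]
    exact Filter.preimage_mem_comap ((hasBasis_nhds_zero_dual hK).mem_of_mem hN)
  obtain ⟨n₀, h⟩ := cauchySeq_iff.1 hα _ hN'
  exact ⟨n₀, fun m hm n hn => h n hn m hm⟩

/-- Totally bounded sets of functionals are bounded on each `expBall E K N`. -/
theorem exists_forall_norm_dual_le (hK : IsGeneratingNhd K) {A : Set (StereotypeDual (OExp E G))}
    (hA : @TotallyBounded _ (IsTopologicalAddGroup.rightUniformSpace _) A) {N : ℕ} (hN : 1 ≤ N) :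
    ∃ C : ℝ, 0 < C ∧ ∀ α ∈ A, ∀ u ∈ expBall E K N, ‖α u‖ ≤ C := by
  let _ : UniformSpace (StereotypeDual (OExp E G)) := IsTopologicalAddGroup.rightUniformSpace _
  have : IsUniformAddGroup (StereotypeDual (OExp E G)) := isUniformAddGroup_of_addCommGroup
  obtain ⟨t, ht, hAt⟩ := totallyBounded_iff_subset_finite_iUnion_nhds_zero.1 hA _
    ((hasBasis_nhds_zero_dual hK).mem_of_mem hN)
  choose c hc0 hc using fun α => exists_norm_dual_le (E := E) hK α hN
  refine ⟨∑ β ∈ ht.toFinset, c β + 1, by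
    have := Finset.sum_nonneg fun β (_ : β ∈ ht.toFinset) => hc0 β
    linarith, fun α hα u hu => ?_⟩
  obtain ⟨β, hβ, δ, hδ, rfl⟩ := Set.mem_iUnion₂.1 (hAt hα)
  calc ‖β u + δ u‖ ≤ ‖β u‖ + ‖δ u‖ := norm_add_le _ _
    _ ≤ ∑ β ∈ ht.toFinset, c β + 1 := add_le_add ((hc β u hu).trans
        (Finset.single_le_sum (fun β _ => hc0 β) (ht.mem_toFinset.2 hβ))) (hδ u hu)

variable [FiniteDimensional ℂ E]

/-- Sets of functionals which are bounded on each `expBall E K N` are totally bounded. -/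
theorem totallyBounded_dual (hK : IsGeneratingNhd K) {A : Set (StereotypeDual (OExp E G))}
    (hA : ∀ N : ℕ, 1 ≤ N → ∃ C : ℝ, ∀ α ∈ A, ∀ u ∈ expBall E K N, ‖α u‖ ≤ C) :
    @TotallyBounded _ (IsTopologicalAddGroup.rightUniformSpace _) A := by
  let _ : UniformSpace (StereotypeDual (OExp E G)) := IsTopologicalAddGroup.rightUniformSpace _
  have : IsUniformAddGroup (StereotypeDual (OExp E G)) := isUniformAddGroup_of_addCommGroup
  have := StereotypeDual.continuousSMul (OExp E G)
  refine totallyBounded_iff_subset_finite_iUnion_nhds_zero.2 fun U hU => ?_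
  obtain ⟨V, hV, hVU⟩ := exists_nhds_zero_half hU
  obtain ⟨N, hN, hNV⟩ := (hasBasis_nhds_zero_dual hK).mem_iff.1 hV
  obtain ⟨M, γ, f, b, hM, hγ0, hγ, hf, hb, hsum⟩ := exists_dual_expansion (E := E) hK hN
  obtain ⟨C, hC⟩ := hA M hM
  obtain ⟨s, hs⟩ : ∃ s : Finset ℕ, C * (∑' j, γ j - ∑ j ∈ s, γ j) ≤ 1 :=
    ((hγ.hasSum.tendsto_mul_sub_sum C).eventually_le_const one_pos).exists
  let Λ : (ℕ → ℂ) → StereotypeDual (OExp E G) := fun a => ∑ j ∈ s, ((γ j : ℂ) * a j) • f j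
  have hΛ : Continuous Λ := continuous_finsetSum s fun j _ =>
    (continuous_const.mul (continuous_apply j)).smul continuous_const
  have hcomp : IsCompact (Λ '' Set.univ.pi fun _ => Metric.closedBall 0 C) :=
    (isCompact_univ_pi fun _ => isCompact_closedBall (0 : ℂ) C).image hΛ
  obtain ⟨t, ht, hcov⟩ := totallyBounded_iff_subset_finite_iUnion_nhds_zero.1
    hcomp.totallyBounded V hV
  refine ⟨t, ht, fun α hα => ?_⟩
  have hmem : Λ (fun j => α (b j)) ∈ Λ '' Set.univ.pi fun _ => Metric.closedBall 0 C :=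
    ⟨_, fun j _ => mem_closedBall_zero_iff.2 (hC α hα _ (hb j)), rfl⟩
  obtain ⟨β, hβ, δ, hδ, hβδ⟩ := Set.mem_iUnion₂.1 (hcov hmem)
  have hrest : α - Λ (fun j => α (b j)) ∈ dualBall E K N := fun u hu => by
    have h := (hsum α u hu).norm_sub_sum_le (hγ.hasSum.mul_left C) (fun j => by
      rw [norm_mul, norm_mul, Complex.norm_real, Real.norm_of_nonneg (hγ0 j), mul_comm C]
      exact mul_le_mul (mul_le_of_le_one_right (hγ0 j) (hf j u hu)) (hC α hα _ (hb j))
        (norm_nonneg _) (hγ0 j)) s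
    rw [← Finset.mul_sum, ← mul_sub] at h
    have h4 : (α - Λ fun j => α (b j)) u = α u - ∑ j ∈ s, (γ j : ℂ) * f j u * α (b j) := by
      rw [← StereotypeDual.sum_smul_apply]
      rfl
    rw [h4]
    exact h.trans hs
  refine Set.mem_iUnion₂.2 ⟨β, hβ, δ + (α - Λ fun j => α (b j)), hVU _ hδ _ (hNV hrest), ?_⟩
  change β + (δ + (α - Λ fun j => α (b j))) = α
  have hβδ' : β + δ = Λ fun j => α (b j) := hβδ
  rw [← add_assoc, hβδ', add_sub_cancel]

theorem isStereotype_oExp (hK : IsGeneratingNhd K) : IsStereotype (OExp E G) where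
  continuousSMul := inferInstance
  locallyConvex := inferInstance
  isHomeomorph := by
    have hev : ∀ x, ∃ α : StereotypeDual (OExp E G), ∀ u, α u = OExp.eval E x u := fun x =>
      ⟨UniformConvergenceCLM.ofFun _ _ _ ⟨OExp.eval E x, OExp.continuous_eval hK x⟩, fun u => rfl⟩
    choose δ hδ using hev
    have hinj : Function.Injective (stereotypeEval (OExp E G)) := fun u v huv =>
      OExp.ext_eval fun x => by
        rw [← hδ, ← hδ]
        exact DFunLike.congr_fun huv (δ x)
    have hsurj : Function.Surjective (stereotypeEval (OExp E G)) := fun Φ => by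
      obtain ⟨M, γ, y, b, hM, hγ0, hγ, hy, hb, hΦ⟩ := exists_hasSum_dual (E := E) hK
        (Φ : StereotypeDual (OExp E G) →L[ℂ] ℂ)
      obtain ⟨u, hu⟩ := exists_oExp_hasSum hK hM hb hγ (a := fun j => γ j * y j) fun j => by
        rw [norm_mul, Complex.norm_real, Real.norm_of_nonneg (hγ0 j)]
        exact mul_le_of_le_one_right (hγ0 j) (hy j)
      refine ⟨u, ?_⟩
      ext α
      refine (hu α).unique ((hΦ α).congr_fun ?_)
      intro j
      simp only [smul_eq_mul]
      ring
    have hcont : Continuous (IsStereotype.evalLinearMap (OExp E G)) := by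
      refine continuous_of_continuousAt_zero _ ?_
      rw [ContinuousAt, map_zero]
      refine (StereotypeDual.hasBasis_nhds_zero _).tendsto_right_iff.2 ?_
      rintro ⟨A, r⟩ ⟨hA, hr⟩
      refine mem_nhds_zero_oExp hK (Q := {u | ∀ α ∈ A, ‖α u‖ ≤ r}) ?_ ?_ fun N hN => ?_
      · rw [balanced_iff_smul_mem]
        intro a ha u hu α hα
        rw [map_smul, norm_smul]
        exact (mul_le_of_le_one_left (norm_nonneg _) ha).trans (hu α hα)
      · intro u hu v hv a b ha hb hab α hα
        have : α (a • u + b • v) = a • α u + b • α v := by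
          rw [map_add]
          exact congr_arg₂ (· + ·) (map_smul α (a : ℂ) u) (map_smul α (b : ℂ) v)
        rw [this]
        exact mem_closedBall_zero_iff.1 (convex_closedBall (0 : ℂ) r
          (mem_closedBall_zero_iff.2 (hu α hα)) (mem_closedBall_zero_iff.2 (hv α hα)) ha hb hab)
      · obtain ⟨C, hC, hCA⟩ := exists_forall_norm_dual_le hK hA hN
        refine ⟨r / C, by positivity, fun u hu α hα => ?_⟩
        rw [map_smul, norm_smul, Complex.norm_real, Real.norm_of_nonneg (by positivity)]
        calc r / C * ‖α u‖ ≤ r / C * C := by gcongr; exact hCA α hα u hu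
          _ = r := div_mul_cancel₀ _ hC.ne'
    have hopen : ∀ U ∈ 𝓝 (0 : OExp E G), stereotypeEval (OExp E G) '' U ∈ 𝓝 0 := fun U hU => by
      obtain ⟨p, hp, hpU⟩ := exists_continuous_seminorm_ball_subset hU
      obtain ⟨w, hw0, hw, hpw⟩ := exists_weight_seminorm_le hK hp
      let A : Set (StereotypeDual (OExp E G)) :=
        Set.range fun x => (((w (level K x))⁻¹ : ℝ) : ℂ) • δ x
      have hAapp : ∀ x u, ((((w (level K x))⁻¹ : ℝ) : ℂ) • δ x) u
          = (((w (level K x))⁻¹ : ℝ) : ℂ) * OExp.eval E x u := fun x u => by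
        rw [← hδ]
        rfl
      have hA := totallyBounded_dual hK (A := A) fun N hN => by
        obtain ⟨C, hC⟩ := hw N hN
        refine ⟨C, ?_⟩
        rintro _ ⟨x, rfl⟩ u hu
        have := hw0 (level K x)
        rw [hAapp, norm_mul, Complex.norm_real, Real.norm_of_nonneg (by positivity),
          inv_mul_le_iff₀ this, mul_comm]
        exact (hu x).trans (hC _)
      filter_upwards [(StereotypeDual.hasBasis_nhds_zero _).mem_of_mem
        (i := (A, 1 / 2)) ⟨hA, by norm_num⟩] with Φ hΦ
      obtain ⟨u, rfl⟩ := hsurj Φ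
      refine ⟨u, hpU u ((hpw u (1 / 2) (by norm_num) fun x => ?_).trans_lt (by norm_num)), rfl⟩
      have h1 : ‖((((w (level K x))⁻¹ : ℝ) : ℂ) • δ x) u‖ ≤ 1 / 2 := hΦ _ ⟨x, rfl⟩
      have := hw0 (level K x)
      rwa [hAapp, norm_mul, Complex.norm_real, Real.norm_of_nonneg (by positivity),
        inv_mul_le_iff₀ this, mul_comm] at h1
    refine ⟨hcont, ?_, hinj, hsurj⟩
    refine IsTopologicalAddGroup.isOpenMap_iff_nhds_zero
      (f := (IsStereotype.evalLinearMap (OExp E G)).toAddMonoidHom).2 fun U hU => ?_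
    have := hopen _ (Filter.mem_map.1 hU)
    exact Filter.mem_of_superset this (Set.image_preimage_subset _ _)

theorem isNuclearMap_dual (hK : IsGeneratingNhd K) {Y : Type w} [NormedAddCommGroup Y]
    [NormedSpace ℂ Y] [CompleteSpace Y] (ψ : StereotypeDual (OExp E G) →L[ℂ] Y) :
    IsNuclearMap ψ := by
  have := StereotypeDual.continuousSMul (OExp E G)
  obtain ⟨M, γ, y, b, hM, hγ0, hγ, hy, hb, hψ⟩ := exists_hasSum_dual (E := E) hK ψ
  refine IsNuclearMap.of_hasSum (fun j => stereotypeEval (OExp E G) (b j)) y γ ?_ hy hγ0 hγ hψ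
  exact Filter.mem_of_superset ((hasBasis_nhds_zero_dual hK).mem_of_mem hM)
    fun α hα j => hα _ (hb j)

end OExpDual

theorem mainTheorem8 (E : Type v) [NormedAddCommGroup E] [NormedSpace ℂ E] [FiniteDimensional ℂ E]
    (G : Type u) [TopologicalSpace G] [T2Space G] [ChartedSpace E G] [Group G]
    [LieGroup 𝓘(ℂ, E) ω G] (hStein : IsSteinManifold E G) (hG : IsCompactlyGeneratedGroup G) :
    (IsBraunerSpace (OExp E G) ∧ IsNuclearSpace.{u, w} (OExp E G)) ∧
    (IsFrechetSpace (StereotypeDual (OExp E G)) ∧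
      IsNuclearSpace.{u, w} (StereotypeDual (OExp E G))) ∧
    (∀ K : Set G, IsCompact K → K ∈ 𝓝 1 → ⋃ n : ℕ, K ^ n = Set.univ →
      ∀ N : ℕ, 1 ≤ N → ∃ M : ℕ, N < M ∧
        IsAbsolutelySummingInclusion (powerRectangle E K N) (powerRectangle E K M)) := by
  have : IsTopologicalGroup G := topologicalGroup_of_lieGroup 𝓘(ℂ, E) ω
  have : LocallyCompactSpace G := Manifold.locallyCompact_of_finiteDimensional 𝓘(ℂ, E)
  obtain ⟨K, hK⟩ := hG.exists_isGeneratingNhd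
  have hX := isStereotype_oExp (E := E) hK
  have hF := isFrechetSpace_dual (E := E) hK
  exact ⟨⟨⟨_, _, _, _, _, hF, ⟨hX.evalEquiv⟩⟩, hX, fun Y _ _ _ φ => isNuclearMap_oExp hK φ⟩,
    ⟨hF, hX.dual, fun Y _ _ _ ψ => isNuclearMap_dual hK ψ⟩,
    fun L hL hL1 hLu N hN => exists_isAbsolutelySummingInclusion ⟨hL, hL1, hLu⟩ hN⟩
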